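/- **Setting.** Let $q\in\mathbb C^*$ not be a root of unity, $2s\in\mathbb Z_{\ge 0}$, $m_0\in\mathbb Z$, $\zeta,\chi\in\mathbb C^*$, and let $b,c,b^*,c^*\in\mathbb C^*$ satisfy $bc=b^*c^*$. Write $\mathfrak b(x)=x-x^{-1}$, $[X,Y]_q=qXY-q^{-1}YX$, $[n]_q=\frac{q^n-q^{-n}}{q-q^{-1}}$, $$\theta_M=bq^{2M}+cq^{-2M},\qquad \theta^*_N=b^*q^{2N}+c^*q^{-2N},\qquad \kappa=bq^{2s}+cq^{-2s},\qquad \kappa^*=b^*q^{2s}+c^*q^{-2s},$$ $Z=\zeta^2+\zeta^{-2}$, $W=q^{2s+1}+q^{-2s-1}$, $Q=q^2-q^{-2}$, and $$\rho=-bcQ^2,\quad \omega=(q-q^{-1})^2(bcZW-\kappa\kappa^*),\quad \eta=-\tfrac{Q^2}{q+q^{-1}}bc(\kappa Z-\kappa^*W),\quad \eta^*=-\tfrac{Q^2}{q+q^{-1}}b^*c^*(\kappa^* Z-\kappa W).$$ Let $\mathsf{AW}$ be the Askey–Wilson algebra, generated by $\mathsf A,\mathsf A^*$ with relations $[\mathsf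 A,[\mathsf A,\mathsf A^*]_q]_{q^{-1}}=\rho\mathsf A^*+\omega\mathsf A+\eta$ and $[\mathsf A^*,[\mathsf A^*,\mathsf A]_q]_{q^{-1}}=\rho\mathsf A+\omega\mathsf A^*+\eta^*$. Let $\pi$ be an irreducible representation of $\mathsf{AW}$ on a complex vector space $\mathcal V$ of dimension $2s+1$ in which $\pi(\mathsf A)$, $\pi(\mathsf A^*)$ are diagonalizable, with pairwise distinct eigenvalues $\theta_0,\dots,\theta_{2s}$ and pairwise distinct eigenvalues $\theta^*_0,\dots,\theta^*_{2s}$ respectively. Fix any eigenbases $|\theta_M\rangle$, $|\theta^*_N\rangle$ of $\mathcal V$ and $\langle\theta_M|$, $\langle\theta^*_N|$ of the dual space, and define coefficients by $$\pi(\mathsf A^*)|\theta_M\rangle=\sum_{M'}A^*_{M',M}|\theta_{M'}\rangle,\quad \pi(\mathsf A)|\theta^*_N\rangle=\sum_{N'}A_{N',N}|\theta^*_{N'}\rangle,\quad \langle\theta_M|\pi(\mathsf A^*)=\sum_{M'}\langle\theta_{M'}|\tilde A^*_{M,M'},\quad \langle\theta^*_N|\pi(\mathsf A)=\sum_{N'}\langle\theta^*_{N'}|\tilde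 A_{N,N'},$$ $|\theta^*_N\rangle=\sum_M P_{MN}|\theta_M\rangle$, $\xi_M=\langle\theta_M|\theta_M\rangle$, $\xi^*_N=\langle\theta^*_N|\theta^*_N\rangle$. The reference states are $|\Omega^-\rangle=|\theta_0\rangle$, $|\Omega^+\rangle=|\theta_0^*\rangle$, $\langle\Omega^-|=\langle\theta_0|$, $\langle\Omega^+|=\langle\theta^*_0|$. **Dynamical operators.** With $\bar\eta(x,y;u)=(q+q^{-1})\rho^{-1}(xu+yu^{-1})$ let $K(u)$ be the $2\times2$ matrix over $\mathsf{AW}$ with entries $$K_{11}(u)=\mathfrak b(u^2)(qu\mathsf A-q^{-1}u^{-1}\mathsf A^*)-\bar\eta(\eta,\eta^*;u),\qquad K_{22}(u)=\mathfrak b(u^2)(qu\mathsf A^*-q^{-1}u^{-1}\mathsf A)-\bar\eta(\eta^*,\eta;u),$$ $$K_{12}(u)=\chi \mathfrak b(u^2)\Big(\rho^{-1}\big([\mathsf A^*,\mathsf A]_q+\tfrac{\omega}{q-q^{-1}}\big)+\tfrac{qu^2+q^{-1}u^{-2}}{Q}\Big),\qquad K_{21}(u)=\rho\chi^{-1} \mathfrak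 b(u^2)\Big(\rho^{-1}\big([\mathsf A,\mathsf A^*]_q+\tfrac{\omega}{q-q^{-1}}\big)+\tfrac{qu^2+q^{-1}u^{-2}}{Q}\Big).$$ For $\epsilon=\pm1$, $\alpha,\beta\in\mathbb C$ put $\gamma^\epsilon(u,m)=\alpha^{\frac{1-\epsilon}2}\beta^{\frac{1+\epsilon}2}q^{-m}u-\alpha^{\frac{1+\epsilon}2}\beta^{\frac{1-\epsilon}2}q^{m}u^{-1}$, $L^\epsilon(u,x)=(1,\,-xu^{\epsilon})\,K(u)\,(xu^{-\epsilon},\,1)^t$ and $$\mathscr B^\epsilon(u,m)=-\frac{\epsilon q^{-\epsilon}u^{-\epsilon}}{\gamma^\epsilon(1,m+1)}L^\epsilon(u,\beta q^{-\epsilon m}),\qquad \mathscr C^\epsilon(u,m)=\frac{\epsilon q^{-\epsilon}u^{-\epsilon}}{\gamma^\epsilon(1,m-1)}L^\epsilon(u,\alpha q^{\epsilon m}).$$ The Bethe states and dual Bethe states are $$|\Psi_\pm^M(\bar u,m_0)\rangle=\pi\big(\mathscr B^\pm(u_1,m_0+2(M-1))\cdots\mathscr B^\pm(u_M,m_0)\big)|\Omega^\pm\rangle,\qquad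 \langle\Psi_\pm^N(\bar v,m_0)|=\langle\Omega^\pm|\pi\big(\mathscr C^\pm(v_1,m_0+2)\cdots\mathscr C^\pm(v_N,m_0+2N)\big),$$ where $\beta=0$ and $Q\chi^{-1}\alpha bq^{-m_0}=-1$ for $|\Psi_-\rangle$, $\beta=0$ and $Q\chi^{-1}\alpha c^*q^{m_0}=1$ for $|\Psi_+\rangle$, $\alpha=0$ and $Q\chi^{-1}\beta cq^{m_0-2}=-1$ for $\langle\Psi_-|$, $\alpha=0$ and $Q\chi^{-1}\beta b^*q^{-m_0+2}=1$ for $\langle\Psi_+|$. **Bethe equations.** Put $f(u,v)=\frac{\mathfrak b(qv/u)\mathfrak b(uv)}{\mathfrak b(v/u)\mathfrak b(quv)}$, $h(u,v)=\frac{\mathfrak b(q^2uv)\mathfrak b(qu/v)}{\mathfrak b(quv)\mathfrak b(u/v)}$, $$\Lambda_1^\epsilon(u)=\tfrac{q^{-2s-1}}{u^\epsilon}(q^{2s+1}u\zeta^{-1}-u^{-1}\zeta)(q^{2s+1}u\zeta-u^{-1}\zeta^{-1})(uc^*q^{-2s}+u^{-1}bq^{2s})\Big(u\big(\tfrac{c}{c^*}\big)^{\frac{1-\epsilon}2}+u^{-1}\big(\tfrac{b^*}{b}\big)^{\frac{1+\epsilon}2}\Big),$$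 $$\Lambda_2^\epsilon(u)=\tfrac{\mathfrak b(u^2)q^{-2s-1}}{u^\epsilon \mathfrak b(qu^2)}(q^{2s-1}u^{-1}\zeta-u\zeta^{-1})(q^{2s-1}u^{-1}\zeta^{-1}-u\zeta)(q^2ubq^{2s}+u^{-1}c^*q^{-2s})\Big(q^2u\big(\tfrac{b^*}{b}\big)^{\frac{1+\epsilon}2}+u^{-1}\big(\tfrac{c}{c^*}\big)^{\frac{1-\epsilon}2}\Big),$$ and for a tuple $\bar u$ write $f_i=\prod_{j\ne i}f(u_i,u_j)$, $h_i=\prod_{j\neq i}h(u_i,u_j)$ and, for length $2s$, $$T_i=\frac{\mathfrak b(u_i^2)}{\mathfrak b(q)}\,\frac{\prod_{k=0}^{2s}\mathfrak b(q^{1/2+k-s}\zeta u_i)\,\mathfrak b(q^{1/2+k-s}\zeta^{-1}u_i)}{\prod_{j\ne i}\mathfrak b(u_iu_j^{-1})\,\mathfrak b(qu_iu_j)}.$$ Define $$E^M_\pm(u_i,\bar u_i)=-\tfrac{\mathfrak b(u_i^2)}{\mathfrak b(qu_i^2)}f_i\Lambda_1^\pm(u_i)+h_i\Lambda_2^\pm(u_i)\quad(\text{length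 }M),$$ $$E_\pm(u_i,\bar u_i)=\tfrac{\mathfrak b(u_i^2)}{\mathfrak b(qu_i^2)}u_i^{\pm1}f_i\Lambda^\pm_1(u_i)-(q^2u_i^3)^{\mp1}h_i\Lambda_2^\pm(u_i)+\nu_\pm u_i^{\mp2}T_i,\qquad \nu_+=q^{-1-4s}c^*,\ \nu_-=q^{1+4s}b,$$ $$\tilde E_\pm(u_i,\bar u_i)=\tfrac{\mathfrak b(u_i^2)}{\mathfrak b(qu_i^2)}u_i^{\mp1}f_i\Lambda^\pm_1(u_i)-(q^2u_i^3)^{\pm1}h_i\Lambda_2^\pm(u_i)+\tilde\nu_\pm T_i,\qquad \tilde\nu_+=q^{1+4s}b^*,\ \tilde\nu_-=q^{-1-4s}c$$ (the last two for length $2s$). A tuple is *non-trivial admissible* if $u_i\ne0$, $u_i^2\neq u_i^{-2}$, $\mathfrak b(qu_i^2)\ne0$ for all $i$ and the numbers $U_i=(qu_i^2+q^{-1}u_i^{-2})/(q+q^{-1})$ are pairwise distinct. Write $\sigma(\bar u)=\sum_{j=1}^{2s}(qu_j^2+q^{-1}u_j^{-2})$. For $0\le M,N\le 2s$ let $S_-^{M(h)}$,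 $S_+^{*N(h)}$, $S_+^{M(i)}$, $S_-^{*N(i)}$, $dS_+^{M(i)}$, $dS_-^{*N(i)}$ denote non-trivial admissible tuples (the first two of length $M$, $N$, the others of length $2s$) such that, for every index $j$: - $S_-^{M(h)}$: $E_-^M(u_j,\bar u_j)=0$; $\quad S_+^{*N(h)}$: $E_+^N(u_j,\bar u_j)=0$; - $S_+^{M(i)}$: $E_+(u_j,\bar u_j)=0$ and $\theta_M=q^{-4s}\big(c^*Z[2s]_q+q^{2s}\kappa-qc^*\sigma(\bar u)\big)$; - $S_-^{*N(i)}$: $E_-(u_j,\bar u_j)=0$ and $\theta^*_N=q^{4s}\big(bZ[2s]_q+q^{-2s}\kappa^*-q^{-1}b\,\sigma(\bar u)\big)$; - $dS_+^{M(i)}$: $\tilde E_+(u_j,\bar u_j)=0$ and $\theta_M=q^{4s}\big(b^*Z[2s]_q+q^{-2s}\kappa-q^{-1}b^*\sigma(\bar u)\big)$; - $dS_-^{*N(i)}$: $\tilde E_-(u_j,\bar u_j)=0$ and $\theta^*_N=q^{-4s}\big(cZ[2s]_q+q^{2s}\kappa^*-qc\,\sigma(\bar u)\big)$. *Hypothesis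 1* (resp. *2*, *3*) says that for all $0\le M,N\le2s$ tuples $S_-^{M(h)}$ and $S_+^{*N(h)}$ (resp. $S_+^{M(i)}$ and $S_-^{*N(i)}$; resp. $dS_+^{M(i)}$ and $dS_-^{*N(i)}$) exist. **Normalizations.** Put $$\mathcal N_M(\bar u)=\prod_{k=1}^M\big(qu_k\mathfrak b(u_k^2)A^*_{k,k-1}\big)^{-1},\qquad \mathcal N^*_N(\bar w)=\prod_{k=1}^N\big(-q^{-1}w_k^{-1}\mathfrak b(w_k^2)A_{k,k-1}\big)^{-1},$$ $$\tilde{\mathcal N}_M(\bar v)=\prod_{k=1}^M\big(q^{-1}v_k\mathfrak b(v_k^2)\tilde A^*_{k-1,k}\big)^{-1},\qquad \tilde{\mathcal N}^*_N(\bar y)=\prod_{k=1}^N\big(-qy_k^{-1}\mathfrak b(y_k^2)\tilde A_{k-1,k}\big)^{-1},$$ $$\mathcal N_M^{(i)}=\mathcal N^*_{2s}(P^{-1})_{2s,M},\quad \mathcal N_N^{*(i)}=\mathcal N_{2s}P_{2s,N},\quad \tilde{\mathcal N}^{(i)}_M=\tilde{\mathcal N}^*_{2s}P_{M,2s}\frac{\xi_M}{\xi^*_{2s}},\quad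 \tilde{\mathcal N}^{*(i)}_N=\tilde{\mathcal N}_{2s}(P^{-1})_{N,2s}\frac{\xi^*_N}{\xi_{2s}}.$$ **Statement.** For all $0\le M,N\le 2s$ and all tuples of the indicated types, $$\mathcal N_M(\bar u)|\Psi_-^M(\bar u,m_0)\rangle=\mathcal N_M^{(i)}(\bar u')|\Psi_+^{2s}(\bar u',m_0)\rangle\quad\text{for }\bar u=S_-^{M(h)},\ \bar u'=S_+^{M(i)},$$ $$\mathcal N^*_N(\bar w)|\Psi_+^N(\bar w,m_0)\rangle=\mathcal N_N^{*(i)}(\bar w')|\Psi_-^{2s}(\bar w',m_0)\rangle\quad\text{for }\bar w=S_+^{*N(h)},\ \bar w'=S_-^{*N(i)},$$ $$\tilde{\mathcal N}_M(\bar v)\langle\Psi_-^M(\bar v,m_0)|=\tilde{\mathcal N}_M^{(i)}(\bar v')\langle\Psi_+^{2s}(\bar v',m_0)|\quad\text{for }\bar v=S_-^{M(h)},\ \bar v'=dS_+^{M(i)},$$ $$\tilde{\mathcal N}^*_N(\bar y)\langle\Psi_+^N(\bar y,m_0)|=\tilde{\mathcal N}_N^{*(i)}(\bar y')\langle\Psi_-^{2s}(\bar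 y',m_0)|\quad\text{for }\bar y=S_+^{*N(h)},\ \bar y'=dS_-^{*N(i)}.$$ In particular $$|\Omega^-\rangle=\mathcal N_0^{(i)}(\bar u')|\Psi_+^{2s}(\bar u',m_0)\rangle\ \text{ for }\bar u'=S_+^{0(i)},\qquad |\Omega^+\rangle=\mathcal N_0^{*(i)}(\bar w')|\Psi_-^{2s}(\bar w',m_0)\rangle\ \text{ for }\bar w'=S_-^{*0(i)}.$$ Consequently, under Hypotheses 1 and 2 the first two identities, under Hypotheses 1 and 3 the next two, and under Hypothesis 2 the last two are realized by at least one choice of Bethe roots for every $0\le M,N\le2s$. -/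

import Mathlib

noncomputable section

/-! ### Askey-Wilson algebra -/

namespace AW

/-- The `q`-commutator `[X, Y]_q = q X Y - q⁻¹ Y X`. -/
def qComm {R : Type*} [Ring R] [Algebra ℂ R] (q : ℂ) (X Y : R) : R :=
  q • (X * Y) - q⁻¹ • (Y * X)

/-- The two defining relations of the Askey-Wilson algebra, on the free algebra with
generators `ι 0` (that is `A`) and `ι 1` (that is `A*`). -/
inductive Rel (q ρ ω η ηs : ℂ) : FreeAlgebra ℂ (Fin 2) → FreeAlgebra ℂ (Fin 2) → Prop
  | aw1 : Rel q ρ ω η ηs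
      (qComm q⁻¹ (FreeAlgebra.ι ℂ 0) (qComm q (FreeAlgebra.ι ℂ 0) (FreeAlgebra.ι ℂ 1)))
      (ρ • FreeAlgebra.ι ℂ 1 + ω • FreeAlgebra.ι ℂ 0 + η • 1)
  | aw2 : Rel q ρ ω η ηs
      (qComm q⁻¹ (FreeAlgebra.ι ℂ 1) (qComm q (FreeAlgebra.ι ℂ 1) (FreeAlgebra.ι ℂ 0)))
      (ρ • FreeAlgebra.ι ℂ 0 + ω • FreeAlgebra.ι ℂ 1 + ηs • 1)

/-- The Askey-Wilson algebra: the unital associative `ℂ`-algebra generated by `A`, `A*` subject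
to `[A,[A,A*]_q]_{q⁻¹} = ρ A* + ω A + η` and `[A*,[A*,A]_q]_{q⁻¹} = ρ A + ω A* + η*`. -/
abbrev Alg (q ρ ω η ηs : ℂ) : Type := RingQuot (Rel q ρ ω η ηs)

/-! ### Parameters -/

/-- The scalar parameters. `n` is the integer `2s`; `tb, tc, tbs, tcs` are `b, c, b*, c*`
in the eigenvalue sequences; `χ` is the free scale of the reflection algebra. -/
structure Params where
  n : ℕ
  q : ℂ
  tb : ℂ
  tc : ℂ
  tbs : ℂ
  tcs : ℂ
  ζ : ℂ
  χ : ℂ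
  q_ne : q ≠ 0
  q_pow_ne : ∀ k : ℕ, 0 < k → q ^ k ≠ 1
  tb_ne : tb ≠ 0
  tc_ne : tc ≠ 0
  tbs_ne : tbs ≠ 0
  tcs_ne : tcs ≠ 0
  ζ_ne : ζ ≠ 0
  χ_ne : χ ≠ 0
  tb_mul_tc : tb * tc = tbs * tcs

/-- `b(x) = x - x⁻¹`. -/
def b (x : ℂ) : ℂ := x - x⁻¹

namespace Params

variable (P : Params)

/-- `θ_M = b q^{2M} + c q^{-2M}`. -/
def theta (M : ℕ) : ℂ := P.tb * P.q ^ (2 * (M : ℤ)) + P.tc * P.q ^ (-(2 * (M : ℤ)))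

/-- `θ*_N = b* q^{2N} + c* q^{-2N}`. -/
def thetaStar (N : ℕ) : ℂ := P.tbs * P.q ^ (2 * (N : ℤ)) + P.tcs * P.q ^ (-(2 * (N : ℤ)))

/-- `b q^{2s} + c q^{-2s}`. -/
def edge : ℂ := P.tb * P.q ^ (P.n : ℤ) + P.tc * P.q ^ (-(P.n : ℤ))

/-- `b* q^{2s} + c* q^{-2s}`. -/
def edgeStar : ℂ := P.tbs * P.q ^ (P.n : ℤ) + P.tcs * P.q ^ (-(P.n : ℤ))

/-- `ζ² + ζ⁻²`. -/
def zz : ℂ := P.ζ ^ 2 + (P.ζ ^ 2)⁻¹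

/-- `q² - q⁻²`. -/
def qq : ℂ := P.q ^ 2 - (P.q ^ 2)⁻¹

/-- `[2s]_q = (q^{2s} - q^{-2s}) / (q - q⁻¹)`. -/
def qInt : ℂ := (P.q ^ (P.n : ℤ) - P.q ^ (-(P.n : ℤ))) / (P.q - P.q⁻¹)

def rho : ℂ := -(P.tb * P.tc * P.qq ^ 2)

def omega : ℂ :=
  (P.q - P.q⁻¹) ^ 2 *
    (P.tb * P.tc * P.zz * (P.q ^ ((P.n : ℤ) + 1) + P.q ^ (-(P.n : ℤ) - 1)) - P.edge * P.edgeStar)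

def eta : ℂ :=
  -(P.qq ^ 2 / (P.q + P.q⁻¹)) * (P.tb * P.tc) *
    (P.edge * P.zz - P.edgeStar * (P.q ^ ((P.n : ℤ) + 1) + P.q ^ (-(P.n : ℤ) - 1)))

def etaStar : ℂ :=
  -(P.qq ^ 2 / (P.q + P.q⁻¹)) * (P.tbs * P.tcs) *
    (P.edgeStar * P.zz - P.edge * (P.q ^ ((P.n : ℤ) + 1) + P.q ^ (-(P.n : ℤ) - 1)))

/-- The Askey-Wilson algebra with the structure constants above. -/
abbrev Algebra : Type := Alg P.q P.rho P.omega P.eta P.etaStar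

/-- The generator `A`. -/
def genA : P.Algebra := RingQuot.mkAlgHom ℂ _ (FreeAlgebra.ι ℂ 0)

/-- The generator `A*`. -/
def genAs : P.Algebra := RingQuot.mkAlgHom ℂ _ (FreeAlgebra.ι ℂ 1)

/-! ### The reflection algebra matrix `K(u)` and the dynamical operators -/

/-- `(q + q⁻¹) ρ⁻¹ (x u + y u⁻¹)`. -/
def etaBar (x y u : ℂ) : ℂ := (P.q + P.q⁻¹) * P.rho⁻¹ * (x * u + y * u⁻¹)

/-- The entry `K₁₁(u)`. -/
def K11 (u : ℂ) : P.Algebra :=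
  b (u ^ 2) • ((P.q * u) • P.genA - (P.q * u)⁻¹ • P.genAs) - P.etaBar P.eta P.etaStar u • 1

/-- The entry `K₂₂(u)`. -/
def K22 (u : ℂ) : P.Algebra :=
  b (u ^ 2) • ((P.q * u) • P.genAs - (P.q * u)⁻¹ • P.genA) - P.etaBar P.etaStar P.eta u • 1

/-- The entry `K₁₂(u)`. -/
def K12 (u : ℂ) : P.Algebra :=
  (P.χ * b (u ^ 2)) •
    (P.rho⁻¹ • (qComm P.q P.genAs P.genA + (P.omega / (P.q - P.q⁻¹)) • 1)
      + ((P.q * u ^ 2 + (P.q * u ^ 2)⁻¹) / P.qq) • 1)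

/-- The entry `K₂₁(u)`. -/
def K21 (u : ℂ) : P.Algebra :=
  (P.rho * P.χ⁻¹ * b (u ^ 2)) •
    (P.rho⁻¹ • (qComm P.q P.genA P.genAs + (P.omega / (P.q - P.q⁻¹)) • 1)
      + ((P.q * u ^ 2 + (P.q * u ^ 2)⁻¹) / P.qq) • 1)

/-- `(1, -x u^ε) K(u) (x u^{-ε}, 1)ᵗ`. -/
def gaugeK (ε : ℤ) (u x : ℂ) : P.Algebra :=
  (x * u ^ (-ε)) • P.K11 u + P.K12 u - (x ^ 2) • P.K21 u - (x * u ^ ε) • P.K22 u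

/-- `γ^ε(u, m) = α^{(1-ε)/2} β^{(1+ε)/2} q^{-m} u - α^{(1+ε)/2} β^{(1-ε)/2} q^m u⁻¹`,
for `ε = ±1`. -/
def gam (ε : ℤ) (α β u : ℂ) (m : ℤ) : ℂ :=
  α ^ ((1 - ε) / 2) * β ^ ((1 + ε) / 2) * P.q ^ (-m) * u
    - α ^ ((1 + ε) / 2) * β ^ ((1 - ε) / 2) * P.q ^ m * u⁻¹

/-- The dynamical operator `ℬ^ε(u, m)`, `ε = ±1`: the gauge transformed off-diagonal entry of
`K(u)` along the vector `(β q^{-εm} u^{-ε}, 1)ᵗ`. -/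
def dynB (ε : ℤ) (α β u : ℂ) (m : ℤ) : P.Algebra :=
  (-(ε : ℂ) * P.q ^ (-ε) * u ^ (-ε) / P.gam ε α β 1 (m + 1)) • P.gaugeK ε u (β * P.q ^ (-(ε * m)))

/-- The dynamical operator `𝒞^ε(u, m)`, `ε = ±1`: the gauge transformed off-diagonal entry of
`K(u)` along the vector `(α q^{εm} u^{-ε}, 1)ᵗ`. -/
def dynC (ε : ℤ) (α β u : ℂ) (m : ℤ) : P.Algebra :=
  ((ε : ℂ) * P.q ^ (-ε) * u ^ (-ε) / P.gam ε α β 1 (m - 1)) • P.gaugeK ε u (α * P.q ^ (ε * m))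

/-- `B^ε(ū, m, M) = ℬ^ε(u_1, m + 2(M-1)) ⋯ ℬ^ε(u_M, m)`. -/
def stringB (ε : ℤ) (α β : ℂ) (m : ℤ) {M : ℕ} (u : Fin M → ℂ) : P.Algebra :=
  (List.ofFn fun i : Fin M =>
    P.dynB ε α β (u i) (m + 2 * ((M : ℤ) - 1 - ((i : ℕ) : ℤ)))).prod

/-- `C^ε(v̄, m, N) = 𝒞^ε(v_1, m + 2) ⋯ 𝒞^ε(v_N, m + 2N)`. -/
def stringC (ε : ℤ) (α β : ℂ) (m : ℤ) {N : ℕ} (v : Fin N → ℂ) : P.Algebra :=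
  (List.ofFn fun i : Fin N => P.dynC ε α β (v i) (m + 2 * (((i : ℕ) : ℤ) + 1))).prod

/-- The `α` with `(q² - q⁻²) χ⁻¹ α b q^{-m₀} = -1`. -/
def alphaMinus (m₀ : ℤ) : ℂ := -(P.χ * P.q ^ m₀ / (P.qq * P.tb))

/-- The `α` with `(q² - q⁻²) χ⁻¹ α c* q^{m₀} = 1`. -/
def alphaPlus (m₀ : ℤ) : ℂ := P.χ * P.q ^ (-m₀) / (P.qq * P.tcs)

/-- The `β` with `(q² - q⁻²) χ⁻¹ β c q^{m₀-2} = -1`. -/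
def betaMinus (m₀ : ℤ) : ℂ := -(P.χ * P.q ^ (2 - m₀) / (P.qq * P.tc))

/-- The `β` with `(q² - q⁻²) χ⁻¹ β b* q^{-m₀+2} = 1`. -/
def betaPlus (m₀ : ℤ) : ℂ := P.χ * P.q ^ (m₀ - 2) / (P.qq * P.tbs)

/-! ### Bethe equations -/

def f (u v : ℂ) : ℂ := b (P.q * v / u) * b (u * v) / (b (v / u) * b (P.q * u * v))

def h (u v : ℂ) : ℂ := b (P.q ^ 2 * u * v) * b (P.q * u / v) / (b (P.q * u * v) * b (u / v))

/-- The eigenvalue `Λ₁^ε(u)` on the reference states, `ε = ±1`. -/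
def Lam1 (ε : ℤ) (u : ℂ) : ℂ :=
  P.q ^ (-(P.n : ℤ) - 1) / u ^ ε
    * (P.q ^ ((P.n : ℤ) + 1) * u * P.ζ⁻¹ - u⁻¹ * P.ζ)
    * (P.q ^ ((P.n : ℤ) + 1) * u * P.ζ - u⁻¹ * P.ζ⁻¹)
    * (u * P.tcs * P.q ^ (-(P.n : ℤ)) + u⁻¹ * P.tb * P.q ^ (P.n : ℤ))
    * (u * (P.tc / P.tcs) ^ ((1 - ε) / 2) + u⁻¹ * (P.tbs / P.tb) ^ ((1 + ε) / 2))

/-- The eigenvalue `Λ₂^ε(u)` on the reference states, `ε = ±1`. -/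
def Lam2 (ε : ℤ) (u : ℂ) : ℂ :=
  b (u ^ 2) * P.q ^ (-(P.n : ℤ) - 1) / (u ^ ε * b (P.q * u ^ 2))
    * (P.q ^ ((P.n : ℤ) - 1) * u⁻¹ * P.ζ - u * P.ζ⁻¹)
    * (P.q ^ ((P.n : ℤ) - 1) * u⁻¹ * P.ζ⁻¹ - u * P.ζ)
    * (P.q ^ 2 * u * P.tb * P.q ^ (P.n : ℤ) + u⁻¹ * P.tcs * P.q ^ (-(P.n : ℤ)))
    * (P.q ^ 2 * u * (P.tbs / P.tb) ^ ((1 + ε) / 2) + u⁻¹ * (P.tc / P.tcs) ^ ((1 - ε) / 2))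

/-- The homogeneous Bethe function `E_ε^M(u_i, ū_i)`. -/
def bethe (ε : ℤ) {M : ℕ} (u : Fin M → ℂ) (i : Fin M) : ℂ :=
  -(b (u i ^ 2) / b (P.q * u i ^ 2)) * (∏ j ∈ Finset.univ.erase i, P.f (u i) (u j))
      * P.Lam1 ε (u i)
    + (∏ j ∈ Finset.univ.erase i, P.h (u i) (u j)) * P.Lam2 ε (u i)

/-- `q^{1/2+k-s}`, as the power `1 + 2k - 2s` of a square root of `q`. (Below the other choice
of the square root changes two signs, which cancel.) -/
def qHalf (k : ℕ) : ℂ := (P.q ^ (1 / 2 : ℂ)) ^ (1 + 2 * (k : ℤ) - (P.n : ℤ))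

/-- `b(u_i²)/b(q) ∏_{k=0}^{2s} b(q^{1/2+k-s} ζ u_i) b(q^{1/2+k-s} ζ⁻¹ u_i)
/ ∏_{j ≠ i} b(u_i u_j⁻¹) b(q u_i u_j)`. -/
def inhomTerm (u : Fin P.n → ℂ) (i : Fin P.n) : ℂ :=
  b (u i ^ 2) / b P.q
    * (∏ k ∈ Finset.range (P.n + 1),
        b (P.qHalf k * P.ζ * u i) * b (P.qHalf k * P.ζ⁻¹ * u i))
    / ∏ j ∈ Finset.univ.erase i, b (u i * (u j)⁻¹) * b (P.q * u i * u j)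

/-- The inhomogeneous Bethe function `E_ε(u_i, ū_i)`; the coefficient `ν` is an argument. -/
def betheInhomAux (ε : ℤ) (ν : ℂ) (u : Fin P.n → ℂ) (i : Fin P.n) : ℂ :=
  b (u i ^ 2) / b (P.q * u i ^ 2) * u i ^ ε
      * (∏ j ∈ Finset.univ.erase i, P.f (u i) (u j)) * P.Lam1 ε (u i)
    - (P.q ^ 2 * u i ^ 3) ^ (-ε)
      * (∏ j ∈ Finset.univ.erase i, P.h (u i) (u j)) * P.Lam2 ε (u i)
    + ν * u i ^ (-(2 * ε)) * P.inhomTerm u i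

/-- `E_+(u_i, ū_i)`, with `ν_+ = q^{-1-4s} c*`. -/
def betheInhomPlus (u : Fin P.n → ℂ) (i : Fin P.n) : ℂ :=
  P.betheInhomAux 1 (P.q ^ (-1 - 2 * (P.n : ℤ)) * P.tcs) u i

/-- `E_-(u_i, ū_i)`, with `ν_- = q^{1+4s} b`. -/
def betheInhomMinus (u : Fin P.n → ℂ) (i : Fin P.n) : ℂ :=
  P.betheInhomAux (-1) (P.q ^ (1 + 2 * (P.n : ℤ)) * P.tb) u i

/-- The dual inhomogeneous Bethe function `Ẽ_ε(y_i, ȳ_i)`; the coefficient `ν̃` is an argument. -/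
def betheDualAux (ε : ℤ) (ν : ℂ) (y : Fin P.n → ℂ) (i : Fin P.n) : ℂ :=
  b (y i ^ 2) / b (P.q * y i ^ 2) * y i ^ (-ε)
      * (∏ j ∈ Finset.univ.erase i, P.f (y i) (y j)) * P.Lam1 ε (y i)
    - (P.q ^ 2 * y i ^ 3) ^ ε
      * (∏ j ∈ Finset.univ.erase i, P.h (y i) (y j)) * P.Lam2 ε (y i)
    + ν * P.inhomTerm y i

/-- `Ẽ_+(y_i, ȳ_i)`, with `ν̃_+ = q^{1+4s} b*`. -/
def betheDualPlus (y : Fin P.n → ℂ) (i : Fin P.n) : ℂ :=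
  P.betheDualAux 1 (P.q ^ (1 + 2 * (P.n : ℤ)) * P.tbs) y i

/-- `Ẽ_-(y_i, ȳ_i)`, with `ν̃_- = q^{-1-4s} c`. -/
def betheDualMinus (y : Fin P.n → ℂ) (i : Fin P.n) : ℂ :=
  P.betheDualAux (-1) (P.q ^ (-1 - 2 * (P.n : ℤ)) * P.tc) y i

/-- `q u² + q⁻¹ u⁻²`. -/
def symRoot (u : ℂ) : ℂ := P.q * u ^ 2 + (P.q * u ^ 2)⁻¹

/-- Non-trivial admissible roots: `u_i ≠ 0`, `u_i² ≠ u_i⁻²`, the denominator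
`q u_i² - q⁻¹ u_i⁻²` of the Bethe equations does not vanish, and the symmetrized roots
`U_i = (q u_i² + q⁻¹ u_i⁻²)/(q + q⁻¹)` are pairwise distinct. -/
def Admissible {M : ℕ} (u : Fin M → ℂ) : Prop :=
  (∀ i, u i ≠ 0 ∧ u i ^ 2 ≠ (u i ^ 2)⁻¹ ∧ b (P.q * u i ^ 2) ≠ 0) ∧
    ∀ i j, i ≠ j → P.symRoot (u i) / (P.q + P.q⁻¹) ≠ P.symRoot (u j) / (P.q + P.q⁻¹)

/-- `ū` is a set `S_-^{M(h)}` (for `ε = -1`) or `S_+^{*M(h)}` (for `ε = 1`). -/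
def IsHom (ε : ℤ) {M : ℕ} (u : Fin M → ℂ) : Prop :=
  P.Admissible u ∧ ∀ i, P.bethe ε u i = 0

/-- `ū` is a set `S_+^{M(i)}`. -/
def IsInhom (M : ℕ) (u : Fin P.n → ℂ) : Prop :=
  P.Admissible u ∧ (∀ i, P.betheInhomPlus u i = 0) ∧
    P.theta M = P.q ^ (-(2 * (P.n : ℤ))) *
      (P.tcs * P.zz * P.qInt + P.q ^ (P.n : ℤ) * P.edge - P.q * P.tcs * ∑ j, P.symRoot (u j))

/-- `w̄` is a set `S_-^{*N(i)}`. -/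
def IsInhomStar (N : ℕ) (w : Fin P.n → ℂ) : Prop :=
  P.Admissible w ∧ (∀ i, P.betheInhomMinus w i = 0) ∧
    P.thetaStar N = P.q ^ (2 * (P.n : ℤ)) *
      (P.tb * P.zz * P.qInt + P.q ^ (-(P.n : ℤ)) * P.edgeStar
        - P.q⁻¹ * P.tb * ∑ j, P.symRoot (w j))

/-- `ȳ` is a set `dS_+^{M(i)}`. -/
def IsDualInhom (M : ℕ) (y : Fin P.n → ℂ) : Prop :=
  P.Admissible y ∧ (∀ i, P.betheDualPlus y i = 0) ∧
    P.theta M = P.q ^ (2 * (P.n : ℤ)) *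
      (P.tbs * P.zz * P.qInt + P.q ^ (-(P.n : ℤ)) * P.edge
        - P.q⁻¹ * P.tbs * ∑ j, P.symRoot (y j))

/-- `v̄` is a set `dS_-^{*N(i)}`. -/
def IsDualInhomStar (N : ℕ) (v : Fin P.n → ℂ) : Prop :=
  P.Admissible v ∧ (∀ i, P.betheDualMinus v i = 0) ∧
    P.thetaStar N = P.q ^ (-(2 * (P.n : ℤ))) *
      (P.tc * P.zz * P.qInt + P.q ^ (P.n : ℤ) * P.edgeStar - P.q * P.tc * ∑ j, P.symRoot (v j))

/-- Existence of homogeneous Bethe roots. -/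
def Hypothesis1 : Prop :=
  (∀ M ≤ P.n, ∃ u : Fin M → ℂ, P.IsHom (-1) u) ∧ (∀ N ≤ P.n, ∃ w : Fin N → ℂ, P.IsHom 1 w)

/-- Existence of inhomogeneous Bethe roots. -/
def Hypothesis2 : Prop :=
  (∀ M ≤ P.n, ∃ u, P.IsInhom M u) ∧ (∀ N ≤ P.n, ∃ w, P.IsInhomStar N w)

/-- Existence of dual inhomogeneous Bethe roots. -/
def Hypothesis3 : Prop :=
  (∀ M ≤ P.n, ∃ y, P.IsDualInhom M y) ∧ (∀ N ≤ P.n, ∃ v, P.IsDualInhomStar N v)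

end Params

/-! ### The Leonard pair, its eigenbases, and the Bethe states -/

/-- An irreducible representation of the Askey-Wilson algebra on `V` (of dimension `2s + 1`) on
which `A` and `A*` are diagonalizable with simple spectra `θ_0, …, θ_{2s}` and
`θ*_0, …, θ*_{2s}`, with chosen eigenbases `ket M = |θ_M⟩`, `ketS N = |θ*_N⟩` of `V` and
`bra M = ⟨θ_M|`, `braS N = ⟨θ*_N|` of the dual space. -/
structure LeonardRep (P : Params) (V : Type*) [AddCommGroup V] [Module ℂ V] where
  π : P.Algebra →ₐ[ℂ] Module.End ℂ V
  irreducible : ∀ W : Submodule ℂ V, (∀ a, ∀ x ∈ W, π a x ∈ W) → W = ⊥ ∨ W = ⊤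
  theta_inj : ∀ M ≤ P.n, ∀ M' ≤ P.n, P.theta M = P.theta M' → M = M'
  thetaStar_inj : ∀ N ≤ P.n, ∀ N' ≤ P.n, P.thetaStar N = P.thetaStar N' → N = N'
  ket : Module.Basis (Fin (P.n + 1)) ℂ V
  ketS : Module.Basis (Fin (P.n + 1)) ℂ V
  bra : Module.Basis (Fin (P.n + 1)) ℂ (Module.Dual ℂ V)
  braS : Module.Basis (Fin (P.n + 1)) ℂ (Module.Dual ℂ V)
  ket_eig : ∀ M, π P.genA (ket M) = P.theta M • ket M
  ketS_eig : ∀ N, π P.genAs (ketS N) = P.thetaStar N • ketS N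
  bra_eig : ∀ M, bra M ∘ₗ π P.genA = P.theta M • bra M
  braS_eig : ∀ N, braS N ∘ₗ π P.genAs = P.thetaStar N • braS N

namespace LeonardRep

variable {P : Params} {V : Type*} [AddCommGroup V] [Module ℂ V] (D : LeonardRep P V)

/-- `A*_{M',M}`: the coefficient of `|θ_{M'}⟩` in `π(A*)|θ_M⟩`. -/
def coefAs (M' M : Fin (P.n + 1)) : ℂ := D.ket.repr (D.π P.genAs (D.ket M)) M'

/-- `A_{N',N}`: the coefficient of `|θ*_{N'}⟩` in `π(A)|θ*_N⟩`. -/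
def coefA (N' N : Fin (P.n + 1)) : ℂ := D.ketS.repr (D.π P.genA (D.ketS N)) N'

/-- `Ã*_{M,M'}`: the coefficient of `⟨θ_{M'}|` in `⟨θ_M|π(A*)`. -/
def dualCoefAs (M M' : Fin (P.n + 1)) : ℂ := D.bra.repr (D.bra M ∘ₗ D.π P.genAs) M'

/-- `Ã_{N,N'}`: the coefficient of `⟨θ*_{N'}|` in `⟨θ*_N|π(A)`. -/
def dualCoefA (N N' : Fin (P.n + 1)) : ℂ := D.braS.repr (D.braS N ∘ₗ D.π P.genA) N'

/-- The transition matrix: `|θ*_N⟩ = ∑_M P_{MN} |θ_M⟩`. -/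
def trans (M N : Fin (P.n + 1)) : ℂ := D.ket.repr (D.ketS N) M

/-- The inverse transition matrix: `|θ_M⟩ = ∑_N (P⁻¹)_{NM} |θ*_N⟩`. -/
def transInv (N M : Fin (P.n + 1)) : ℂ := D.ketS.repr (D.ket M) N

/-- `ξ_M = ⟨θ_M|θ_M⟩`. -/
def xi (M : Fin (P.n + 1)) : ℂ := D.bra M (D.ket M)

/-- `ξ*_N = ⟨θ*_N|θ*_N⟩`. -/
def xiStar (N : Fin (P.n + 1)) : ℂ := D.braS N (D.ketS N)

/-- The reference states. -/
def OmMinus : V := D.ket 0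

def OmPlus : V := D.ketS 0

def dualOmMinus : Module.Dual ℂ V := D.bra 0

def dualOmPlus : Module.Dual ℂ V := D.braS 0

/-- `|Ψ_-^M(ū, m₀)⟩`. -/
def PsiMinus (m₀ : ℤ) {M : ℕ} (u : Fin M → ℂ) : V :=
  D.π (P.stringB (-1) (P.alphaMinus m₀) 0 m₀ u) D.OmMinus

/-- `|Ψ_+^M(w̄, m₀)⟩`. -/
def PsiPlus (m₀ : ℤ) {M : ℕ} (w : Fin M → ℂ) : V :=
  D.π (P.stringB 1 (P.alphaPlus m₀) 0 m₀ w) D.OmPlus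

/-- `⟨Ψ_-^N(v̄, m₀)|`. -/
def dualPsiMinus (m₀ : ℤ) {N : ℕ} (v : Fin N → ℂ) : Module.Dual ℂ V :=
  D.dualOmMinus ∘ₗ D.π (P.stringC (-1) 0 (P.betaMinus m₀) m₀ v)

/-- `⟨Ψ_+^N(ȳ, m₀)|`. -/
def dualPsiPlus (m₀ : ℤ) {N : ℕ} (y : Fin N → ℂ) : Module.Dual ℂ V :=
  D.dualOmPlus ∘ₗ D.π (P.stringC 1 0 (P.betaPlus m₀) m₀ y)

/-- For `k < M ≤ 2s`, the index `k`. -/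
def lo {M : ℕ} (hM : M ≤ P.n) (k : Fin M) : Fin (P.n + 1) := ⟨k, by omega⟩

/-- For `k < M ≤ 2s`, the index `k + 1`. -/
def hi {M : ℕ} (hM : M ≤ P.n) (k : Fin M) : Fin (P.n + 1) := ⟨k + 1, by omega⟩

/-- `𝒩_M(ū) = ∏_{k=1}^M (q u_k b(u_k²) A*_{k,k-1})⁻¹`. -/
def normKet {M : ℕ} (hM : M ≤ P.n) (u : Fin M → ℂ) : ℂ :=
  ∏ k, (P.q * u k * b (u k ^ 2) * D.coefAs (hi hM k) (lo hM k))⁻¹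

/-- `𝒩*_N(w̄) = ∏_{k=1}^N (-q⁻¹ w_k⁻¹ b(w_k²) A_{k,k-1})⁻¹`. -/
def normKetS {N : ℕ} (hN : N ≤ P.n) (w : Fin N → ℂ) : ℂ :=
  ∏ k, (-P.q⁻¹ * (w k)⁻¹ * b (w k ^ 2) * D.coefA (hi hN k) (lo hN k))⁻¹

/-- `∏_{k=1}^M (q⁻¹ v_k b(v_k²) Ã*_{k-1,k})⁻¹`, where `Ã*_{k-1,k}` is the coefficient of
`⟨θ_k|` in `⟨θ_{k-1}|π(A*)`. -/
def normBra {M : ℕ} (hM : M ≤ P.n) (v : Fin M → ℂ) : ℂ :=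
  ∏ k, (P.q⁻¹ * v k * b (v k ^ 2) * D.dualCoefAs (lo hM k) (hi hM k))⁻¹

/-- `∏_{k=1}^N (-q y_k⁻¹ b(y_k²) Ã_{k-1,k})⁻¹`, where `Ã_{k-1,k}` is the coefficient of
`⟨θ*_k|` in `⟨θ*_{k-1}|π(A)`. -/
def normBraS {N : ℕ} (hN : N ≤ P.n) (y : Fin N → ℂ) : ℂ :=
  ∏ k, (-P.q * (y k)⁻¹ * b (y k ^ 2) * D.dualCoefA (lo hN k) (hi hN k))⁻¹

/-- `𝒩_M^{(i)}(ū') = 𝒩*_{2s}(ū') (P⁻¹)_{2s,M}`. -/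
def normKetInhom (M : Fin (P.n + 1)) (u : Fin P.n → ℂ) : ℂ :=
  D.normKetS le_rfl u * D.transInv (Fin.last P.n) M

/-- `𝒩_N^{*(i)}(w̄') = 𝒩_{2s}(w̄') P_{2s,N}`. -/
def normKetSInhom (N : Fin (P.n + 1)) (w : Fin P.n → ℂ) : ℂ :=
  D.normKet le_rfl w * D.trans (Fin.last P.n) N

/-- The normalization `𝒩*_{2s}(v̄') P_{M,2s} ξ_M / ξ*_{2s}` (with dual `𝒩*`). -/
def normBraInhom (M : Fin (P.n + 1)) (v : Fin P.n → ℂ) : ℂ :=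
  D.normBraS le_rfl v * D.trans M (Fin.last P.n) * (D.xi M / D.xiStar (Fin.last P.n))

/-- The normalization `𝒩_{2s}(ȳ') (P⁻¹)_{N,2s} ξ*_N / ξ_{2s}` (with dual `𝒩`). -/
def normBraSInhom (N : Fin (P.n + 1)) (y : Fin P.n → ℂ) : ℂ :=
  D.normBra le_rfl y * D.transInv N (Fin.last P.n) * (D.xiStar N / D.xi (Fin.last P.n))

end LeonardRep

end AW

end

noncomputable section

namespace AW

/-! Every identity holds because both sides equal one and the same normalized eigenvector: `|θ_M⟩`,
`|θ*_N⟩`, `⟨θ_M|` or `⟨θ*_N|`.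

With one gauge parameter set to zero, each dynamical operator is a scalar times `K₁₂(u)`, which is a
scalar times `S - symRoot u`, where `S` is an affine image of `[A*, A]_q`. A Bethe state is
therefore a scalar times `p(S)` on a reference state, where `p` is the monic polynomial whose roots
are the symmetrized Bethe roots.

The Askey-Wilson relations become q-commutation rules of `A` and `A*` with `S` (`A_S_apply`,
`As_S_apply`), and `A*|θ_0⟩` is an affine function of `S` on `|θ_0⟩` (`As_ket_zero`). Hence `A
p(S)|θ_0⟩ = α(S)|θ_0⟩` and `A* p(S)|θ_0⟩ = β(S)|θ_0⟩`, where `α` and `β` at a point are given by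
divided differences of `p` towards the two q-shifted points (`exists_action`). At a root of `p`
these divided differences are products over the other roots, namely the products in the Bethe
equations.

The homogeneous equations say that `α` vanishes at all roots of `p`. As `α` has degree at most that
of `p`, it is a multiple of `p`, and the state is an eigenvector of `A` (`nstate_eq_ket`). For `A*`
and `deg p = 2s`, the polynomial `β` has degree `2s + 1` and must be reduced modulo the polynomial
`charS` annihilating `S` (`aeval_charS`). The inhomogeneous term is the value of `charS`, and the
condition on `σ` fixes the eigenvalue (`smul_nstate_eq_ketS`).

The norms come from triangularity: `S` raises the index by at most one, so the top coordinate of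
`p(S)|θ_0⟩` is an explicit product. The remaining cases follow by exchanging `A` and `A*` or by
transposing, both of which invert `q` and the Bethe roots. -/

theorem b_inv (x : ℂ) : b x⁻¹ = -b x := by
  simp [b]

namespace Params

variable (P : Params)

/-! ### Scalars -/

theorem pow_ne_one {k : ℕ} (hk : k ≠ 0) : P.q ^ k ≠ 1 := P.q_pow_ne k (Nat.pos_of_ne_zero hk)

theorem q_sub_ne : P.q - P.q⁻¹ ≠ 0 := by
  have h := P.pow_ne_one (k := 2) (by norm_num)
  have h0 := P.q_ne
  intro h1
  apply h
  field_simp at h1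
  linear_combination h1

theorem q_add_ne : P.q + P.q⁻¹ ≠ 0 := by
  have h := P.pow_ne_one (k := 4) (by norm_num)
  have h0 := P.q_ne
  intro h1
  apply h
  field_simp at h1
  linear_combination (P.q ^ 2 - 1) * h1

theorem qq_eq : P.qq = (P.q - P.q⁻¹) * (P.q + P.q⁻¹) := by
  have := P.q_ne
  rw [qq]; field_simp; ring

theorem qq_ne : P.qq ≠ 0 := by
  rw [qq_eq]; exact mul_ne_zero P.q_sub_ne P.q_add_ne

/-- `q^{2s}`. -/
def qn : ℂ := P.q ^ P.n

theorem qn_ne : P.qn ≠ 0 := pow_ne_zero _ P.q_ne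

theorem zpow_n : P.q ^ (P.n : ℤ) = P.qn := zpow_natCast _ _

theorem edge_eq : P.edge = P.tb * P.qn + P.tc * P.qn⁻¹ := by
  rw [edge, zpow_neg, zpow_n]

theorem edgeStar_eq : P.edgeStar = P.tbs * P.qn + P.tcs * P.qn⁻¹ := by
  rw [edgeStar, zpow_neg, zpow_n]

/-- `q^{2s+1} + q^{-2s-1}`. -/
def ww : ℂ := P.qn * P.q + (P.qn * P.q)⁻¹

theorem ww_eq : P.q ^ ((P.n : ℤ) + 1) + P.q ^ (-(P.n : ℤ) - 1) = P.ww := by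
  rw [ww, zpow_add₀ P.q_ne, zpow_n, zpow_one, show -(P.n : ℤ) - 1 = -((P.n : ℤ) + 1) by ring,
    zpow_neg, zpow_add₀ P.q_ne, zpow_n, zpow_one]

theorem omega_eq : P.omega = (P.q - P.q⁻¹) ^ 2 *
    (P.tb * P.tc * P.zz * P.ww - P.edge * P.edgeStar) := by
  rw [omega, ww_eq]

/-- The inhomogeneous term of `[A, S]_q`. -/
def com : ℂ := (P.q - P.q⁻¹) * (P.edge * P.zz - P.edgeStar * P.ww)

/-- The inhomogeneous term of `[S, A*]_q`. -/
def comStar : ℂ := (P.q - P.q⁻¹) * (P.edgeStar * P.zz - P.edge * P.ww)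

theorem eta_eq : P.eta = -(P.tb * P.tc * P.qq * P.com) := by
  have := P.q_add_ne
  rw [eta, ww_eq, com, qq_eq]
  field_simp

theorem etaStar_eq : P.etaStar = -(P.tb * P.tc * P.qq * P.comStar) := by
  have := P.q_add_ne
  rw [etaStar, ww_eq, comStar, qq_eq, P.tb_mul_tc]
  field_simp

/-- Solves the constraint between the four parameters, so that `field_simp; ring` can decide
identities that hold only modulo it. -/
theorem tc_eq : P.tc = P.tbs * P.tcs / P.tb := by
  rw [eq_div_iff P.tb_ne, ← P.tb_mul_tc, mul_comm]

/-! ### Symmetries of the parameters -/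

/-- The parameters of the pair with `A` and `A*` exchanged. -/
def swap : Params where
  n := P.n
  q := P.q⁻¹
  tb := P.tcs
  tc := P.tbs
  tbs := P.tc
  tcs := P.tb
  ζ := P.ζ
  χ := P.χ
  q_ne := inv_ne_zero P.q_ne
  q_pow_ne k hk := by
    rw [inv_pow]; exact fun h => P.q_pow_ne k hk (inv_eq_one.1 h)
  tb_ne := P.tcs_ne
  tc_ne := P.tbs_ne
  tbs_ne := P.tc_ne
  tcs_ne := P.tb_ne
  ζ_ne := P.ζ_ne
  χ_ne := P.χ_ne
  tb_mul_tc := by rw [mul_comm, ← P.tb_mul_tc, mul_comm]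

/-- The parameters of the transposed pair. -/
def dual : Params where
  n := P.n
  q := P.q⁻¹
  tb := P.tc
  tc := P.tb
  tbs := P.tcs
  tcs := P.tbs
  ζ := P.ζ
  χ := P.χ
  q_ne := inv_ne_zero P.q_ne
  q_pow_ne k hk := by
    rw [inv_pow]; exact fun h => P.q_pow_ne k hk (inv_eq_one.1 h)
  tb_ne := P.tc_ne
  tc_ne := P.tb_ne
  tbs_ne := P.tcs_ne
  tcs_ne := P.tbs_ne
  ζ_ne := P.ζ_ne
  χ_ne := P.χ_ne
  tb_mul_tc := by rw [mul_comm, P.tb_mul_tc, mul_comm]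

/-- The parameters with the order of the eigenvalues `θ_0, …, θ_{2s}` reversed. -/
def rev : Params where
  n := P.n
  q := P.q
  tb := P.tc * (P.qn ^ 2)⁻¹
  tc := P.tb * P.qn ^ 2
  tbs := P.tbs
  tcs := P.tcs
  ζ := P.ζ
  χ := P.χ
  q_ne := P.q_ne
  q_pow_ne := P.q_pow_ne
  tb_ne := mul_ne_zero P.tc_ne (inv_ne_zero (pow_ne_zero _ P.qn_ne))
  tc_ne := mul_ne_zero P.tb_ne (pow_ne_zero _ P.qn_ne)
  tbs_ne := P.tbs_ne
  tcs_ne := P.tcs_ne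
  ζ_ne := P.ζ_ne
  χ_ne := P.χ_ne
  tb_mul_tc := by
    have := P.qn_ne
    rw [← P.tb_mul_tc]
    field_simp

theorem swap_qn : P.swap.qn = P.qn⁻¹ := by simp [qn, swap]
theorem dual_qn : P.dual.qn = P.qn⁻¹ := by simp [qn, dual]
theorem rev_qn : P.rev.qn = P.qn := rfl

theorem swap_qq : P.swap.qq = -P.qq := by simp [qq, swap]
theorem dual_qq : P.dual.qq = -P.qq := by simp [qq, dual]

theorem swap_edge : P.swap.edge = P.edgeStar := by
  rw [edge_eq, edgeStar_eq, swap_qn]; simp [swap]; ring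
theorem swap_edgeStar : P.swap.edgeStar = P.edge := by
  rw [edge_eq, edgeStar_eq, swap_qn]; simp [swap]; ring
theorem dual_edge : P.dual.edge = P.edge := by
  rw [edge_eq, edge_eq, dual_qn]; simp [dual]; ring
theorem dual_edgeStar : P.dual.edgeStar = P.edgeStar := by
  rw [edgeStar_eq, edgeStar_eq, dual_qn]; simp [dual]; ring
theorem rev_edge : P.rev.edge = P.edge := by
  have := P.qn_ne
  rw [edge_eq, edge_eq, rev_qn]; simp only [rev]; field_simp; ring

theorem swap_ww : P.swap.ww = P.ww := by
  rw [ww, ww, swap_qn]; simp [swap]; ring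
theorem dual_ww : P.dual.ww = P.ww := by
  rw [ww, ww, dual_qn]; simp [dual]; ring

theorem swap_tb_mul_tc : P.swap.tb * P.swap.tc = P.tb * P.tc := by
  rw [P.tb_mul_tc]; exact mul_comm _ _
theorem dual_tb_mul_tc : P.dual.tb * P.dual.tc = P.tb * P.tc := mul_comm _ _
theorem rev_tb_mul_tc : P.rev.tb * P.rev.tc = P.tb * P.tc :=
  (P.rev.tb_mul_tc).trans P.tb_mul_tc.symm

theorem swap_zz : P.swap.zz = P.zz := rfl
theorem dual_zz : P.dual.zz = P.zz := rfl

theorem swap_q_sub : P.swap.q - P.swap.q⁻¹ = -(P.q - P.q⁻¹) := by simp [swap]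
theorem dual_q_sub : P.dual.q - P.dual.q⁻¹ = -(P.q - P.q⁻¹) := by simp [dual]

theorem swap_rho : P.swap.rho = P.rho := by
  rw [rho, rho, swap_tb_mul_tc, swap_qq, neg_sq]
theorem dual_rho : P.dual.rho = P.rho := by
  rw [rho, rho, dual_tb_mul_tc, dual_qq, neg_sq]
theorem rev_rho : P.rev.rho = P.rho := by
  rw [rho, rho, rev_tb_mul_tc]; rfl

theorem swap_omega : P.swap.omega = P.omega := by
  rw [omega_eq, omega_eq, swap_tb_mul_tc, swap_zz, swap_ww, swap_edge, swap_edgeStar, swap_q_sub]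
  ring
theorem dual_omega : P.dual.omega = P.omega := by
  rw [omega_eq, omega_eq, dual_tb_mul_tc, dual_zz, dual_ww, dual_edge, dual_edgeStar, dual_q_sub]
  ring
theorem rev_omega : P.rev.omega = P.omega := by
  rw [omega_eq, omega_eq, rev_tb_mul_tc, rev_edge]; rfl

theorem swap_com : P.swap.com = -P.comStar := by
  rw [com, comStar, swap_q_sub, swap_edge, swap_edgeStar, swap_zz, swap_ww]; ring
theorem swap_comStar : P.swap.comStar = -P.com := by
  rw [com, comStar, swap_q_sub, swap_edge, swap_edgeStar, swap_zz, swap_ww]; ring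
theorem dual_com : P.dual.com = -P.com := by
  rw [com, com, dual_q_sub, dual_edge, dual_edgeStar, dual_zz, dual_ww]; ring
theorem dual_comStar : P.dual.comStar = -P.comStar := by
  rw [comStar, comStar, dual_q_sub, dual_edge, dual_edgeStar, dual_zz, dual_ww]; ring
theorem rev_com : P.rev.com = P.com := by
  rw [com, com, rev_edge]; rfl
theorem rev_comStar : P.rev.comStar = P.comStar := by
  rw [comStar, comStar, rev_edge]; rfl

theorem swap_eta : P.swap.eta = P.etaStar := by
  rw [eta_eq, etaStar_eq, swap_tb_mul_tc, swap_qq, swap_com]; ring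
theorem swap_etaStar : P.swap.etaStar = P.eta := by
  rw [eta_eq, etaStar_eq, swap_tb_mul_tc, swap_qq, swap_comStar]; ring
theorem dual_eta : P.dual.eta = P.eta := by
  rw [eta_eq, eta_eq, dual_tb_mul_tc, dual_qq, dual_com]; ring
theorem dual_etaStar : P.dual.etaStar = P.etaStar := by
  rw [etaStar_eq, etaStar_eq, dual_tb_mul_tc, dual_qq, dual_comStar]; ring
theorem rev_eta : P.rev.eta = P.eta := by
  rw [eta_eq, eta_eq, rev_tb_mul_tc, rev_com]; rfl
theorem rev_etaStar : P.rev.etaStar = P.etaStar := by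
  rw [etaStar_eq, etaStar_eq, rev_tb_mul_tc, rev_comStar]; rfl

/-! ### Eigenvalue sequences -/

theorem theta_eq (M : ℕ) : P.theta M = P.tb * (P.q ^ M) ^ 2 + P.tc * ((P.q ^ M) ^ 2)⁻¹ := by
  rw [theta, zpow_neg, mul_comm (2 : ℤ), zpow_mul, zpow_natCast]; norm_cast

theorem thetaStar_eq (M : ℕ) :
    P.thetaStar M = P.tbs * (P.q ^ M) ^ 2 + P.tcs * ((P.q ^ M) ^ 2)⁻¹ := by
  rw [thetaStar, zpow_neg, mul_comm (2 : ℤ), zpow_mul, zpow_natCast]; norm_cast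

theorem swap_theta (M : ℕ) : P.swap.theta M = P.thetaStar M := by
  rw [theta_eq, thetaStar_eq]; simp [swap]; ring
theorem swap_thetaStar (M : ℕ) : P.swap.thetaStar M = P.theta M := by
  rw [theta_eq, thetaStar_eq]; simp [swap]; ring
theorem dual_theta (M : ℕ) : P.dual.theta M = P.theta M := by
  rw [theta_eq, theta_eq]; simp [dual]; ring
theorem dual_thetaStar (M : ℕ) : P.dual.thetaStar M = P.thetaStar M := by
  rw [thetaStar_eq, thetaStar_eq]; simp [dual]; ring

theorem rev_theta {M : ℕ} (hM : M ≤ P.n) : P.rev.theta M = P.theta (P.n - M) := by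
  have h0 := P.q_ne
  obtain ⟨k, hk⟩ := Nat.exists_eq_add_of_le hM
  have h1 : P.qn = P.q ^ M * P.q ^ k := by rw [qn, hk, pow_add]
  rw [theta_eq, theta_eq, hk, Nat.add_sub_cancel_left]
  simp only [rev, h1]
  field_simp
  ring

theorem swap_symRoot (u : ℂ) : P.swap.symRoot u⁻¹ = P.symRoot u := by
  simp [symRoot, swap]; ring
theorem dual_symRoot (u : ℂ) : P.dual.symRoot u⁻¹ = P.symRoot u := by
  simp [symRoot, dual]; ring

end Params

end AW

end

noncomputable section

namespace AW

open Module

/-! ### Pairs of operators with the Askey-Wilson relations, and their symmetries. -/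

/-- A pair of linear maps satisfying the Askey-Wilson relations, irreducible, with chosen
eigenbases. -/
structure LeonardPair (P : Params) (V : Type*) [AddCommGroup V] [Module ℂ V] where
  A : End ℂ V
  As : End ℂ V
  rel1 : qComm P.q⁻¹ A (qComm P.q A As) = P.rho • As + P.omega • A + P.eta • 1
  rel2 : qComm P.q⁻¹ As (qComm P.q As A) = P.rho • A + P.omega • As + P.etaStar • 1
  irreducible : ∀ W : Submodule ℂ V, (∀ x ∈ W, A x ∈ W) → (∀ x ∈ W, As x ∈ W) → W = ⊥ ∨ W = ⊤
  theta_inj : ∀ M ≤ P.n, ∀ M' ≤ P.n, P.theta M = P.theta M' → M = M'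
  thetaStar_inj : ∀ N ≤ P.n, ∀ N' ≤ P.n, P.thetaStar N = P.thetaStar N' → N = N'
  ket : Basis (Fin (P.n + 1)) ℂ V
  ketS : Basis (Fin (P.n + 1)) ℂ V
  ket_eig : ∀ M, A (ket M) = P.theta M • ket M
  ketS_eig : ∀ N, As (ketS N) = P.thetaStar N • ketS N

/-- Both sides expand to `X²Y - (q² + q⁻²)XYX + YX²`. This is why the relations survive the
inversion of `q` in `swap`. -/
theorem qComm_qComm_inv {R : Type*} [Ring R] [Algebra ℂ R] (q : ℂ) (X Y : R) :
    qComm q (X) (qComm q⁻¹ X Y) = qComm q⁻¹ X (qComm q X Y) := by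
  simp only [qComm, inv_inv, mul_sub, sub_mul, mul_smul_comm, smul_mul_assoc, mul_assoc]
  module

namespace LeonardPair

variable {P : Params} {V : Type*} [AddCommGroup V] [Module ℂ V] (L : LeonardPair P V)

/-- The pair with `A` and `A*` exchanged. -/
def swap : LeonardPair P.swap V where
  A := L.As
  As := L.A
  rel1 := by
    rw [P.swap_rho, P.swap_omega, P.swap_eta, ← L.rel2, ← qComm_qComm_inv]
    simp [Params.swap]
  rel2 := by
    rw [P.swap_rho, P.swap_omega, P.swap_etaStar, ← L.rel1, ← qComm_qComm_inv]
    simp [Params.swap]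
  irreducible W h1 h2 := L.irreducible W h2 h1
  theta_inj M hM M' hM' h := L.thetaStar_inj M hM M' hM' (by simpa only [P.swap_theta] using h)
  thetaStar_inj M hM M' hM' h := L.theta_inj M hM M' hM' (by simpa only [P.swap_thetaStar] using h)
  ket := L.ketS
  ketS := L.ket
  ket_eig M := by rw [P.swap_theta]; exact L.ketS_eig M
  ketS_eig M := by rw [P.swap_thetaStar]; exact L.ket_eig M

theorem reindex_rev_eig (M : Fin (P.n + 1)) : L.A (L.ket.reindex Fin.revPerm M) =
    P.rev.theta M • L.ket.reindex Fin.revPerm M := by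
  have h2 : ((Fin.rev M : Fin (P.n + 1)) : ℕ) = P.n - M := by
    rw [Fin.val_rev]; omega
  rw [P.rev_theta (Nat.lt_succ_iff.1 M.2), Basis.reindex_apply, ← h2]
  exact L.ket_eig (Fin.rev M)

/-- The pair with the order of the eigenvalues of `A` reversed. -/
def rev : LeonardPair P.rev V where
  A := L.A
  As := L.As
  rel1 := by rw [P.rev_rho, P.rev_omega, P.rev_eta]; exact L.rel1
  rel2 := by rw [P.rev_rho, P.rev_omega, P.rev_etaStar]; exact L.rel2
  irreducible := L.irreducible
  theta_inj M hM M' hM' h := by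
    have hM : M ≤ P.n := hM
    have hM' : M' ≤ P.n := hM'
    rw [P.rev_theta hM, P.rev_theta hM'] at h
    have := L.theta_inj _ (Nat.sub_le _ _) _ (Nat.sub_le _ _) h
    omega
  thetaStar_inj := L.thetaStar_inj
  ket := L.ket.reindex Fin.revPerm
  ketS := L.ketS
  ket_eig := L.reindex_rev_eig
  ketS_eig := L.ketS_eig

/-- The transposed pair, with chosen eigenbases of the dual space. -/
def dual (bra braS : Basis (Fin (P.n + 1)) ℂ (Dual ℂ V))
    (hbra : ∀ M, bra M ∘ₗ L.A = P.theta M • bra M)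
    (hbraS : ∀ N, braS N ∘ₗ L.As = P.thetaStar N • braS N) : LeonardPair P.dual (Dual ℂ V) where
  A := L.A.dualMap
  As := L.As.dualMap
  rel1 := by
    rw [P.dual_rho, P.dual_omega, P.dual_eta]
    ext φ x
    have h := congrArg (fun f : End ℂ V => φ (f x)) L.rel1
    simp [qComm, Params.dual, mul_sub] at h ⊢
    linear_combination h
  rel2 := by
    rw [P.dual_rho, P.dual_omega, P.dual_etaStar]
    ext φ x
    have h := congrArg (fun f : End ℂ V => φ (f x)) L.rel2
    simp [qComm, Params.dual, mul_sub] at h ⊢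
    linear_combination h
  irreducible W h1 h2 := by
    have : FiniteDimensional ℂ V := L.ket.finiteDimensional_of_finite
    -- In finite dimension, invariant subspaces of the dual correspond to invariant subspaces of `V`
    -- through annihilators.
    have hA : ∀ x ∈ W.dualCoannihilator, L.A x ∈ W.dualCoannihilator := fun x hx => by
      rw [Submodule.mem_dualCoannihilator] at hx ⊢
      exact fun φ hφ => hx _ (h1 φ hφ)
    have hAs : ∀ x ∈ W.dualCoannihilator, L.As x ∈ W.dualCoannihilator := fun x hx => by
      rw [Submodule.mem_dualCoannihilator] at hx ⊢
      exact fun φ hφ => hx _ (h2 φ hφ)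
    have hW : W.dualCoannihilator.dualAnnihilator = W :=
      Subspace.dualCoannihilator_dualAnnihilator_eq
    rcases L.irreducible _ hA hAs with h | h
    · right; rw [← hW, h, Submodule.dualAnnihilator_bot]
    · left; rw [← hW, h, Submodule.dualAnnihilator_top]
  theta_inj M hM M' hM' h := L.theta_inj M hM M' hM' (by simpa only [P.dual_theta] using h)
  thetaStar_inj M hM M' hM' h :=
    L.thetaStar_inj M hM M' hM' (by simpa only [P.dual_thetaStar] using h)
  ket := bra
  ketS := braS
  ket_eig M := by rw [P.dual_theta]; exact hbra M
  ketS_eig M := by rw [P.dual_thetaStar]; exact hbraS M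

/-! ### The operator `S` -/

/-- The affine image of `[A*, A]_q` in terms of which `K₁₂(u)` is `symRoot u - S`, up to a
scalar. -/
def S : End ℂ V :=
  (P.tb * P.tc * P.qq)⁻¹ • (qComm P.q L.As L.A + (P.omega / (P.q - P.q⁻¹)) • 1)

/-- Under the exchange, the q-commutator, `qq` and `q - q⁻¹` all change sign. States built over
`|θ_0⟩` and over `|θ*_0⟩` thus use the same operator. -/
theorem swap_S : L.swap.S = L.S := by
  rw [S, S, P.swap_tb_mul_tc, P.swap_qq, P.swap_omega, P.swap_q_sub, mul_neg, inv_neg, div_neg]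
  simp only [qComm, Params.swap, swap, inv_inv]
  module

theorem rev_S : L.rev.S = L.S := by
  rw [S, S, P.rev_tb_mul_tc, P.rev_omega]; rfl

theorem dual_S (bra braS : Basis (Fin (P.n + 1)) ℂ (Dual ℂ V))
    (hbra : ∀ M, bra M ∘ₗ L.A = P.theta M • bra M)
    (hbraS : ∀ N, braS N ∘ₗ L.As = P.thetaStar N • braS N) :
    (L.dual bra braS hbra hbraS).S = L.S.dualMap := by
  rw [S, S, P.dual_tb_mul_tc, P.dual_qq, P.dual_omega, P.dual_q_sub, mul_neg, inv_neg, div_neg]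
  ext φ x
  simp [qComm, Params.dual, LeonardPair.dual]
  ring

theorem smul_S_apply (x : V) : (P.tb * P.tc * P.qq) • L.S x =
    P.q • L.As (L.A x) - P.q⁻¹ • L.A (L.As x) + (P.omega / (P.q - P.q⁻¹)) • x := by
  have h : P.tb * P.tc * P.qq ≠ 0 := mul_ne_zero (mul_ne_zero P.tb_ne P.tc_ne) P.qq_ne
  rw [S, LinearMap.smul_apply, smul_inv_smul₀ h]
  simp [qComm]

/-- This is the first Askey-Wilson relation with `[A*, A]_q` expressed through `S`: the cubic
relation becomes a q-commutation rule whose remainder is linear in `A*`. -/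
theorem A_S_apply (x : V) : L.A (L.S x) =
    P.q⁻¹ ^ 2 • L.S (L.A x) + P.q⁻¹ • (P.qq • L.As x + P.com • x) := by
  have h : P.tb * P.tc * P.qq ≠ 0 := mul_ne_zero (mul_ne_zero P.tb_ne P.tc_ne) P.qq_ne
  have hq := P.q_ne
  have hq2 := P.q_sub_ne
  have h1 := congrArg L.A (L.smul_S_apply x)
  have h2 := L.smul_S_apply (L.A x)
  have h3 := congrArg (fun f : End ℂ V => f x) L.rel1
  simp only [map_smul, map_add, map_sub] at h1
  simp only [qComm, mul_sub, sub_mul, mul_smul_comm, smul_mul_assoc, LinearMap.add_apply,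
    LinearMap.sub_apply, LinearMap.smul_apply, Module.End.mul_apply, Module.End.one_apply,
    inv_inv, smul_sub, P.eta_eq, Params.rho] at h3
  refine smul_right_injective V h ?_
  dsimp only
  rw [h1, smul_add, smul_comm _ (P.q⁻¹ ^ 2), h2]
  generalize he : P.omega / (P.q - P.q⁻¹) = e at *
  rw [div_eq_iff hq2] at he
  rw [he] at h3
  linear_combination (norm := (match_scalars <;> field_simp <;> ring)) (-P.q⁻¹) • h3

theorem As_S_apply (x : V) : L.As (L.S x) =
    P.q ^ 2 • L.S (L.As x) - P.q • (P.qq • L.A x + P.comStar • x) := by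
  have h := L.swap.A_S_apply x
  rw [L.swap_S, P.swap_com, P.swap_qq] at h
  simp only [swap, Params.swap, inv_inv] at h
  rw [h]
  module

end LeonardPair

end AW

end

noncomputable section

namespace AW

open Module Polynomial

/-! ### Monic polynomials given by their roots. -/

/-- The monic polynomial with the given roots. -/
def rootPoly {M : ℕ} (t : Fin M → ℂ) : ℂ[X] := ∏ i, (X - C (t i))

theorem rootPoly_succ {M : ℕ} (t : Fin (M + 1) → ℂ) :
    rootPoly t = (X - C (t 0)) * rootPoly (Fin.tail t) := by
  rw [rootPoly, Fin.prod_univ_succ]; rfl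

theorem rootPoly_monic {M : ℕ} (t : Fin M → ℂ) : (rootPoly t).Monic :=
  monic_prod_of_monic _ _ fun _ _ => monic_X_sub_C _

theorem rootPoly_natDegree {M : ℕ} (t : Fin M → ℂ) : (rootPoly t).natDegree = M := by
  rw [rootPoly, natDegree_prod_of_monic _ _ fun i _ => monic_X_sub_C _]
  simp

/-! ### Tridiagonality of `A*` and triangularity of `S` in the eigenbasis of `A`; `|θ_0⟩` as a
cyclic vector. -/

namespace Params

variable (P : Params)

/-- The last parenthesis is `θ_M - θ_{N-1}`, written out so that it makes sense at `N = 0`. The two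
roots of the quadratic are the neighbours of `θ_N`, whence tridiagonality. -/
theorem theta_quadratic (M N : ℕ) :
    P.theta M ^ 2 + P.theta N ^ 2 - (P.q ^ 2 + P.q⁻¹ ^ 2) * P.theta M * P.theta N - P.rho =
      (P.theta M - P.theta (N + 1)) *
        (P.theta M - (P.tb * (P.q⁻¹ * P.q ^ N) ^ 2 + P.tc * ((P.q⁻¹ * P.q ^ N) ^ 2)⁻¹)) := by
  have h0 := P.q_ne
  have h1 : P.q ^ N ≠ 0 := pow_ne_zero _ h0
  have h2 : P.q ^ M ≠ 0 := pow_ne_zero _ h0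
  rw [P.theta_eq M, P.theta_eq N, P.theta_eq (N + 1), rho, qq, pow_succ P.q N]
  generalize P.q ^ N = y at *
  generalize P.q ^ M = x at *
  field_simp
  ring

theorem theta_sub_theta_succ (k : ℕ) : P.q * P.theta k - P.q⁻¹ * P.theta (k + 1) =
    P.tc * P.qq / (P.q * (P.q ^ k) ^ 2) := by
  have h0 := P.q_ne
  have h1 : P.q ^ k ≠ 0 := pow_ne_zero _ h0
  rw [P.theta_eq k, P.theta_eq (k + 1), qq, pow_succ P.q k]
  field_simp
  ring

theorem pow_ne_pow {i j : ℕ} (h : i < j) : P.q ^ i ≠ P.q ^ j := by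
  obtain ⟨d, rfl⟩ := Nat.exists_eq_add_of_lt h
  intro h1
  apply P.pow_ne_one (k := d + 1) (by omega)
  have h0 : P.q ^ i ≠ 0 := pow_ne_zero _ P.q_ne
  apply mul_left_cancel₀ h0
  rw [← pow_add, ← add_assoc, ← h1, mul_one]

end Params

namespace LeonardPair

variable {P : Params} {V : Type*} [AddCommGroup V] [Module ℂ V] (L : LeonardPair P V)

/-- The matrix of `A*` in the eigenbasis of `A`. -/
def coef (i j : Fin (P.n + 1)) : ℂ := L.ket.repr (L.As (L.ket j)) i

theorem repr_A (x : V) (i : Fin (P.n + 1)) : L.ket.repr (L.A x) i = P.theta i * L.ket.repr x i := by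
  have h : (L.ket.coord i) ∘ₗ L.A = P.theta i • L.ket.coord i := by
    refine L.ket.ext fun j => ?_
    by_cases hij : j = i
    · subst hij; simp [L.ket_eig]
    · simp [L.ket_eig, hij]
  exact congrArg (fun f : V →ₗ[ℂ] ℂ => f x) h

/-- The matrix entry of `rel1` at `(i, j)` in the eigenbasis of `A`. -/
theorem coef_relation (i j : Fin (P.n + 1)) :
    (P.theta i ^ 2 + P.theta j ^ 2 - (P.q ^ 2 + P.q⁻¹ ^ 2) * P.theta i * P.theta j - P.rho) *
      L.coef i j = if i = j then P.omega * P.theta j + P.eta else 0 := by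
  have h3 := congrArg (fun f : End ℂ V => L.ket.repr (f (L.ket j)) i) L.rel1
  simp only [qComm, mul_sub, sub_mul, mul_smul_comm, smul_mul_assoc, LinearMap.add_apply,
    LinearMap.sub_apply, LinearMap.smul_apply, Module.End.mul_apply, Module.End.one_apply,
    inv_inv, L.ket_eig, map_smul, map_add, map_sub, Finsupp.add_apply, Finsupp.sub_apply,
    Finsupp.smul_apply, smul_eq_mul, L.repr_A, Basis.repr_self, Finsupp.single_apply] at h3
  rw [← coef] at h3
  have hq := P.q_ne
  have e1 : P.q⁻¹ * P.q = 1 := inv_mul_cancel₀ hq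
  by_cases hij : i = j
  · subst hij
    simp only [if_true] at h3 ⊢
    linear_combination h3 - (2 * P.theta i ^ 2 * L.coef i i) * e1
  · simp only [Ne.symm hij, hij, if_false] at h3 ⊢
    linear_combination h3 - ((P.theta i ^ 2 + P.theta j ^ 2) * L.coef i j) * e1

theorem coef_eq_zero {i j : Fin (P.n + 1)} (h : (j : ℕ) + 1 < i) : L.coef i j = 0 := by
  have h0 := P.q_ne
  have hij : i ≠ j := by rintro rfl; omega
  have h1 := L.coef_relation i j
  rw [if_neg hij, P.theta_quadratic] at h1
  refine (mul_eq_zero.1 h1).resolve_left (mul_ne_zero ?_ ?_)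
  · intro h2
    have := L.theta_inj i (by omega) (j + 1) (by omega) (sub_eq_zero.1 h2)
    omega
  -- At `j = 0` the value `θ_{j-1}` lies outside the given spectrum, so distinctness does not apply
  -- to it. Instead `θ_i - θ_{j-1}` is compared with `θ_{i-1} - θ_j`: the index sum is the same,
  -- hence so is the factor containing `b` and `c`, and the other factor is nonzero because `q` is
  -- not a root of unity.
  · obtain ⟨k, hk⟩ : ∃ k, (i : ℕ) = k + 1 := ⟨i - 1, by omega⟩
    have hkj : P.theta k - P.theta j ≠ 0 := fun h2 => by
      have := L.theta_inj k (by omega) j (by omega) (sub_eq_zero.1 h2)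
      omega
    have hx : P.q ^ k ≠ 0 := pow_ne_zero _ h0
    have hy : P.q ^ (j : ℕ) ≠ 0 := pow_ne_zero _ h0
    have e1 : P.theta k - P.theta j = ((P.q ^ k) ^ 2 - (P.q ^ (j : ℕ)) ^ 2) *
        (P.tb - P.tc / ((P.q ^ k) ^ 2 * (P.q ^ (j : ℕ)) ^ 2)) := by
      rw [P.theta_eq, P.theta_eq]; field_simp; ring
    rw [e1] at hkj
    have e2 : P.theta i - (P.tb * (P.q⁻¹ * P.q ^ (j : ℕ)) ^ 2 +
        P.tc * ((P.q⁻¹ * P.q ^ (j : ℕ)) ^ 2)⁻¹) =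
        (P.q ^ (2 * k + 4) - P.q ^ (2 * (j : ℕ))) / P.q ^ 2 *
        (P.tb - P.tc / ((P.q ^ k) ^ 2 * (P.q ^ (j : ℕ)) ^ 2)) := by
      rw [hk, P.theta_eq, pow_succ P.q k, pow_add P.q, pow_mul' P.q 2 k, pow_mul' P.q 2 (j : ℕ)]
      field_simp
      ring
    rw [e2]
    refine mul_ne_zero (div_ne_zero ?_ (pow_ne_zero _ h0)) (right_ne_zero_of_mul hkj)
    exact sub_ne_zero.2 (P.pow_ne_pow (by omega)).symm

theorem repr_apply_eq_sum (f : End ℂ V) (x : V) (i : Fin (P.n + 1)) :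
    L.ket.repr (f x) i = ∑ j, L.ket.repr x j * L.ket.repr (f (L.ket j)) i := by
  conv_lhs => rw [← L.ket.sum_repr x]
  rw [map_sum, map_sum, Finsupp.finsetSum_apply]
  simp

/-- Otherwise the span of the eigenvectors with index at most `j` would be a proper nonzero
invariant subspace. -/
theorem coef_succ_ne_zero {i j : Fin (P.n + 1)} (h : (i : ℕ) = j + 1) : L.coef i j ≠ 0 := by
  intro h0
  let W : Submodule ℂ V :=
    { carrier := {x | ∀ l, j < l → L.ket.repr x l = 0}
      add_mem' := fun {a b} ha hb l hl => by simp [ha l hl, hb l hl]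
      zero_mem' := fun l _ => by simp
      smul_mem' := fun c x hx l hl => by simp [hx l hl] }
  have hW : ∀ x, x ∈ W ↔ ∀ l, j < l → L.ket.repr x l = 0 := fun x => Iff.rfl
  have hA : ∀ x ∈ W, L.A x ∈ W := fun x hx l hl => by rw [L.repr_A, hx l hl, mul_zero]
  have hAs : ∀ x ∈ W, L.As x ∈ W := fun x hx l hl => by
    rw [L.repr_apply_eq_sum]
    refine Finset.sum_eq_zero fun k _ => ?_
    by_cases hk : j < k
    · rw [hx k hk, zero_mul]
    · have hk' : (k : ℕ) ≤ j := not_lt.1 hk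
      have hl' : (j : ℕ) < l := hl
      by_cases h1 : (k : ℕ) + 1 < l
      · rw [← coef, L.coef_eq_zero h1, mul_zero]
      · have e1 : k = j := Fin.ext (by omega)
        have e2 : l = i := Fin.ext (by omega)
        rw [e1, e2, ← coef, h0, mul_zero]
  have hji : j < i := by rw [Fin.lt_def]; omega
  rcases L.irreducible W hA hAs with h1 | h1
  · have : L.ket j ∈ W := fun l hl => by simp [hl.ne]
    rw [h1, Submodule.mem_bot] at this
    exact L.ket.ne_zero j this
  · have : L.ket i ∈ W := by rw [h1]; trivial
    have := this i hji
    simp at this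

theorem repr_S_ket (i j : Fin (P.n + 1)) : (P.tb * P.tc * P.qq) * L.ket.repr (L.S (L.ket j)) i =
    (P.q * P.theta j - P.q⁻¹ * P.theta i) * L.coef i j +
      if i = j then P.omega / (P.q - P.q⁻¹) else 0 := by
  have h := congrArg (fun x => L.ket.repr x i) (L.smul_S_apply (L.ket j))
  simp only [L.ket_eig, map_smul, map_add, map_sub, Finsupp.add_apply, Finsupp.sub_apply,
    Finsupp.smul_apply, smul_eq_mul, L.repr_A, Basis.repr_self, Finsupp.single_apply] at h
  rw [h, coef]
  by_cases hij : i = j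
  · simp [hij]; ring
  · simp [hij, Ne.symm hij]; ring

theorem tb_tc_qq_ne : P.tb * P.tc * P.qq ≠ 0 := mul_ne_zero (mul_ne_zero P.tb_ne P.tc_ne) P.qq_ne

theorem repr_S_ket_eq_zero {i j : Fin (P.n + 1)} (h : (j : ℕ) + 1 < i) :
    L.ket.repr (L.S (L.ket j)) i = 0 := by
  have hij : i ≠ j := by rintro rfl; omega
  have h1 := L.repr_S_ket i j
  rw [if_neg hij, L.coef_eq_zero h, mul_zero, add_zero] at h1
  exact (mul_eq_zero.1 h1).resolve_left tb_tc_qq_ne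

/-- The denominator is the scalar supplied by the dynamical operators, which is why the
normalizations of the Bethe states involve only entries of `A*`. -/
theorem repr_S_ket_succ {i j : Fin (P.n + 1)} (h : (i : ℕ) = j + 1) :
    L.ket.repr (L.S (L.ket j)) i = L.coef i j / (P.tb * P.q ^ (2 * (j : ℕ) + 1)) := by
  have hij : i ≠ j := by rintro rfl; omega
  have h1 := L.repr_S_ket i j
  rw [if_neg hij, h, P.theta_sub_theta_succ, add_zero] at h1
  have h0 := P.q_ne
  have hb := P.tb_ne
  have hc := P.tc_ne
  have hQ := P.qq_ne
  have hx : P.q ^ (j : ℕ) ≠ 0 := pow_ne_zero _ h0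
  rw [pow_succ, pow_mul', eq_div_iff (by positivity)]
  field_simp at h1
  linear_combination h1

theorem repr_S_eq_zero {m : ℕ} {x : V} (hx : ∀ i : Fin (P.n + 1), m < i → L.ket.repr x i = 0)
    (i : Fin (P.n + 1)) (hi : m + 1 < i) : L.ket.repr (L.S x) i = 0 := by
  rw [L.repr_apply_eq_sum]
  refine Finset.sum_eq_zero fun k _ => ?_
  by_cases hk : m < k
  · rw [hx k hk, zero_mul]
  · rw [L.repr_S_ket_eq_zero (by omega), mul_zero]

theorem repr_S_succ {x : V} {i j : Fin (P.n + 1)} (h : (i : ℕ) = j + 1)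
    (hx : ∀ i : Fin (P.n + 1), j < i → L.ket.repr x i = 0) :
    L.ket.repr (L.S x) i = L.ket.repr x j * L.ket.repr (L.S (L.ket j)) i := by
  rw [L.repr_apply_eq_sum]
  refine Finset.sum_eq_single j (fun k _ hk => ?_) (by simp)
  by_cases hk' : j < k
  · rw [hx k hk', zero_mul]
  · have : (k : ℕ) ≤ j := not_lt.1 hk'
    have : (k : ℕ) ≠ j := fun e => hk (Fin.ext e)
    rw [L.repr_S_ket_eq_zero (by omega), mul_zero]

/-- The vector `∏ (S - t_i) |θ_0⟩`. -/
def vec {M : ℕ} (t : Fin M → ℂ) : V := aeval L.S (rootPoly t) (L.ket 0)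

theorem vec_succ {M : ℕ} (t : Fin (M + 1) → ℂ) :
    L.vec t = L.S (L.vec (Fin.tail t)) - t 0 • L.vec (Fin.tail t) := by
  simp only [vec, rootPoly_succ, map_mul, map_sub, aeval_X, aeval_C, Module.End.mul_apply,
    LinearMap.sub_apply, Module.algebraMap_end_apply]

theorem repr_vec_eq_zero {M : ℕ} (t : Fin M → ℂ) (i : Fin (P.n + 1)) (hi : M < i) :
    L.ket.repr (L.vec t) i = 0 := by
  induction M generalizing i with
  | zero =>
    have : (0 : Fin (P.n + 1)) ≠ i := by rintro rfl; simp at hi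
    simp [vec, rootPoly, this]
  | succ M ih =>
    rw [vec_succ, map_sub, map_smul, Finsupp.sub_apply, Finsupp.smul_apply,
      ih _ i (by omega), L.repr_S_eq_zero (ih _) i hi]
    simp

/-- Each factor `S - t_i` raises the top index by at most one, and the shift by `t_i` does not reach
the new top coordinate. The result is therefore independent of `t`. -/
theorem repr_vec {M : ℕ} (hM : M ≤ P.n) (t : Fin M → ℂ) :
    L.ket.repr (L.vec t) ⟨M, Nat.lt_succ_iff.2 hM⟩ =
      ∏ k : Fin M, L.coef (LeonardRep.hi hM k) (LeonardRep.lo hM k) /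
        (P.tb * P.q ^ (2 * (k : ℕ) + 1)) := by
  induction M with
  | zero => simp [vec, rootPoly]
  | succ M ih =>
    have h1 : L.ket.repr (L.vec (Fin.tail t)) ⟨M + 1, by omega⟩ = 0 :=
      L.repr_vec_eq_zero _ _ (by simp)
    rw [vec_succ, map_sub, map_smul, Finsupp.sub_apply, Finsupp.smul_apply, h1,
      L.repr_S_succ (j := ⟨M, Nat.lt_succ_of_lt hM⟩) rfl (fun i hi => L.repr_vec_eq_zero _ i hi),
      ih (by omega), Fin.prod_univ_castSucc, L.repr_S_ket_succ rfl, smul_zero, sub_zero]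
    rfl

/-- The normalized vector `∏ (S - t_i) |θ_0⟩`. -/
def nstate {M : ℕ} (hM : M ≤ P.n) (t : Fin M → ℂ) : V :=
  (∏ k : Fin M, P.tb * P.q ^ (2 * (k : ℕ) + 1) /
    L.coef (LeonardRep.hi hM k) (LeonardRep.lo hM k)) • L.vec t

theorem repr_nstate {M : ℕ} (hM : M ≤ P.n) (t : Fin M → ℂ) :
    L.ket.repr (L.nstate hM t) ⟨M, Nat.lt_succ_iff.2 hM⟩ = 1 := by
  rw [nstate, map_smul, Finsupp.smul_apply, L.repr_vec hM, smul_eq_mul, ← Finset.prod_mul_distrib]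
  refine Finset.prod_eq_one fun k _ => ?_
  have := L.coef_succ_ne_zero (i := LeonardRep.hi hM k) (j := LeonardRep.lo hM k) rfl
  have := P.q_ne
  have := P.tb_ne
  field_simp

theorem eq_smul_ket {x : V} {i : Fin (P.n + 1)} (hx : L.A x = P.theta i • x) :
    x = L.ket.repr x i • L.ket i := by
  apply L.ket.repr.injective
  refine Finsupp.ext fun j => ?_
  rw [map_smul, Finsupp.smul_apply, Basis.repr_self, Finsupp.single_apply]
  by_cases hij : i = j
  · simp [hij]
  · by_contra h1
    rw [if_neg hij, smul_zero] at h1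
    have h : P.theta j * L.ket.repr x j = P.theta i * L.ket.repr x j := by
      rw [← L.repr_A, hx, map_smul, Finsupp.smul_apply, smul_eq_mul]
    exact hij (Fin.ext (L.theta_inj i (by omega) j (by omega) (mul_right_cancel₀ h1 h).symm))

/-- One nonzero coordinate identifies the eigenvalue, so in the homogeneous case it never has to be
computed from the Bethe roots. -/
theorem eq_smul_ket_of_eigen {x : V} {κ : ℂ} (hx : L.A x = κ • x) {i : Fin (P.n + 1)}
    (hi : L.ket.repr x i ≠ 0) : x = L.ket.repr x i • L.ket i := by
  have hκ : P.theta i = κ := by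
    apply mul_right_cancel₀ hi
    rw [← L.repr_A, hx, map_smul, Finsupp.smul_apply, smul_eq_mul]
  exact L.eq_smul_ket (by rw [hx, hκ])

theorem eq_zero_of_eigen {x : V} {κ : ℂ} (hx : L.A x = κ • x)
    (hκ : ∀ M ≤ P.n, κ ≠ P.theta M) : x = 0 := by
  by_contra h0
  obtain ⟨i, hi⟩ : ∃ i, L.ket.repr x i ≠ 0 := by
    by_contra! h
    exact h0 (L.ket.repr.injective (Finsupp.ext fun j => by simp [h j]))
  apply hκ i (by omega)
  apply mul_right_cancel₀ hi
  rw [← L.repr_A, hx, map_smul, Finsupp.smul_apply, smul_eq_mul]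

/-- The nonzero subdiagonal of `S` makes `|θ_0⟩` cyclic, and `p(S)` commutes with `S`. -/
theorem aeval_S_eq_zero {p : ℂ[X]} (hp : aeval L.S p (L.ket 0) = 0) : aeval L.S p = 0 := by
  have hc : ∀ x, aeval L.S p (L.S x) = L.S (aeval L.S p x) := fun x => by
    have h1 : aeval L.S (p * X) = aeval L.S (X * p) := by rw [mul_comm]
    rw [map_mul, map_mul, aeval_X] at h1
    exact congrArg (fun f : End ℂ V => f x) h1
  have key : ∀ m : ℕ, ∀ j : Fin (P.n + 1), (j : ℕ) = m → aeval L.S p (L.ket j) = 0 := by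
    intro m
    induction m using Nat.strong_induction_on with
    | _ m ih =>
      intro j hj
      rcases Nat.eq_zero_or_pos m with h0 | h0
      · have : j = 0 := Fin.ext (hj.trans h0)
        rw [this, hp]
      · obtain ⟨k, rfl⟩ : ∃ k, m = k + 1 := ⟨m - 1, by omega⟩
        let l : Fin (P.n + 1) := ⟨k, by omega⟩
        have hl : aeval L.S p (L.ket l) = 0 := ih k (by omega) l rfl
        have h1 : aeval L.S p (L.S (L.ket l)) = 0 := by rw [hc, hl, map_zero]
        rw [← L.ket.sum_repr (L.S (L.ket l)), map_sum, Finset.sum_eq_single j] at h1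
        · rw [map_smul, smul_eq_zero] at h1
          refine h1.resolve_left ?_
          rw [L.repr_S_ket_succ hj]
          exact div_ne_zero (L.coef_succ_ne_zero hj) (mul_ne_zero P.tb_ne (pow_ne_zero _ P.q_ne))
        · intro i _ hij
          rw [map_smul]
          have hne : (i : ℕ) ≠ j := fun e => hij (Fin.ext e)
          by_cases hi : (i : ℕ) < k + 1
          · rw [ih i hi i rfl, smul_zero]
          · have hlk : (l : ℕ) = k := rfl
            rw [L.repr_S_ket_eq_zero (by omega), zero_smul]
        · simp
  exact L.ket.ext fun j => key _ j rfl

end LeonardPair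

/-! ### The value of `A*` on `|θ_0⟩`. -/

namespace Params

variable (P : Params)

/-- The constant term of `A*` on `|θ_0⟩`, as an affine function of `S`. -/
def lzero : ℂ := P.qn⁻¹ * P.edgeStar - P.tb * P.zz * (P.qn * P.q)

/-- The right-hand side of `coef_relation` at `(0, 0)` contains the factor `tb - q² tc`,
proportional to `θ_0 - θ_{-1}`, which also divides the quadratic on its left-hand side. -/
theorem lzero_identity : P.omega * (P.tb + P.tc) + P.eta =
    (P.tb - P.q ^ 2 * P.tc) *
      ((P.q - P.q⁻¹) * P.tc * P.qq * P.q⁻¹ * P.lzero + P.omega) := by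
  have h0 := P.q_ne
  have h1 := P.qn_ne
  have h2 := P.tb_ne
  rw [omega_eq, eta_eq, com, lzero, edge_eq, edgeStar_eq, ww, qq, P.tc_eq]
  field_simp
  ring

theorem sq_pow_add_one_ne (i : ℕ) : (P.q ^ i) ^ 2 + 1 ≠ 0 := by
  intro h
  rcases Nat.eq_zero_or_pos i with rfl | hi
  · norm_num at h
  · apply P.pow_ne_one (k := 4 * i) (by omega)
    rw [pow_mul']
    linear_combination ((P.q ^ i) ^ 2 - 1) * h

theorem sum_thetaStar (m : ℕ) : (P.q - P.q⁻¹) * ∑ N ∈ Finset.range m, P.thetaStar N =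
    P.tbs * P.q⁻¹ * ((P.q ^ m) ^ 2 - 1) + P.tcs * P.q * (1 - ((P.q ^ m) ^ 2)⁻¹) := by
  have h0 := P.q_ne
  induction m with
  | zero => simp
  | succ m ih =>
    have h1 : P.q ^ m ≠ 0 := pow_ne_zero _ h0
    rw [Finset.sum_range_succ, mul_add, ih, P.thetaStar_eq, pow_succ P.q m]
    field_simp
    ring

theorem theta_injective_of_lt {i : ℕ} (hi : i ≠ 0) (hb : P.tb = P.q ^ 2 * P.tc) :
    P.theta i - P.theta 0 ≠ 0 := by
  have h0 := P.q_ne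
  have h1 : P.q ^ i ≠ 0 := pow_ne_zero _ h0
  have e : P.theta i - P.theta 0 =
      (P.q ^ (2 * i) - P.q ^ 0) * (P.tc * (P.q ^ (2 * i + 2) - P.q ^ 0) / P.q ^ (2 * i)) := by
    rw [theta_eq, theta_eq, hb, pow_zero, pow_add P.q, pow_mul' P.q 2 i]
    field_simp
    ring
  rw [e]
  refine mul_ne_zero (sub_ne_zero.2 (P.pow_ne_pow (by omega)).symm)
    (div_ne_zero (mul_ne_zero P.tc_ne (sub_ne_zero.2 (P.pow_ne_pow (by omega)).symm))
      (pow_ne_zero _ h0))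

end Params

namespace LeonardPair

variable {P : Params} {V : Type*} [AddCommGroup V] [Module ℂ V] (L : LeonardPair P V)

/-- The trace of `A*` computed in its matrix over each of the two eigenbases. -/
theorem sum_coef : ∑ i, L.coef i i = ∑ N ∈ Finset.range (P.n + 1), P.thetaStar N := by
  have h1 := LinearMap.trace_eq_matrix_trace ℂ L.ket L.As
  rw [LinearMap.trace_eq_matrix_trace ℂ L.ketS L.As] at h1
  simp only [Matrix.trace, Matrix.diag_apply, LinearMap.toMatrix_apply, L.ketS_eig, map_smul,
    Finsupp.smul_apply, Basis.repr_self, Finsupp.single_eq_same, smul_eq_mul, mul_one] at h1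
  rw [Finset.sum_range]
  exact h1.symm

/-- The diagonal of `A*` in the case `θ_0 = θ_{-1}`, where the Askey-Wilson relations do not
determine the first entry. -/
theorem coef_self_of_degenerate (hb : P.tb = P.q ^ 2 * P.tc) (i : Fin (P.n + 1)) (hi : i ≠ 0) :
    L.coef i i = P.ww * (P.edgeStar - P.q * P.tc * P.zz) / (2 * (P.q - P.q⁻¹)) *
      (((P.q ^ ((i : ℕ) + 1)) ^ 2 - 1) / ((P.q ^ ((i : ℕ) + 1)) ^ 2 + 1) -
        ((P.q ^ (i : ℕ)) ^ 2 - 1) / ((P.q ^ (i : ℕ)) ^ 2 + 1)) := by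
  have h0 := P.q_ne
  have hy := P.qn_ne
  have hc := P.tc_ne
  have hq := P.q_sub_ne
  have hi' : (i : ℕ) ≠ 0 := fun h => hi (Fin.ext h)
  have h1 := L.coef_relation i i
  rw [if_pos rfl] at h1
  have hθ := P.theta_injective_of_lt hi' hb
  have e1 : P.theta i ^ 2 + P.theta i ^ 2 - (P.q ^ 2 + P.q⁻¹ ^ 2) * P.theta i * P.theta i - P.rho =
      -(P.q - P.q⁻¹) ^ 2 * ((P.theta i + P.theta 0) * (P.theta i - P.theta 0)) := by
    rw [Params.rho, Params.qq, P.theta_eq 0, hb, pow_zero]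
    field_simp
    ring
  have hκ : P.edge = P.tc * P.q * P.ww := by
    rw [P.edge_eq, Params.ww, hb]; field_simp
  have e2 : P.omega * P.theta i + P.eta = (P.q - P.q⁻¹) ^ 2 *
      (P.q * P.tc * P.ww * (P.q * P.tc * P.zz - P.edgeStar)) * (P.theta i - P.theta 0) := by
    rw [P.omega_eq, P.eta_eq, Params.com, P.qq_eq, hκ, P.theta_eq 0, hb, pow_zero]
    field_simp
    ring
  rw [e1, e2] at h1
  have h2 : (P.theta i + P.theta 0) * L.coef i i =
      P.q * P.tc * P.ww * (P.edgeStar - P.q * P.tc * P.zz) := by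
    apply mul_left_cancel₀ hθ
    apply mul_left_cancel₀ (pow_ne_zero 2 hq)
    linear_combination -h1
  have hx : P.q ^ (i : ℕ) ≠ 0 := pow_ne_zero _ h0
  have hx1 := P.sq_pow_add_one_ne i
  have hx2 := P.sq_pow_add_one_ne (i + 1)
  have e3 : P.theta i + P.theta 0 = P.tc * (((P.q ^ ((i : ℕ) + 1)) ^ 2 + 1) *
      ((P.q ^ (i : ℕ)) ^ 2 + 1)) / (P.q ^ (i : ℕ)) ^ 2 := by
    rw [P.theta_eq i, P.theta_eq 0, hb, pow_zero, pow_succ P.q i]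
    field_simp
    ring
  rw [e3] at h2
  have h3 : L.coef i i * (((P.q ^ ((i : ℕ) + 1)) ^ 2 + 1) * ((P.q ^ (i : ℕ)) ^ 2 + 1)) =
      P.q * P.ww * (P.edgeStar - P.q * P.tc * P.zz) * (P.q ^ (i : ℕ)) ^ 2 := by
    field_simp at h2
    linear_combination h2
  -- Writing the entry as a difference of values of `(x - 1)/(x + 1)` at `x = q^{2i+2}` and `x =
  -- q^{2i}` makes the sum over the diagonal telescope.
  have e4 : ((P.q ^ ((i : ℕ) + 1)) ^ 2 - 1) / ((P.q ^ ((i : ℕ) + 1)) ^ 2 + 1) -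
        ((P.q ^ (i : ℕ)) ^ 2 - 1) / ((P.q ^ (i : ℕ)) ^ 2 + 1) =
      2 * P.q * (P.q ^ (i : ℕ)) ^ 2 * (P.q - P.q⁻¹) /
        (((P.q ^ ((i : ℕ) + 1)) ^ 2 + 1) * ((P.q ^ (i : ℕ)) ^ 2 + 1)) := by
    rw [div_sub_div _ _ hx2 hx1]
    congr 1
    rw [pow_succ P.q i]
    field_simp
    ring
  rw [e4]
  have h4 : ((P.q ^ ((i : ℕ) + 1)) ^ 2 + 1) * ((P.q ^ (i : ℕ)) ^ 2 + 1) ≠ 0 := mul_ne_zero hx2 hx1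
  rw [eq_div_of_mul_eq h4 h3]
  generalize P.q - P.q⁻¹ = d at *
  field_simp

/-- Generically the common factor `tb - q² tc` cancels from `coef_relation`. When it vanishes, the
relation at `(0, 0)` is empty, and the entry is recovered from the trace, the other diagonal entries
being known. -/
theorem coef_zero_zero : (P.q - P.q⁻¹) * P.tb * P.q * (P.q⁻¹ ^ 2 * P.tc - P.tb) * L.coef 0 0 =
    P.tb * P.tc * P.qq * P.lzero + P.q * P.tb * P.omega / (P.q - P.q⁻¹) := by
  have h0 := P.q_ne
  have hy := P.qn_ne
  have hc := P.tc_ne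
  have hb0 := P.tb_ne
  have hq := P.q_sub_ne
  by_cases hb : P.tb = P.q ^ 2 * P.tc
  · have h1 := L.sum_coef
    rw [Fin.sum_univ_succ, Finset.sum_congr rfl fun i _ =>
      L.coef_self_of_degenerate hb (Fin.succ i) (Fin.succ_ne_zero i), ← Finset.mul_sum] at h1
    simp only [Fin.val_succ] at h1
    rw [← Finset.sum_range (fun i : ℕ =>
      ((P.q ^ (i + 1 + 1)) ^ 2 - 1) / ((P.q ^ (i + 1 + 1)) ^ 2 + 1) -
        ((P.q ^ (i + 1)) ^ 2 - 1) / ((P.q ^ (i + 1)) ^ 2 + 1)),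
      Finset.sum_range_sub (fun i : ℕ =>
        ((P.q ^ (i + 1)) ^ 2 - 1) / ((P.q ^ (i + 1)) ^ 2 + 1))] at h1
    have h2 := P.sum_thetaStar (P.n + 1)
    have hx1 := P.sq_pow_add_one_ne 1
    have hx2 := P.sq_pow_add_one_ne (P.n + 1)
    have h3 : P.q ^ (P.n + 1) = P.qn * P.q := pow_succ _ _
    rw [h3] at h1 h2 hx2
    rw [zero_add, pow_one] at h1
    rw [pow_one] at hx1
    have h4 : P.ww = ((P.qn * P.q) ^ 2 + 1) / (P.qn * P.q) := by
      rw [Params.ww]; field_simp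
    have h5 : (P.q - P.q⁻¹) * L.coef 0 0 =
        P.tbs * P.q⁻¹ * ((P.qn * P.q) ^ 2 - 1) + P.tcs * P.q * (1 - ((P.qn * P.q) ^ 2)⁻¹) -
        (P.edgeStar - P.q * P.tc * P.zz) / (2 * (P.qn * P.q)) *
          (((P.qn * P.q) ^ 2 - 1) - ((P.qn * P.q) ^ 2 + 1) * ((P.q ^ 2 - 1) / (P.q ^ 2 + 1))) := by
      rw [← h2, ← h1, h4]
      generalize L.coef 0 0 = a
      generalize P.qn * P.q = w at *
      generalize P.q - P.q⁻¹ = d at *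
      field_simp
      ring
    have h6 : P.omega / (P.q - P.q⁻¹) = (P.q - P.q⁻¹) *
        (P.q * P.tc * P.ww * (P.q * P.tc * P.zz - P.edgeStar)) := by
      have hκ : P.edge = P.tc * P.q * P.ww := by
        rw [P.edge_eq, Params.ww, hb]; field_simp
      rw [P.omega_eq, hκ, hb]
      generalize P.q - P.q⁻¹ = d at *
      field_simp
    rw [mul_div_assoc, h6, h4]
    have h7 : (P.q - P.q⁻¹) * P.tb * P.q * (P.q⁻¹ ^ 2 * P.tc - P.tb) * L.coef 0 0 =
      P.tb * P.q * (P.q⁻¹ ^ 2 * P.tc - P.tb) * ((P.q - P.q⁻¹) * L.coef 0 0) := by ring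
    rw [h7, h5, Params.lzero, P.edgeStar_eq, Params.qq, hb]
    field_simp
    ring
  · have h1 := L.coef_relation 0 0
    have h2 := P.lzero_identity
    have hθ : P.theta ((0 : Fin (P.n + 1)) : ℕ) = P.tb + P.tc := by
      rw [P.theta_eq]; simp
    rw [if_pos rfl, hθ, h2] at h1
    have hne : P.tb - P.q ^ 2 * P.tc ≠ 0 := sub_ne_zero.2 hb
    have e1 : (P.tb + P.tc) ^ 2 + (P.tb + P.tc) ^ 2 -
        (P.q ^ 2 + P.q⁻¹ ^ 2) * (P.tb + P.tc) * (P.tb + P.tc) - P.rho =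
        (P.tb - P.q ^ 2 * P.tc) * ((P.q - P.q⁻¹) ^ 2 * (P.q⁻¹ ^ 2 * P.tc - P.tb)) := by
      rw [Params.rho, Params.qq]; field_simp; ring
    rw [e1, mul_assoc] at h1
    have h3 := mul_left_cancel₀ hne h1
    apply mul_left_cancel₀ hq
    have e2 : (P.q - P.q⁻¹) * (P.q * P.tb * P.omega / (P.q - P.q⁻¹)) = P.q * P.tb * P.omega :=
      mul_div_cancel₀ _ hq
    have e3 : P.q * P.q⁻¹ = 1 := mul_inv_cancel₀ h0
    linear_combination P.q * P.tb * h3 - e2 +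
      (P.q - P.q⁻¹) * P.tb * P.tc * P.qq * P.lzero * e3

/-- Both `A*` and `S` send `|θ_0⟩` into the span of the first two eigenvectors, with proportional
second coordinates; `coef_zero_zero` matches the first ones. This starts every induction on
polynomials in `S`. -/
theorem As_ket_zero :
    L.As (L.ket 0) = (P.q * P.tb) • L.S (L.ket 0) + P.lzero • L.ket 0 := by
  have h0 := P.q_ne
  have hb := P.tb_ne
  apply L.ket.repr.injective
  refine Finsupp.ext fun i => ?_
  simp only [map_add, map_smul, Finsupp.add_apply, Finsupp.smul_apply, smul_eq_mul,
    Basis.repr_self, Finsupp.single_apply]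
  rw [← coef]
  rcases lt_trichotomy (i : ℕ) 1 with hi | hi | hi
  · have hi0 : i = 0 := Fin.ext (by simpa using hi)
    subst hi0
    have h1 := L.repr_S_ket 0 0
    have h2 := L.coef_zero_zero
    have hθ : P.theta ((0 : Fin (P.n + 1)) : ℕ) = P.tb + P.tc := by
      rw [P.theta_eq]; simp
    rw [if_pos rfl, hθ] at h1
    rw [if_pos rfl]
    apply mul_left_cancel₀ (tb_tc_qq_ne (P := P))
    have e3 : P.q * P.q⁻¹ = 1 := mul_inv_cancel₀ h0
    rw [P.qq_eq] at *
    linear_combination (-P.q * P.tb) * h1 + h2 - 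
      (P.q - P.q⁻¹) * P.tb * P.tc * P.q⁻¹ * L.coef 0 0 * e3
  · have h1 := L.repr_S_ket_succ (i := i) (j := 0) hi
    have hne : (0 : Fin (P.n + 1)) ≠ i := by rintro rfl; simp at hi
    rw [h1, if_neg hne]
    simp
    field_simp
  · have hne : (0 : Fin (P.n + 1)) ≠ i := by rintro rfl; simp at hi
    rw [L.coef_eq_zero hi, L.repr_S_ket_eq_zero hi, if_neg hne]
    simp

end LeonardPair

/-! ### The split basis and the polynomial annihilating `S`. -/

namespace Params

variable (P : Params)

/-- The eigenvalues `q^{2s-2k} ζ² + q^{2k-2s} ζ⁻²` of `S`. -/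
def node (k : ℕ) : ℂ :=
  P.qn * P.ζ ^ 2 / (P.q ^ k) ^ 2 + (P.q ^ k) ^ 2 / (P.qn * P.ζ ^ 2)

/-- The characteristic polynomial of `S`. -/
def charS : ℂ[X] := rootPoly fun k : Fin (P.n + 1) => P.node k

/-- The superdiagonal of `A` in the split basis. -/
def splitPhi (k : ℕ) : ℂ :=
  -((P.q ^ k - (P.q ^ k)⁻¹) * (P.qn * P.q / P.q ^ k - P.q ^ k / (P.qn * P.q)) *
    (P.tcs * P.q * P.ζ ^ 2 / (P.q ^ k) ^ 2 + P.tb * P.qn) *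
    (P.tbs / P.tb + (P.q ^ k) ^ 2 / (P.qn * P.q * P.ζ ^ 2)))

/-- The diagonal of `A*` in the split basis. -/
def splitMu (k : ℕ) : ℂ := (P.q ^ k) ^ 2 *
  (P.lzero + P.q * P.tb * P.node 0 + P.tb / (P.ζ ^ 2 * P.qn) * (P.q + P.q⁻¹) * ((P.q ^ k) ^ 2 - 1))

/-- The superdiagonal of `A*` in the split basis. -/
def splitNu (k : ℕ) : ℂ := (P.q ^ k) ^ 2 / (P.q * P.qn * P.ζ ^ 2) * P.splitPhi k

/-- The value `node (k - 1)`. -/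
def nodePred (k : ℕ) : ℂ :=
  P.qn * P.ζ ^ 2 * P.q ^ 2 / (P.q ^ k) ^ 2 + (P.q ^ k) ^ 2 / (P.qn * P.ζ ^ 2 * P.q ^ 2)

theorem nodePred_succ (k : ℕ) : P.nodePred (k + 1) = P.node k := by
  have h0 := P.q_ne
  have h1 : P.q ^ k ≠ 0 := pow_ne_zero _ h0
  have h2 := P.qn_ne
  have h3 := P.ζ_ne
  rw [nodePred, node, pow_succ P.q k]
  field_simp

/-- This identity and the five recursions down to `split_nu_zero` are the coefficient comparisons in
the inductive step of `A_split_and_As_split`. -/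
theorem split_theta (k : ℕ) :
    P.q⁻¹ ^ 2 * P.theta k + P.q⁻¹ * P.qq * (P.tb * P.q * (P.q ^ k) ^ 2) = P.theta (k + 1) := by
  have h0 := P.q_ne
  have h1 : P.q ^ k ≠ 0 := pow_ne_zero _ h0
  rw [theta_eq, theta_eq, qq, pow_succ P.q k]
  field_simp
  ring

theorem split_phi (k : ℕ) : P.q⁻¹ ^ 2 * P.theta k * P.node k + P.q⁻¹ ^ 2 * P.splitPhi k +
    P.q⁻¹ * (P.qq * P.splitMu k + P.com) - P.node k * P.theta k = P.splitPhi (k + 1) := by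
  have h0 := P.q_ne
  have h1 : P.q ^ k ≠ 0 := pow_ne_zero _ h0
  have h2 := P.qn_ne
  have h3 := P.ζ_ne
  have h4 := P.tb_ne
  rw [theta_eq, qq, splitPhi, splitPhi, splitMu, node, node, pow_zero, lzero, com, edge_eq,
    edgeStar_eq, zz, ww, P.tc_eq, pow_succ P.q k]
  generalize P.q ^ k = x at *
  field_simp
  ring

theorem split_phi_zero (k : ℕ) : P.q⁻¹ ^ 2 * P.splitPhi k * P.nodePred k +
    P.q⁻¹ * P.qq * P.splitNu k - P.node k * P.splitPhi k = 0 := by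
  have h0 := P.q_ne
  have h1 : P.q ^ k ≠ 0 := pow_ne_zero _ h0
  have h2 := P.qn_ne
  have h3 := P.ζ_ne
  rw [qq, node, nodePred, splitNu]
  generalize P.splitPhi k = p at *
  generalize P.q ^ k = x at *
  field_simp
  ring

theorem split_mu (k : ℕ) : P.q ^ 2 * (P.tb * P.q * (P.q ^ k) ^ 2) * P.node (k + 1) +
    P.q ^ 2 * P.splitMu k - P.node k * (P.tb * P.q * (P.q ^ k) ^ 2) = P.splitMu (k + 1) := by
  have h0 := P.q_ne
  have h1 : P.q ^ k ≠ 0 := pow_ne_zero _ h0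
  have h2 := P.qn_ne
  have h3 := P.ζ_ne
  rw [splitMu, splitMu]
  generalize P.node 0 = w at *
  rw [node, node, pow_succ P.q k]
  generalize P.q ^ k = x at *
  field_simp
  ring

theorem split_nu (k : ℕ) : P.q ^ 2 * P.splitMu k * P.node k + P.q ^ 2 * P.splitNu k -
    P.q * (P.qq * P.theta k + P.comStar) - P.node k * P.splitMu k = P.splitNu (k + 1) := by
  have h0 := P.q_ne
  have h1 : P.q ^ k ≠ 0 := pow_ne_zero _ h0
  have h2 := P.qn_ne
  have h3 := P.ζ_ne
  have h4 := P.tb_ne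
  rw [theta_eq, qq, splitNu, splitNu, splitPhi, splitPhi, splitMu, node, node, pow_zero, lzero,
    comStar, edge_eq, edgeStar_eq, zz, ww, P.tc_eq, pow_succ P.q k]
  generalize P.q ^ k = x at *
  field_simp
  ring

theorem split_nu_zero (k : ℕ) : P.q ^ 2 * P.splitNu k * P.nodePred k -
    P.q * P.qq * P.splitPhi k - P.node k * P.splitNu k = 0 := by
  have h0 := P.q_ne
  have h1 : P.q ^ k ≠ 0 := pow_ne_zero _ h0
  have h2 := P.qn_ne
  have h3 := P.ζ_ne
  rw [qq, node, nodePred, splitNu]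
  generalize P.splitPhi k = p at *
  generalize P.q ^ k = x at *
  field_simp
  ring

theorem splitPhi_zero : P.splitPhi 0 = 0 := by simp [splitPhi]

/-- The off-diagonal term of `A` stops exactly after `2s + 1` factors, which makes `split (2s + 1)`
satisfy an eigenvalue equation. -/
theorem splitPhi_last : P.splitPhi (P.n + 1) = 0 := by
  have h0 := P.q_ne
  have h2 := P.qn_ne
  have h : P.q ^ (P.n + 1) = P.qn * P.q := pow_succ _ _
  rw [splitPhi, h, div_self (mul_ne_zero h2 h0)]
  ring

end Params

namespace LeonardPair

variable {P : Params} {V : Type*} [AddCommGroup V] [Module ℂ V] (L : LeonardPair P V)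

/-- The split basis: `∏_{i < k} (S - node i) |θ_0⟩`. -/
def split : ℕ → V
  | 0 => L.ket 0
  | k + 1 => L.S (split k) - P.node k • split k

/-- The predecessor of `split k`. -/
def splitPred : ℕ → V
  | 0 => 0
  | k + 1 => L.split k

theorem A_split_and_As_split (k : ℕ) :
    L.A (L.split k) = P.theta k • L.split k + P.splitPhi k • L.splitPred k ∧
      L.As (L.split k) = (P.tb * P.q * (P.q ^ k) ^ 2) • L.split (k + 1) +
        P.splitMu k • L.split k + P.splitNu k • L.splitPred k := by
  induction k with
  | zero =>
    refine ⟨by simp [split, splitPred, L.ket_eig], ?_⟩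
    have h := L.As_ket_zero
    have e : P.splitMu 0 = P.lzero + P.q * P.tb * P.node 0 := by simp [Params.splitMu]
    rw [show L.split 0 = L.ket 0 from rfl, h, e,
      show L.split (0 + 1) = L.S (L.ket 0) - P.node 0 • L.ket 0 from rfl, splitPred, pow_zero]
    module
  | succ k ih =>
    obtain ⟨hA, hAs⟩ := ih
    have hS : L.S (L.split k) = L.split (k + 1) + P.node k • L.split k := by
      rw [split]; abel
    have hS1 : L.S (L.split (k + 1)) =
        L.split (k + 1 + 1) + P.node (k + 1) • L.split (k + 1) :=
      (sub_add_cancel _ _).symm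
    -- At `k = 0` the predecessor is the default `0` and the bare recursion for it is false; the
    -- coefficient `splitPhi 0 = 0` repairs this.
    have hw : P.splitPhi k • L.S (L.splitPred k) =
        P.splitPhi k • (L.split k + P.nodePred k • L.splitPred k) := by
      cases k with
      | zero => rw [P.splitPhi_zero, zero_smul, zero_smul]
      | succ k => rw [splitPred, P.nodePred_succ]; congr 1; rw [split]; abel
    have hw' : P.splitNu k • L.S (L.splitPred k) =
        P.splitNu k • (L.split k + P.nodePred k • L.splitPred k) := by
      rw [Params.splitNu, mul_smul, mul_smul, hw]
    constructor
    · rw [show L.split (k + 1) = L.S (L.split k) - P.node k • L.split k from rfl, map_sub,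
        map_smul, L.A_S_apply, hA, hAs, map_add, map_smul, map_smul, hw, hS, splitPred]
      linear_combination (norm := module) P.split_theta k • L.split (k + 1) +
        P.split_phi k • L.split k + P.split_phi_zero k • L.splitPred k
    · rw [show L.As (L.split (k + 1)) = L.As (L.S (L.split k) - P.node k • L.split k) from rfl,
        map_sub, map_smul, L.As_S_apply, hA, hAs, map_add, map_add, map_smul, map_smul, map_smul,
        hw', hS1, hS, splitPred]
      have e : P.q ^ 2 * (P.tb * P.q * (P.q ^ k) ^ 2) = P.tb * P.q * (P.q ^ (k + 1)) ^ 2 := by ring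
      linear_combination (norm := module) e • L.split (k + 1 + 1) +
        P.split_mu k • L.split (k + 1) +
        P.split_nu k • L.split k + P.split_nu_zero k • L.splitPred k

theorem split_eq_aeval (k : ℕ) :
    L.split k = aeval L.S (∏ i ∈ Finset.range k, (X - C (P.node i))) (L.ket 0) := by
  induction k with
  | zero => simp [split]
  | succ k ih =>
    rw [Finset.prod_range_succ, mul_comm, map_mul, Module.End.mul_apply, ← ih, split]
    simp

/-- `A` acts on `charS(S)|θ_0⟩` by `θ_{2s+1}`. If this is not an eigenvalue, the vector is zero, and
cyclicity gives `charS(S) = 0`. -/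
theorem aeval_charS_of_theta (h : ∀ M ≤ P.n, P.theta (P.n + 1) ≠ P.theta M) :
    aeval L.S P.charS = 0 := by
  apply L.aeval_S_eq_zero
  have h1 := (L.A_split_and_As_split (P.n + 1)).1
  rw [P.splitPhi_last, zero_smul, add_zero] at h1
  have h2 := L.eq_zero_of_eigen h1 h
  rw [split_eq_aeval, Finset.prod_range] at h2
  exact h2

/-- If `θ_{2s+1}` does lie in the spectrum, the eigenvalues are read in reverse order. This changes
neither `S` nor `charS`, and the two orders cannot both fail. -/
theorem aeval_charS : aeval L.S P.charS = 0 := by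
  by_cases h : ∀ M ≤ P.n, P.theta (P.n + 1) ≠ P.theta M
  · exact L.aeval_charS_of_theta h
  · push Not at h
    obtain ⟨M, hM, hMe⟩ := h
    have h1 := L.rev.aeval_charS_of_theta ?_
    · rw [L.rev_S] at h1
      exact h1
    · intro N hN hNe
      have hN : N ≤ P.n := hN
      have h0 := P.q_ne
      have hx : P.q ^ M ≠ 0 := pow_ne_zero _ h0
      have hy : P.q ^ N ≠ 0 := pow_ne_zero _ h0
      have hn := P.qn_ne
      have e1 : P.q ^ (P.n + 1) = P.qn * P.q := pow_succ _ _
      have e2 : P.rev.q ^ (P.rev.n + 1) = P.qn * P.q := pow_succ _ _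
      rw [P.theta_eq, P.theta_eq, e1] at hMe
      rw [P.rev.theta_eq, P.rev.theta_eq, e2] at hNe
      simp only [Params.rev] at hNe
      have hM1 : (P.qn * P.q) ^ 2 - (P.q ^ M) ^ 2 ≠ 0 := by
        rw [← e1, ← pow_mul, ← pow_mul]
        exact sub_ne_zero.2 (P.pow_ne_pow (by omega)).symm
      have hN1 : (P.qn * P.q) ^ 2 - (P.q ^ N) ^ 2 ≠ 0 := by
        rw [← e1, ← pow_mul, ← pow_mul]
        exact sub_ne_zero.2 (P.pow_ne_pow (by omega)).symm
      -- A coincidence `θ_{2s+1} = θ_M` fixes the ratio `c/b`, and one in the reversed sequence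
      -- fixes it again. Together they force `q^{4+2M+2N} = 1`.
      have h3 : P.tb * ((P.qn * P.q) ^ 2 * (P.q ^ M) ^ 2) = P.tc := by
        apply mul_left_cancel₀ hM1
        field_simp at hMe
        linear_combination hMe
      have h4 : P.tc * (P.q ^ 2 * (P.q ^ N) ^ 2) = P.tb * P.qn ^ 2 := by
        apply mul_left_cancel₀ hN1
        field_simp at hNe
        linear_combination hNe
      have h5 : P.q ^ (4 + 2 * M + 2 * N) = 1 := by
        apply mul_left_cancel₀ (mul_ne_zero P.tb_ne (pow_ne_zero 2 hn))
        rw [← h3] at h4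
        linear_combination h4
      exact P.pow_ne_one (by omega) h5

end LeonardPair

/-! ### Divided differences, and polynomials vanishing at prescribed points. -/

/-- The divided difference at `a, b` of the monic polynomial with roots `t`. -/
def divDiff (a b : ℂ) : {M : ℕ} → (Fin M → ℂ) → ℂ
  | 0, _ => 0
  | _ + 1, t => (a - t 0) * divDiff a b (Fin.tail t) + (rootPoly (Fin.tail t)).eval b

theorem eval_rootPoly_succ {M : ℕ} (t : Fin (M + 1) → ℂ) (a : ℂ) :
    (rootPoly t).eval a = (a - t 0) * (rootPoly (Fin.tail t)).eval a := by
  rw [rootPoly_succ]; simp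

theorem eval_rootPoly {M : ℕ} (t : Fin M → ℂ) (a : ℂ) :
    (rootPoly t).eval a = ∏ i, (a - t i) := by
  rw [rootPoly, eval_prod]; simp

theorem sub_mul_divDiff (a b : ℂ) {M : ℕ} (t : Fin M → ℂ) :
    (a - b) * divDiff a b t = (rootPoly t).eval a - (rootPoly t).eval b := by
  induction M with
  | zero => simp [divDiff, rootPoly]
  | succ M ih =>
    rw [divDiff, eval_rootPoly_succ, eval_rootPoly_succ]
    linear_combination (a - t 0) * ih (Fin.tail t)

/-- The polynomial vanishes at `t i`, so the divided difference just removes that factor. Such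
products are the numerators of `∏ f` and `∏ h` in the Bethe equations. -/
theorem divDiff_root (a : ℂ) {M : ℕ} (t : Fin M → ℂ) (i : Fin M) :
    divDiff a (t i) t = ∏ j ∈ Finset.univ.erase i, (a - t j) := by
  induction M with
  | zero => exact i.elim0
  | succ M ih =>
    rw [divDiff]
    refine Fin.cases ?_ (fun i => ?_) i
    · have h := sub_mul_divDiff a (t 0) (Fin.tail t)
      have e : (Finset.univ.erase (0 : Fin (M + 1))) = Finset.univ.map (Fin.succEmb M) := by
        ext j; refine Fin.cases ?_ (fun j => ?_) j <;> simp [Fin.succ_ne_zero]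
      rw [h, sub_add_cancel, eval_rootPoly, e, Finset.prod_map]
      rfl
    · have e : (Finset.univ.erase (Fin.succ i)) =
          insert 0 ((Finset.univ.erase i).map (Fin.succEmb M)) := by
        ext j
        refine Fin.cases ?_ (fun j => ?_) j
        · simp [(Fin.succ_ne_zero i).symm]
        · simp [Fin.succ_ne_zero]
      have h0 : (rootPoly (Fin.tail t)).eval (t (Fin.succ i)) = 0 := by
        rw [eval_rootPoly]
        exact Finset.prod_eq_zero (Finset.mem_univ i) (sub_self _)
      rw [h0, add_zero, e, Finset.prod_insert (by simp [Fin.succ_ne_zero]), Finset.prod_map]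
      congr 1
      exact ih (Fin.tail t) i

theorem natDegree_lt_of_coeff_eq_zero {p : ℂ[X]} {n : ℕ} (hp : p.natDegree ≤ n)
    (h : p.coeff n = 0) (hn : 0 < n) : p.natDegree < n := by
  refine lt_of_le_of_ne hp fun e => ?_
  rw [← e] at h hn
  rw [coeff_natDegree, leadingCoeff_eq_zero] at h
  simp [h] at hn

/-- This turns Bethe equations, which are conditions at the roots, into an eigenvalue equation.
Distinctness of the symmetrized roots is needed here. -/
theorem eq_C_mul_rootPoly {M : ℕ} {t : Fin M → ℂ} (ht : Function.Injective t) {F : ℂ[X]}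
    (hF : F.natDegree ≤ M) (h0 : ∀ i, F.eval (t i) = 0) : F = C (F.coeff M) * rootPoly t := by
  rcases Nat.eq_zero_or_pos M with rfl | hM
  · rw [rootPoly, Finset.univ_eq_empty, Finset.prod_empty, mul_one]
    exact eq_C_of_natDegree_le_zero hF
  · rw [← sub_eq_zero]
    refine eq_zero_of_natDegree_lt_card_of_eval_eq_zero _ ht (fun i => ?_) ?_
    · have h1 : (rootPoly t).eval (t i) = 0 := by
        rw [eval_rootPoly]
        exact Finset.prod_eq_zero (Finset.mem_univ i) (sub_self _)
      simp [h0, h1]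
    · rw [Fintype.card_fin]
      have h1 : (F - C (F.coeff M) * rootPoly t).coeff M = 0 := by
        have h2 := (rootPoly_monic t).coeff_natDegree
        rw [rootPoly_natDegree] at h2
        rw [coeff_sub, coeff_C_mul, h2, mul_one, sub_self]
      have h2 : (F - C (F.coeff M) * rootPoly t).natDegree ≤ M :=
        (natDegree_sub_le_of_le hF
          ((natDegree_C_mul_le _ _).trans (rootPoly_natDegree t).le)).trans (max_self M).le
      exact natDegree_lt_of_coeff_eq_zero h2 h1 hM

/-! ### Action of `A` and `A*` on polynomials in `S`. -/

namespace LeonardPair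

variable {P : Params} {V : Type*} [AddCommGroup V] [Module ℂ V] (L : LeonardPair P V)

/-- The action of `A` and `A*` on `p(S)|θ_0⟩` for `p` the monic polynomial with roots `t`. -/
theorem exists_action {M : ℕ} (t : Fin M → ℂ) : ∃ α β : ℂ[X],
    L.A (L.vec t) = aeval L.S α (L.ket 0) ∧ L.As (L.vec t) = aeval L.S β (L.ket 0) ∧
    α.natDegree ≤ M ∧ β.natDegree ≤ M + 1 ∧
    β.coeff (M + 1) = (P.q ^ M) ^ 2 * (P.q * P.tb) ∧
    β.coeff M = (P.q ^ M) ^ 2 * (P.lzero - P.q⁻¹ * P.tb * ∑ i, t i) ∧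
    ∀ v s sp sm Rp Rm : ℂ, v ≠ 0 → s = P.q * v + (P.q * v)⁻¹ →
      sp = P.q ^ 3 * v + (P.q ^ 3 * v)⁻¹ → sm = v / P.q + P.q / v →
      Rp + Rm = (P.q⁻¹ ^ 2 - 1) * s * (P.tb + P.tc) +
        P.q⁻¹ * (P.qq * (P.q * P.tb * s + P.lzero) + P.com) →
      P.q ^ 2 * v * Rp + v⁻¹ * Rm = (P.q ^ 2 - 1) * s * (P.q * P.tb * s + P.lzero) -
        P.q * (P.qq * (P.tb + P.tc) + P.comStar) →
      α.eval s = (P.tb + P.tc) * (rootPoly t).eval s + Rp * divDiff sp s t + Rm * divDiff sm s t ∧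
      β.eval s = (P.q * P.tb * s + P.lzero) * (rootPoly t).eval s +
        P.q ^ 2 * v * Rp * divDiff sp s t + v⁻¹ * Rm * divDiff sm s t := by
  -- Here `s, sp, sm` play the roles of `symRoot u`, `symRoot (q u)`, `symRoot (q⁻¹ u)` with `v =
  -- u²`. The two linear conditions on `Rp` and `Rm` are what the recursion requires of the terms
  -- proportional to `p(s)`.
  have h0 := P.q_ne
  induction M with
  | zero =>
    refine ⟨C (P.tb + P.tc), C (P.q * P.tb) * X + C P.lzero, ?_, ?_, by simp, ?_, by simp, by simp,
      ?_⟩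
    · have hθ : P.theta 0 = P.tb + P.tc := by
        rw [P.theta_eq]; simp
      simp [vec, rootPoly, L.ket_eig, hθ, add_smul]
    · simp only [vec, rootPoly, Finset.univ_eq_empty, Finset.prod_empty, map_one,
        Module.End.one_apply, L.As_ket_zero, map_add, map_mul, aeval_C, aeval_X,
        LinearMap.add_apply, Module.End.mul_apply, Module.algebraMap_end_apply, mul_smul]
    · exact natDegree_linear_le
    · intro v s sp sm Rp Rm _ _ _ _ _ _
      simp [rootPoly, divDiff]
  | succ M ih =>
    obtain ⟨α, β, hA, hAs, hα, hβ, hc1, hc2, hev⟩ := ih (Fin.tail t)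
    set p := rootPoly (Fin.tail t) with hp
    have hpd : p.natDegree = M := rootPoly_natDegree _
    have hα0 : α.coeff (M + 1) = 0 := coeff_eq_zero_of_natDegree_lt (by omega)
    have hp0 : p.coeff (M + 1) = 0 := coeff_eq_zero_of_natDegree_lt (by omega)
    have hα1 : α.coeff (M + 2) = 0 := coeff_eq_zero_of_natDegree_lt (by omega)
    have hp1 : p.coeff (M + 2) = 0 := coeff_eq_zero_of_natDegree_lt (by omega)
    have hβ1 : β.coeff (M + 2) = 0 := coeff_eq_zero_of_natDegree_lt (by omega)
    -- The witnesses are `A_S_apply` and `As_S_apply` read as a recursion on polynomials when a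
    -- factor `X - t 0` is added.
    refine ⟨C (P.q⁻¹ ^ 2) * (X * α) + C P.q⁻¹ * (C P.qq * β + C P.com * p) - C (t 0) * α,
      C (P.q ^ 2) * (X * β) - C P.q * (C P.qq * α + C P.comStar * p) - C (t 0) * β,
      ?_, ?_, ?_, ?_, ?_, ?_, ?_⟩
    · rw [vec_succ, map_sub, map_smul, L.A_S_apply, hA, hAs]
      simp only [vec, ← hp, map_sub, map_add, map_mul, aeval_C, aeval_X, LinearMap.add_apply,
        LinearMap.sub_apply, Module.End.mul_apply, Module.algebraMap_end_apply, smul_add]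
    · rw [vec_succ, map_sub, map_smul, L.As_S_apply, hA, hAs]
      simp only [vec, ← hp, map_sub, map_add, map_mul, aeval_C, aeval_X, LinearMap.add_apply,
        LinearMap.sub_apply, Module.End.mul_apply, Module.algebraMap_end_apply, smul_add]
    · refine natDegree_le_iff_coeff_eq_zero.2 fun N hN => ?_
      obtain ⟨K, rfl⟩ : ∃ K, N = K + 1 := ⟨N - 1, by omega⟩
      simp only [coeff_sub, coeff_C_mul, coeff_add, coeff_X_mul]
      rw [coeff_eq_zero_of_natDegree_lt (show α.natDegree < K by omega),
        coeff_eq_zero_of_natDegree_lt (show α.natDegree < K + 1 by omega),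
        coeff_eq_zero_of_natDegree_lt (show p.natDegree < K + 1 by omega),
        coeff_eq_zero_of_natDegree_lt (show β.natDegree < K + 1 by omega)]
      simp
    · refine natDegree_le_iff_coeff_eq_zero.2 fun N hN => ?_
      obtain ⟨K, rfl⟩ : ∃ K, N = K + 1 := ⟨N - 1, by omega⟩
      simp only [coeff_sub, coeff_C_mul, coeff_add, coeff_X_mul]
      rw [coeff_eq_zero_of_natDegree_lt (show β.natDegree < K by omega),
        coeff_eq_zero_of_natDegree_lt (show α.natDegree < K + 1 by omega),
        coeff_eq_zero_of_natDegree_lt (show p.natDegree < K + 1 by omega),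
        coeff_eq_zero_of_natDegree_lt (show β.natDegree < K + 1 by omega)]
      simp
    · rw [coeff_sub, coeff_sub, coeff_C_mul, coeff_C_mul, coeff_C_mul, coeff_add, coeff_C_mul,
        coeff_C_mul, coeff_X_mul, hc1, hα1, hp1, hβ1, pow_succ P.q M]
      ring
    · rw [coeff_sub, coeff_sub, coeff_C_mul, coeff_C_mul, coeff_C_mul, coeff_add, coeff_C_mul,
        coeff_C_mul, coeff_X_mul, hc1, hc2, hα0, hp0, Fin.sum_univ_succ, pow_succ P.q M]
      have e : ∑ i, Fin.tail t i = ∑ i : Fin M, t i.succ := rfl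
      rw [e]
      field_simp
      ring
    · intro v s sp sm Rp Rm hv hs hsp hsm h1 h2
      obtain ⟨ha, hb⟩ := hev v s sp sm Rp Rm hv hs hsp hsm h1 h2
      -- Apart from inhomogeneous terms and the shift by `t 0`, the recursion multiplies `(α(s),
      -- β(s))` by a 2×2 matrix. These four identities say that `(1, q²v)` and `(1, v⁻¹)` are its
      -- eigenvectors, with eigenvalues `sp` and `sm`.
      have i1 : sp = P.q⁻¹ ^ 2 * s + P.q⁻¹ * P.qq * (P.q ^ 2 * v) := by
        rw [hsp, hs, Params.qq]; field_simp; ring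
      have i2 : sm = P.q⁻¹ ^ 2 * s + P.q⁻¹ * P.qq * v⁻¹ := by
        rw [hsm, hs, Params.qq]; field_simp; ring
      have i3 : P.q ^ 2 * v * sp = P.q ^ 2 * s * (P.q ^ 2 * v) - P.q * P.qq := by
        rw [hsp, hs, Params.qq]; field_simp; ring
      have i4 : v⁻¹ * sm = P.q ^ 2 * s * v⁻¹ - P.q * P.qq := by
        rw [hsm, hs, Params.qq]; field_simp; ring
      simp only [eval_sub, eval_add, eval_mul, eval_C, eval_X, ha, hb, divDiff,
        eval_rootPoly_succ, ← hp]
      constructor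
      · linear_combination (-(p.eval s)) * h1 - Rp * divDiff sp s (Fin.tail t) * i1 -
          Rm * divDiff sm s (Fin.tail t) * i2
      · linear_combination (-(p.eval s)) * h2 - Rp * divDiff sp s (Fin.tail t) * i3 -
          Rm * divDiff sm s (Fin.tail t) * i4

end LeonardPair

/-! ### The Bethe functions in terms of symmetrized roots. -/

namespace Params

variable (P : Params)

/-- `symRoot (q u)`. -/
def symRootUp (u : ℂ) : ℂ := P.q ^ 3 * u ^ 2 + (P.q ^ 3 * u ^ 2)⁻¹

/-- `symRoot (q⁻¹ u)`. -/
def symRootDown (u : ℂ) : ℂ := u ^ 2 / P.q + P.q / u ^ 2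

theorem f_eq {u v : ℂ} (hu : u ≠ 0) (hv : v ≠ 0) :
    P.f u v = (P.symRootDown u - P.symRoot v) / (P.symRoot u - P.symRoot v) := by
  have h0 := P.q_ne
  have e1 : b (P.q * v / u) * b (u * v) = -(P.symRootDown u - P.symRoot v) := by
    simp only [b, symRootDown, symRoot]; field_simp; ring
  have e2 : b (v / u) * b (P.q * u * v) = -(P.symRoot u - P.symRoot v) := by
    simp only [b, symRoot]; field_simp; ring
  rw [f, e1, e2, neg_div_neg_eq]

theorem h_eq {u v : ℂ} (hu : u ≠ 0) (hv : v ≠ 0) :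
    P.h u v = (P.symRootUp u - P.symRoot v) / (P.symRoot u - P.symRoot v) := by
  have h0 := P.q_ne
  have e1 : b (P.q ^ 2 * u * v) * b (P.q * u / v) = P.symRootUp u - P.symRoot v := by
    simp only [b, symRootUp, symRoot]; field_simp; ring
  have e2 : b (P.q * u * v) * b (u / v) = P.symRoot u - P.symRoot v := by
    simp only [b, symRoot]; field_simp; ring
  rw [h, e1, e2]

theorem qHalf_mul {k : ℕ} (hk : k ≤ P.n) : P.qHalf (P.n - k) * P.qHalf k = P.q := by
  have h0 : P.q ^ (1 / 2 : ℂ) ≠ 0 := by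
    rw [Complex.cpow_def_of_ne_zero P.q_ne]; exact Complex.exp_ne_zero _
  rw [qHalf, qHalf, ← zpow_add₀ h0]
  have e : (1 + 2 * ((P.n - k : ℕ) : ℤ) - (P.n : ℤ)) + (1 + 2 * (k : ℤ) - (P.n : ℤ)) = (2 : ℕ) := by
    push_cast [Nat.cast_sub hk]; ring
  rw [e, zpow_natCast, ← Complex.cpow_nat_mul]
  norm_num

theorem qHalf_sq (k : ℕ) : P.qHalf k ^ 2 = P.q * (P.q ^ k) ^ 2 / P.qn := by
  have h0 : P.q ^ (1 / 2 : ℂ) ≠ 0 := by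
    rw [Complex.cpow_def_of_ne_zero P.q_ne]; exact Complex.exp_ne_zero _
  have h1 : (P.q ^ (1 / 2 : ℂ)) ^ 2 = P.q := by
    rw [← Complex.cpow_nat_mul]; norm_num
  have e : (P.q ^ (1 / 2 : ℂ)) ^ (1 + 2 * (k : ℤ) - (P.n : ℤ)) =
      (P.q ^ (1 / 2 : ℂ)) * P.q ^ k / (P.q ^ (1 / 2 : ℂ)) ^ P.n := by
    rw [zpow_sub₀ h0, zpow_add₀ h0, zpow_one, zpow_mul, zpow_natCast, zpow_natCast]
    norm_cast
    rw [h1]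
  rw [qHalf, e, div_pow, mul_pow, h1, ← pow_mul _ P.n 2, mul_comm P.n 2,
    pow_mul _ 2 P.n, h1, qn]

/-- The `ζ`-factor of index `2s - k` is paired with the `ζ⁻¹`-factor of index `k`. Each pair
involves only `qHalf k ^ 2`, so the choice of square root of `q` drops out. -/
theorem prod_b_eq {u : ℂ} (hu : u ≠ 0) : (∏ k ∈ Finset.range (P.n + 1),
    b (P.qHalf k * P.ζ * u) * b (P.qHalf k * P.ζ⁻¹ * u)) = P.charS.eval (P.symRoot u) := by
  rw [charS, eval_rootPoly, ← Finset.prod_range (fun k => P.symRoot u - P.node k),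
    Finset.prod_mul_distrib, ← Finset.prod_range_reflect (fun k => b (P.qHalf k * P.ζ * u)),
    ← Finset.prod_mul_distrib]
  refine Finset.prod_congr rfl fun k hk => ?_
  have hk' : k ≤ P.n := by rw [Finset.mem_range] at hk; omega
  have e : P.n + 1 - 1 - k = P.n - k := by omega
  have h1 := P.qHalf_mul hk'
  have h2 := P.qHalf_sq k
  have h0 := P.q_ne
  have h3 : P.qHalf k ≠ 0 := by rintro h; rw [h, mul_zero] at h1; exact h0 h1.symm
  have h4 : P.qHalf (P.n - k) = P.q / P.qHalf k := by rw [← h1, mul_div_cancel_right₀ _ h3]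
  have h5 := P.ζ_ne
  have h6 := P.qn_ne
  have h7 : P.q ^ k ≠ 0 := pow_ne_zero _ h0
  have e2 : b (P.q / P.qHalf k * P.ζ * u) * b (P.qHalf k * P.ζ⁻¹ * u) =
      P.symRoot u - (P.q * P.ζ ^ 2 / P.qHalf k ^ 2 + P.qHalf k ^ 2 / (P.q * P.ζ ^ 2)) := by
    simp only [b, symRoot]; field_simp; ring
  rw [e, h4, e2, h2, node]
  congr 1
  field_simp

theorem inhomTerm_eq {u : Fin P.n → ℂ} (hu : ∀ i, u i ≠ 0) (i : Fin P.n) :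
    P.inhomTerm u i = b (u i ^ 2) / b P.q * P.charS.eval (P.symRoot (u i)) /
      ∏ j ∈ Finset.univ.erase i, (P.symRoot (u i) - P.symRoot (u j)) := by
  have h0 := P.q_ne
  rw [inhomTerm, P.prod_b_eq (hu i)]
  congr 1
  refine Finset.prod_congr rfl fun j _ => ?_
  have h1 := hu i
  have h2 := hu j
  simp only [b, symRoot]; field_simp; ring

theorem Lam1_minus {u : ℂ} (hu : u ≠ 0) : P.Lam1 (-1) u =
    (P.qn * P.q * u ^ 2 + (P.qn * P.q * u ^ 2)⁻¹ - P.zz) *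
      (P.tcs * u ^ 2 / P.qn + P.tb * P.qn) * (P.tbs / P.tb * u ^ 2 + 1) / u := by
  have h0 := P.q_ne
  have h1 := P.qn_ne
  have h2 := P.ζ_ne
  have h3 := P.tb_ne
  have h4 := P.tcs_ne
  have e : P.tc / P.tcs = P.tbs / P.tb := by
    rw [div_eq_div_iff h4 h3, ← P.tb_mul_tc, mul_comm]
  have e2 : P.q ^ (-(P.n : ℤ) - 1) = (P.qn * P.q)⁻¹ := by
    rw [zpow_sub₀ h0, zpow_neg, zpow_n, zpow_one]; field_simp
  have e3 : P.q ^ ((P.n : ℤ) + 1) = P.qn * P.q := by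
    rw [zpow_add₀ h0, zpow_n, zpow_one]
  have e4 : P.q ^ (-(P.n : ℤ)) = P.qn⁻¹ := by rw [zpow_neg, zpow_n]
  rw [Lam1, e2, e3, e4, zpow_n, e, zz]
  norm_num
  field_simp
  ring

theorem Lam2_minus {u : ℂ} (hu : u ≠ 0) : P.Lam2 (-1) u =
    b (u ^ 2) / b (P.q * u ^ 2) * (P.q ^ 2)⁻¹ *
    (P.q * u ^ 2 / P.qn + P.qn / (P.q * u ^ 2) - P.zz) *
      (P.q ^ 2 * P.qn * P.tb * u ^ 2 + P.tcs / P.qn) * (P.q ^ 2 * u ^ 2 + P.tbs / P.tb) / u := by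
  have h0 := P.q_ne
  have h1 := P.qn_ne
  have h2 := P.ζ_ne
  have h3 := P.tb_ne
  have h4 := P.tcs_ne
  have e : P.tc / P.tcs = P.tbs / P.tb := by
    rw [div_eq_div_iff h4 h3, ← P.tb_mul_tc, mul_comm]
  have e2 : P.q ^ (-(P.n : ℤ) - 1) = (P.qn * P.q)⁻¹ := by
    rw [zpow_sub₀ h0, zpow_neg, zpow_n, zpow_one]; field_simp
  have e3 : P.q ^ ((P.n : ℤ) - 1) = P.qn / P.q := by
    rw [zpow_sub₀ h0, zpow_n, zpow_one]
  have e4 : P.q ^ (-(P.n : ℤ)) = P.qn⁻¹ := by rw [zpow_neg, zpow_n]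
  rw [Lam2, e2, e3, e4, zpow_n, e, zz]
  generalize b (P.q * u ^ 2) = d
  generalize b (u ^ 2) = d'
  norm_num
  have e5 : ∀ x y : ℂ, x / (u⁻¹ * y) = x / y * u := fun x y => by field_simp
  simp only [e5, div_eq_mul_inv]
  generalize d⁻¹ = d''
  field_simp
  ring

/-- The coefficient of the upward divided difference in the action of `A`. -/
def coefUp (u : ℂ) : ℂ := (P.q - P.q⁻¹) / (u * b (u ^ 2)) * P.Lam2 (-1) u

/-- The coefficient of the downward divided difference in the action of `A`. -/
def coefDown (u : ℂ) : ℂ :=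
  -((P.q - P.q⁻¹) / (u * b (u ^ 2))) * (b (u ^ 2) / b (P.q * u ^ 2) * P.Lam1 (-1) u)

/-- Together with `coef_add'`, this verifies the linear conditions of `exists_action` at `v = u²`;
it is where the explicit form of `Λ₁` and `Λ₂` enters. -/
theorem coef_add {u : ℂ} (hu : u ≠ 0) (h1 : b (u ^ 2) ≠ 0) (h2 : b (P.q * u ^ 2) ≠ 0) :
    P.coefUp u + P.coefDown u = (P.q⁻¹ ^ 2 - 1) * P.symRoot u * (P.tb + P.tc) +
      P.q⁻¹ * (P.qq * (P.q * P.tb * P.symRoot u + P.lzero) + P.com) := by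
  have h0 := P.q_ne
  have h3 := P.qn_ne
  have h4 := P.tb_ne
  apply mul_left_cancel₀ h2
  have e1 : b (P.q * u ^ 2) * P.coefUp u = (P.q - P.q⁻¹) / u ^ 2 * (P.q ^ 2)⁻¹ *
    (P.q * u ^ 2 / P.qn + P.qn / (P.q * u ^ 2) - P.zz) *
      (P.q ^ 2 * P.qn * P.tb * u ^ 2 + P.tcs / P.qn) * (P.q ^ 2 * u ^ 2 + P.tbs / P.tb) := by
    rw [coefUp, P.Lam2_minus hu]; generalize P.q - P.q⁻¹ = d at *; field_simp
  have e2 : b (P.q * u ^ 2) * P.coefDown u = -(P.q - P.q⁻¹) / u ^ 2 *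
    (P.qn * P.q * u ^ 2 + (P.qn * P.q * u ^ 2)⁻¹ - P.zz) *
      (P.tcs * u ^ 2 / P.qn + P.tb * P.qn) * (P.tbs / P.tb * u ^ 2 + 1) := by
    rw [coefDown, P.Lam1_minus hu]; generalize P.q - P.q⁻¹ = d at *; field_simp
  rw [mul_add, e1, e2]
  simp only [symRoot, lzero, com, edge_eq, edgeStar_eq, ww, qq, P.tc_eq, b]
  generalize P.zz = Z
  field_simp
  ring

theorem coef_add' {u : ℂ} (hu : u ≠ 0) (h1 : b (u ^ 2) ≠ 0) (h2 : b (P.q * u ^ 2) ≠ 0) :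
    P.q ^ 2 * u ^ 2 * P.coefUp u + (u ^ 2)⁻¹ * P.coefDown u =
      (P.q ^ 2 - 1) * P.symRoot u * (P.q * P.tb * P.symRoot u + P.lzero) -
        P.q * (P.qq * (P.tb + P.tc) + P.comStar) := by
  have h0 := P.q_ne
  have h3 := P.qn_ne
  have h4 := P.tb_ne
  apply mul_left_cancel₀ h2
  have e1 : b (P.q * u ^ 2) * P.coefUp u = (P.q - P.q⁻¹) / u ^ 2 * (P.q ^ 2)⁻¹ *
    (P.q * u ^ 2 / P.qn + P.qn / (P.q * u ^ 2) - P.zz) *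
      (P.q ^ 2 * P.qn * P.tb * u ^ 2 + P.tcs / P.qn) * (P.q ^ 2 * u ^ 2 + P.tbs / P.tb) := by
    rw [coefUp, P.Lam2_minus hu]; generalize P.q - P.q⁻¹ = d at *; field_simp
  have e2 : b (P.q * u ^ 2) * P.coefDown u = -(P.q - P.q⁻¹) / u ^ 2 *
    (P.qn * P.q * u ^ 2 + (P.qn * P.q * u ^ 2)⁻¹ - P.zz) *
      (P.tcs * u ^ 2 / P.qn + P.tb * P.qn) * (P.tbs / P.tb * u ^ 2 + 1) := by
    rw [coefDown, P.Lam1_minus hu]; generalize P.q - P.q⁻¹ = d at *; field_simp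
  rw [mul_add, mul_left_comm (b (P.q * u ^ 2)), e1, mul_left_comm (b (P.q * u ^ 2)), e2]
  simp only [symRoot, lzero, comStar, edge_eq, edgeStar_eq, ww, qq, P.tc_eq, b]
  generalize P.zz = Z
  field_simp
  ring

variable {P}

namespace Admissible

variable {M : ℕ} {u : Fin M → ℂ}

theorem ne_zero (h : P.Admissible u) (i : Fin M) : u i ≠ 0 := (h.1 i).1

theorem b_ne (h : P.Admissible u) (i : Fin M) : b (u i ^ 2) ≠ 0 := sub_ne_zero.2 (h.1 i).2.1

theorem b_q_ne (h : P.Admissible u) (i : Fin M) : b (P.q * u i ^ 2) ≠ 0 := (h.1 i).2.2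

theorem symRoot_injective (h : P.Admissible u) : Function.Injective fun i => P.symRoot (u i) := by
  intro i j hij
  by_contra hne
  exact h.2 i j hne (congrArg (· / (P.q + P.q⁻¹)) hij)

theorem prod_ne (h : P.Admissible u) (i : Fin M) :
    ∏ j ∈ Finset.univ.erase i, (P.symRoot (u i) - P.symRoot (u j)) ≠ 0 :=
  Finset.prod_ne_zero_iff.2 fun _ hj => sub_ne_zero.2 fun e =>
    (Finset.ne_of_mem_erase hj).symm (h.symRoot_injective e)

theorem prod_f (h : P.Admissible u) (i : Fin M) : ∏ j ∈ Finset.univ.erase i, P.f (u i) (u j) =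
    divDiff (P.symRootDown (u i)) (P.symRoot (u i)) (fun i => P.symRoot (u i)) /
      ∏ j ∈ Finset.univ.erase i, (P.symRoot (u i) - P.symRoot (u j)) := by
  rw [divDiff_root _ (fun i => P.symRoot (u i)), ← Finset.prod_div_distrib]
  exact Finset.prod_congr rfl fun _ _ => P.f_eq (h.ne_zero i) (h.ne_zero _)

theorem prod_h (h : P.Admissible u) (i : Fin M) : ∏ j ∈ Finset.univ.erase i, P.h (u i) (u j) =
    divDiff (P.symRootUp (u i)) (P.symRoot (u i)) (fun i => P.symRoot (u i)) /
      ∏ j ∈ Finset.univ.erase i, (P.symRoot (u i) - P.symRoot (u j)) := by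
  rw [divDiff_root _ (fun i => P.symRoot (u i)), ← Finset.prod_div_distrib]
  exact Finset.prod_congr rfl fun _ _ => P.h_eq (h.ne_zero i) (h.ne_zero _)

end Admissible

theorem IsHom.eq_zero {M : ℕ} {u : Fin M → ℂ} (h : P.IsHom (-1) u) (i : Fin M) :
    P.coefUp (u i) *
        divDiff (P.symRootUp (u i)) (P.symRoot (u i)) (fun i => P.symRoot (u i)) +
      P.coefDown (u i) *
        divDiff (P.symRootDown (u i)) (P.symRoot (u i)) (fun i => P.symRoot (u i)) = 0 := by
  have h1 := h.2 i
  rw [bethe, h.1.prod_f, h.1.prod_h] at h1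
  have h2 := h.1.prod_ne i
  rw [coefUp, coefDown]
  generalize divDiff _ _ _ = x at *
  generalize divDiff _ _ _ = y at *
  generalize ∏ j ∈ Finset.univ.erase i, (P.symRoot (u i) - P.symRoot (u j)) = z at *
  have h3 : -(b (u i ^ 2) / b (P.q * u i ^ 2)) * x * P.Lam1 (-1) (u i) +
      y * P.Lam2 (-1) (u i) = 0 := by
    apply mul_left_cancel₀ (inv_ne_zero h2)
    rw [mul_zero, ← h1]; ring
  linear_combination ((P.q - P.q⁻¹) / (u i * b (u i ^ 2))) * h3

/-- The Bethe equation rescaled by a factor involving `-(q - q⁻¹) / (u² b(u²))`. The left side is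
`β` at a root, and the right side is its top coefficient times `charS` there. -/
theorem IsInhomStar.eq_zero {N : ℕ} {u : Fin P.n → ℂ} (h : P.IsInhomStar N u) (i : Fin P.n) :
    P.q ^ 2 * u i ^ 2 * P.coefUp (u i) *
        divDiff (P.symRootUp (u i)) (P.symRoot (u i)) (fun i => P.symRoot (u i)) +
      (u i ^ 2)⁻¹ * P.coefDown (u i) *
        divDiff (P.symRootDown (u i)) (P.symRoot (u i)) (fun i => P.symRoot (u i)) =
      P.qn ^ 2 * (P.q * P.tb) * P.charS.eval (P.symRoot (u i)) := by
  have h1 := h.2.1 i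
  rw [betheInhomMinus, betheInhomAux, h.1.prod_f, h.1.prod_h, P.inhomTerm_eq h.1.ne_zero] at h1
  have h2 := h.1.prod_ne i
  have hu := h.1.ne_zero i
  have hb := h.1.b_ne i
  have hq := P.q_sub_ne
  have h0 := P.q_ne
  have e : P.q ^ (1 + 2 * (P.n : ℤ)) = P.q * P.qn ^ 2 := by
    rw [zpow_add₀ h0, zpow_one, mul_comm 2, zpow_mul, zpow_n]; norm_cast
  rw [e] at h1
  rw [coefUp, coefDown]
  generalize divDiff _ _ _ = x at *
  generalize divDiff _ _ _ = y at *
  generalize ∏ j ∈ Finset.univ.erase i, (P.symRoot (u i) - P.symRoot (u j)) = z at *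
  generalize P.charS.eval (P.symRoot (u i)) = g at *
  have e1 : (P.q ^ 2 * u i ^ 3) ^ (-(-1) : ℤ) = P.q ^ 2 * u i ^ 3 := by norm_num
  have e2 : u i ^ (-(2 * (-1)) : ℤ) = u i ^ 2 := by norm_cast
  have e3 : b P.q = P.q - P.q⁻¹ := rfl
  rw [e1, e2, e3, zpow_neg_one] at h1
  generalize P.Lam1 (-1) (u i) = l1 at *
  generalize P.Lam2 (-1) (u i) = l2 at *
  generalize b (P.q * u i ^ 2) = d at *
  generalize b (u i ^ 2) = d' at *
  generalize P.q - P.q⁻¹ = d'' at *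
  have h3 : d' / d * (u i)⁻¹ * x * l1 - P.q ^ 2 * u i ^ 3 * y * l2 +
      P.q * P.qn ^ 2 * P.tb * u i ^ 2 * (d' / d'' * g) = 0 := by
    apply mul_left_cancel₀ (inv_ne_zero h2)
    rw [mul_zero, ← h1]; ring
  have h4 : d'' / (u i ^ 2 * d') * (P.q * P.qn ^ 2 * P.tb * u i ^ 2 * (d' / d'' * g)) =
      P.q * P.qn ^ 2 * P.tb * g := by field_simp
  have h5 : d'' / (u i ^ 2 * d') * (P.q ^ 2 * u i ^ 3 * y * l2) =
      P.q ^ 2 * u i ^ 2 * (d'' / (u i * d') * l2) * y := by field_simp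
  have h6 : d'' / (u i ^ 2 * d') * (d' / d * (u i)⁻¹ * x * l1) =
      -((u i ^ 2)⁻¹ * (-(d'' / (u i * d')) * (d' / d * l1)) * x) := by
    simp only [div_eq_mul_inv]
    generalize d⁻¹ = k
    field_simp
  linear_combination (-(d'' / (u i ^ 2 * d'))) * h3 + h4 - h5 + h6

/-- The right side is the coefficient of degree `2s` of `β` reduced modulo `charS`. The nodes form
two geometric progressions, and their sum produces `Z [2s]_q` in the condition on `σ`. -/
theorem IsInhomStar.thetaStar_eq {N : ℕ} {u : Fin P.n → ℂ} (h : P.IsInhomStar N u) :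
    P.thetaStar N = P.qn ^ 2 * (P.lzero - P.q⁻¹ * P.tb * ∑ i, P.symRoot (u i)) -
      P.qn ^ 2 * (P.q * P.tb) * P.charS.coeff P.n := by
  have h0 := P.q_ne
  have hn := P.qn_ne
  have hq := P.q_sub_ne
  have hz := P.ζ_ne
  have e : P.q ^ (2 * (P.n : ℤ)) = P.qn ^ 2 := by
    rw [mul_comm, zpow_mul, zpow_n]; norm_cast
  have h1 : ∀ m : ℕ, (P.q - P.q⁻¹) * ∑ k ∈ Finset.range m, P.node k =
      P.qn * P.ζ ^ 2 * P.q * (1 - ((P.q ^ m) ^ 2)⁻¹) +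
        P.q⁻¹ * ((P.q ^ m) ^ 2 - 1) / (P.qn * P.ζ ^ 2) := by
    intro m
    induction m with
    | zero => simp
    | succ m ih =>
      have hx : P.q ^ m ≠ 0 := pow_ne_zero _ h0
      rw [Finset.sum_range_succ, mul_add, ih, node, pow_succ P.q m]
      field_simp
      ring
  have h2 : P.charS.coeff P.n = -∑ k ∈ Finset.range (P.n + 1), P.node k := by
    have h3 := prod_X_sub_C_coeff_card_pred (Finset.univ : Finset (Fin (P.n + 1)))
      (fun k => P.node k) (by simp)
    rw [Finset.card_univ, Fintype.card_fin, Nat.add_sub_cancel] at h3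
    rw [charS, rootPoly, h3, Finset.sum_range]
  have h4 : P.q ^ (P.n + 1) = P.qn * P.q := pow_succ _ _
  have h5 := h1 (P.n + 1)
  rw [h4] at h5
  rw [h.2.2, e, h2, lzero, zpow_neg, zpow_n, qInt, zpow_n, zpow_neg, zpow_n, zz]
  apply mul_left_cancel₀ hq
  have h6 : (P.q - P.q⁻¹) * ((P.qn - P.qn⁻¹) / (P.q - P.q⁻¹)) = P.qn - P.qn⁻¹ :=
    mul_div_cancel₀ _ hq
  have h7 : P.tb * (P.ζ ^ 2 + (P.ζ ^ 2)⁻¹) * (P.qn - P.qn⁻¹) =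
      P.q * P.tb * (P.qn * P.ζ ^ 2 * P.q * (1 - ((P.qn * P.q) ^ 2)⁻¹) +
        P.q⁻¹ * ((P.qn * P.q) ^ 2 - 1) / (P.qn * P.ζ ^ 2)) -
      (P.q - P.q⁻¹) * (P.tb * (P.ζ ^ 2 + (P.ζ ^ 2)⁻¹) * (P.qn * P.q)) := by
    field_simp
    ring
  linear_combination P.qn ^ 2 * P.tb * (P.ζ ^ 2 + (P.ζ ^ 2)⁻¹) * h6 +
    P.qn ^ 2 * h7 - P.qn ^ 2 * P.q * P.tb * h5

end Params

/-! ### Bethe equations imply eigenvectors. -/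

namespace LeonardPair

variable {P : Params} {V : Type*} [AddCommGroup V] [Module ℂ V] (L : LeonardPair P V)

theorem nstate_eq_ket {M : ℕ} (hM : M ≤ P.n) {u : Fin M → ℂ} (hu : P.IsHom (-1) u) :
    L.nstate hM (fun i => P.symRoot (u i)) = L.ket ⟨M, Nat.lt_succ_iff.2 hM⟩ := by
  obtain ⟨α, β, hA, -, hα, -, -, -, hev⟩ := L.exists_action fun i => P.symRoot (u i)
  have h0 : ∀ i, α.eval (P.symRoot (u i)) = 0 := fun i => by
    have h1 := hu.1.ne_zero i
    have h2 := (hev (u i ^ 2) (P.symRoot (u i)) (P.symRootUp (u i)) (P.symRootDown (u i))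
      (P.coefUp (u i)) (P.coefDown (u i)) (pow_ne_zero 2 h1) rfl rfl rfl
      (P.coef_add h1 (hu.1.b_ne i) (hu.1.b_q_ne i))
      (P.coef_add' h1 (hu.1.b_ne i) (hu.1.b_q_ne i))).1
    have h3 : (rootPoly fun i => P.symRoot (u i)).eval (P.symRoot (u i)) = 0 := by
      rw [eval_rootPoly]
      exact Finset.prod_eq_zero (Finset.mem_univ i) (sub_self _)
    rw [h2, h3, mul_zero, zero_add]
    exact hu.eq_zero i
  have h1 : L.A (L.vec fun i => P.symRoot (u i)) = α.coeff M • L.vec fun i => P.symRoot (u i) := by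
    rw [hA]
    conv_lhs => rw [eq_C_mul_rootPoly hu.1.symRoot_injective hα h0]
    rw [map_mul, aeval_C]
    rfl
  have h2 : L.A (L.nstate hM fun i => P.symRoot (u i)) =
      α.coeff M • L.nstate hM fun i => P.symRoot (u i) := by
    rw [nstate, map_smul, h1, smul_comm]
  have h3 := L.repr_nstate hM fun i => P.symRoot (u i)
  have h4 := L.eq_smul_ket_of_eigen h2 (i := ⟨M, Nat.lt_succ_iff.2 hM⟩) (by rw [h3]; exact one_ne_zero)
  rw [h3, one_smul] at h4
  exact h4

theorem smul_nstate_eq_ketS {N : ℕ} (hN : N ≤ P.n) {u : Fin P.n → ℂ} (hu : P.IsInhomStar N u) :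
    L.ket.repr (L.ketS ⟨N, Nat.lt_succ_iff.2 hN⟩) (Fin.last P.n) •
      L.nstate le_rfl (fun i => P.symRoot (u i)) = L.ketS ⟨N, Nat.lt_succ_iff.2 hN⟩ := by
  obtain ⟨α, β, -, hAs, -, hβ, hc1, hc2, hev⟩ := L.exists_action fun i => P.symRoot (u i)
  have hn : P.q ^ P.n = P.qn := rfl
  rw [hn] at hc1 hc2
  have hG := L.aeval_charS
  have hGd : P.charS.natDegree = P.n + 1 := rootPoly_natDegree _
  have hGc : P.charS.coeff (P.n + 1) = 1 := by
    have := (rootPoly_monic fun k : Fin (P.n + 1) => P.node k).coeff_natDegree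
    rwa [rootPoly_natDegree] at this
  -- Since `charS(S) = 0`, the polynomials `F` and `β` act alike; the multiple of `charS` is chosen
  -- to cancel degree `2s + 1`.
  set F : ℂ[X] := β - C (P.qn ^ 2 * (P.q * P.tb)) * P.charS with hF
  have hFd : F.natDegree ≤ P.n := by
    refine Nat.lt_succ_iff.1 (natDegree_lt_of_coeff_eq_zero ?_ ?_ (Nat.succ_pos _))
    · exact (natDegree_sub_le_of_le hβ ((natDegree_C_mul_le _ _).trans hGd.le)).trans
        (max_self _).le
    · rw [coeff_sub, coeff_C_mul, hGc, hc1]; ring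
  have hFc : F.coeff P.n = P.thetaStar N := by
    rw [coeff_sub, coeff_C_mul, hc2, hu.thetaStar_eq]
  have h0 : ∀ i, F.eval (P.symRoot (u i)) = 0 := fun i => by
    have h1 := hu.1.ne_zero i
    have h2 := (hev (u i ^ 2) (P.symRoot (u i)) (P.symRootUp (u i)) (P.symRootDown (u i))
      (P.coefUp (u i)) (P.coefDown (u i)) (pow_ne_zero 2 h1) rfl rfl rfl
      (P.coef_add h1 (hu.1.b_ne i) (hu.1.b_q_ne i))
      (P.coef_add' h1 (hu.1.b_ne i) (hu.1.b_q_ne i))).2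
    have h3 : (rootPoly fun i => P.symRoot (u i)).eval (P.symRoot (u i)) = 0 := by
      rw [eval_rootPoly]
      exact Finset.prod_eq_zero (Finset.mem_univ i) (sub_self _)
    rw [eval_sub, eval_mul, eval_C, h2, h3, mul_zero, zero_add, hu.eq_zero i, sub_self]
  have h1 : L.As (L.vec fun i => P.symRoot (u i)) =
      P.thetaStar N • L.vec fun i => P.symRoot (u i) := by
    have h2 : β = F + C (P.qn ^ 2 * (P.q * P.tb)) * P.charS := by rw [hF]; ring
    rw [hAs, h2, map_add, map_mul, hG, mul_zero, add_zero,
      eq_C_mul_rootPoly hu.1.symRoot_injective hFd h0, hFc, map_mul, aeval_C]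
    rfl
  have h2 : L.As (L.nstate le_rfl fun i => P.symRoot (u i)) =
      P.thetaStar N • L.nstate le_rfl fun i => P.symRoot (u i) := by
    rw [nstate, map_smul, h1, smul_comm]
  have h3 := L.repr_nstate le_rfl fun i => P.symRoot (u i)
  set x := L.nstate le_rfl fun i => P.symRoot (u i) with hx
  have h4 : x = L.ketS.repr x ⟨N, Nat.lt_succ_iff.2 hN⟩ • L.ketS ⟨N, Nat.lt_succ_iff.2 hN⟩ :=
    L.swap.eq_smul_ket (i := ⟨N, Nat.lt_succ_of_le hN⟩) (by rw [P.swap_theta]; exact h2)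
  -- The coordinate of `x` on the last eigenvector is 1, so the factor relating `x` to `|θ*_N⟩` is
  -- the inverse of the one in the statement.
  have h5 := congrArg (fun y => L.ket.repr y (Fin.last P.n)) h4
  simp only [map_smul, Finsupp.smul_apply, smul_eq_mul] at h5
  have h6 : L.ket.repr x (Fin.last P.n) = 1 := h3
  rw [h6] at h5
  rw [h4, smul_smul, mul_comm, ← h5, one_smul]

end LeonardPair

/-! ### Transport of the Bethe equations along the symmetries. -/

namespace Params

variable (P : Params)

theorem inv_f {u v : ℂ} : P.swap.f u⁻¹ v⁻¹ = P.f u v := by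
  have e1 : P.q⁻¹ * v⁻¹ / u⁻¹ = (P.q * v / u)⁻¹ := by simp [div_eq_mul_inv, mul_comm]
  have e2 : u⁻¹ * v⁻¹ = (u * v)⁻¹ := (mul_inv u v).symm
  have e3 : v⁻¹ / u⁻¹ = (v / u)⁻¹ := by simp only [div_eq_mul_inv, mul_inv]
  have e4 : P.q⁻¹ * u⁻¹ * v⁻¹ = (P.q * u * v)⁻¹ := by simp only [mul_inv]
  simp only [f, swap]
  rw [e1, e2, e3, e4]
  simp only [b_inv, neg_mul_neg]

theorem inv_h {u v : ℂ} : P.swap.h u⁻¹ v⁻¹ = P.h u v := by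
  have e1 : P.q⁻¹ ^ 2 * u⁻¹ * v⁻¹ = (P.q ^ 2 * u * v)⁻¹ := by simp only [mul_inv, inv_pow]
  have e2 : P.q⁻¹ * u⁻¹ / v⁻¹ = (P.q * u / v)⁻¹ := by simp only [div_eq_mul_inv, mul_inv]
  have e3 : u⁻¹ / v⁻¹ = (u / v)⁻¹ := by simp only [div_eq_mul_inv, mul_inv]
  have e4 : P.q⁻¹ * u⁻¹ * v⁻¹ = (P.q * u * v)⁻¹ := by simp only [mul_inv]
  simp only [h, swap]
  rw [e1, e2, e3, e4]
  simp only [b_inv, neg_mul_neg]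

theorem b_inv_sq (u : ℂ) : b (u⁻¹ ^ 2) = -b (u ^ 2) := by rw [inv_pow, b_inv]

theorem b_inv_q_sq (u : ℂ) : b (P.q⁻¹ * u⁻¹ ^ 2) = -b (P.q * u ^ 2) := by
  rw [inv_pow, ← mul_inv, b_inv]

variable {P} in
theorem Admissible.swap {M : ℕ} {u : Fin M → ℂ} (h : P.Admissible u) :
    P.swap.Admissible fun i => (u i)⁻¹ := by
  refine ⟨fun i => ⟨inv_ne_zero (h.ne_zero i), ?_, ?_⟩, fun i j hij => ?_⟩
  · refine sub_ne_zero.1 (show b ((u i)⁻¹ ^ 2) ≠ 0 from ?_)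
    rw [b_inv_sq]; exact neg_ne_zero.2 (h.b_ne i)
  · simp only [Params.swap]
    rw [b_inv_q_sq]; exact neg_ne_zero.2 (h.b_q_ne i)
  · rw [P.swap_symRoot, P.swap_symRoot]
    have e : P.swap.q + P.swap.q⁻¹ = P.q + P.q⁻¹ := by simp [Params.swap, add_comm]
    rw [e]; exact h.2 i j hij

variable {P} in
theorem Admissible.dual {M : ℕ} {u : Fin M → ℂ} (h : P.Admissible u) :
    P.dual.Admissible fun i => (u i)⁻¹ := h.swap

theorem swap_Lam1 {u : ℂ} (hu : u ≠ 0) : P.swap.Lam1 (-1) u⁻¹ = P.Lam1 1 u := by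
  have h0 := P.q_ne
  have h1 := P.qn_ne
  have h2 := P.ζ_ne
  have h3 := P.tb_ne
  have h4 := P.tcs_ne
  have e : P.tc / P.tcs = P.tbs / P.tb := by
    rw [div_eq_div_iff h4 h3, ← P.tb_mul_tc, mul_comm]
  have e2 : P.q ^ (-(P.n : ℤ) - 1) = (P.qn * P.q)⁻¹ := by
    rw [zpow_sub₀ h0, zpow_neg, zpow_n, zpow_one]; field_simp
  have e3 : P.q ^ ((P.n : ℤ) + 1) = P.qn * P.q := by
    rw [zpow_add₀ h0, zpow_n, zpow_one]
  have e4 : P.q ^ (-(P.n : ℤ)) = P.qn⁻¹ := by rw [zpow_neg, zpow_n]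
  rw [P.swap.Lam1_minus (inv_ne_zero hu), swap_qn, swap_zz, Lam1, e2, e3, e4, zpow_n, zz]
  simp only [swap]
  rw [e]
  norm_num
  field_simp
  ring

theorem swap_Lam2 {u : ℂ} (hu : u ≠ 0) : P.swap.Lam2 (-1) u⁻¹ = P.Lam2 1 u := by
  have h0 := P.q_ne
  have h1 := P.qn_ne
  have h2 := P.ζ_ne
  have h3 := P.tb_ne
  have h4 := P.tcs_ne
  have e : P.tc / P.tcs = P.tbs / P.tb := by
    rw [div_eq_div_iff h4 h3, ← P.tb_mul_tc, mul_comm]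
  have e2 : P.q ^ (-(P.n : ℤ) - 1) = (P.qn * P.q)⁻¹ := by
    rw [zpow_sub₀ h0, zpow_neg, zpow_n, zpow_one]; field_simp
  have e3 : P.q ^ ((P.n : ℤ) - 1) = P.qn / P.q := by
    rw [zpow_sub₀ h0, zpow_n, zpow_one]
  have e4 : P.q ^ (-(P.n : ℤ)) = P.qn⁻¹ := by rw [zpow_neg, zpow_n]
  rw [P.swap.Lam2_minus (inv_ne_zero hu), swap_qn, swap_zz, Lam2, e2, e3, e4, zpow_n, zz]
  simp only [swap]
  rw [e, b_inv_sq, b_inv_q_sq, neg_div_neg_eq]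
  generalize b (P.q * u ^ 2) = d
  generalize b (u ^ 2) = d'
  norm_num
  simp only [div_eq_mul_inv, mul_inv]
  generalize d⁻¹ = d''
  field_simp
  ring

/-- The common factor `u⁻²` in `Λ₁` and `Λ₂` is harmless in homogeneous equations; in the
inhomogeneous ones it accounts for the missing power of `u_i` before `T_i` in the dual functions. -/
theorem dual_Lam1 {u : ℂ} (hu : u ≠ 0) :
    P.dual.Lam1 (-1) u⁻¹ = P.Lam1 (-1) u / u ^ 2 := by
  have h0 := P.q_ne
  have h1 := P.qn_ne
  have h2 := P.ζ_ne
  have h3 := P.tb_ne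
  have h4 := P.tcs_ne
  have h5 := P.tbs_ne
  rw [P.dual.Lam1_minus (inv_ne_zero hu), P.Lam1_minus hu, dual_qn, dual_zz]
  simp only [dual, P.tc_eq]
  field_simp
  ring

theorem dual_Lam2 {u : ℂ} (hu : u ≠ 0) :
    P.dual.Lam2 (-1) u⁻¹ = P.Lam2 (-1) u / u ^ 2 := by
  have h0 := P.q_ne
  have h1 := P.qn_ne
  have h2 := P.ζ_ne
  have h3 := P.tb_ne
  have h4 := P.tcs_ne
  have h5 := P.tbs_ne
  rw [P.dual.Lam2_minus (inv_ne_zero hu), P.Lam2_minus hu, dual_qn, dual_zz]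
  simp only [dual, P.tc_eq]
  rw [b_inv_sq, b_inv_q_sq, neg_div_neg_eq]
  generalize b (u ^ 2) / b (P.q * u ^ 2) = d
  field_simp
  ring

/-- Inverting `q` only reverses the nodes, as it must because `S` is unchanged. -/
theorem swap_node (k : Fin (P.n + 1)) : P.swap.node k = P.node (Fin.rev k : Fin (P.n + 1)) := by
  have h0 := P.q_ne
  have hn := P.qn_ne
  have hz := P.ζ_ne
  have h1 : P.q ^ (k : ℕ) ≠ 0 := pow_ne_zero _ h0
  have h2 : P.q ^ ((Fin.rev k : Fin (P.n + 1)) : ℕ) = P.qn / P.q ^ (k : ℕ) := by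
    rw [eq_div_iff h1, ← pow_add, qn, Fin.val_rev]
    congr 1
    omega
  rw [node, node, h2, swap_qn]
  simp only [swap]
  rw [inv_pow]
  field_simp

theorem swap_charS_eval (x : ℂ) : P.swap.charS.eval x = P.charS.eval x := by
  rw [charS, charS, eval_rootPoly, eval_rootPoly]
  exact Fintype.prod_equiv Fin.revPerm _ _ fun k => congrArg (x - ·) (P.swap_node k)

theorem swap_inhomTerm {u : Fin P.n → ℂ} (hu : ∀ i, u i ≠ 0) (i : Fin P.n) :
    P.swap.inhomTerm (fun i => (u i)⁻¹) i = P.inhomTerm u i := by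
  have h1 := P.swap.inhomTerm_eq (u := fun i => (u i)⁻¹) (fun i => inv_ne_zero (hu i)) i
  rw [h1, P.inhomTerm_eq hu]
  simp only [P.swap_symRoot, P.swap_charS_eval]
  rw [b_inv_sq]
  simp only [swap]
  rw [b_inv, neg_div_neg_eq]
  rfl

theorem dual_inhomTerm {u : Fin P.n → ℂ} (hu : ∀ i, u i ≠ 0) (i : Fin P.n) :
    P.dual.inhomTerm (fun i => (u i)⁻¹) i = P.inhomTerm u i := P.swap_inhomTerm hu i

theorem swap_qInt : P.swap.qInt = P.qInt := by
  rw [qInt, qInt, P.swap_q_sub]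
  simp only [swap, inv_zpow', neg_neg]
  rw [← neg_sub, neg_div_neg_eq]

theorem dual_qInt : P.dual.qInt = P.qInt := P.swap_qInt

variable {P}

theorem IsHom.swap {M : ℕ} {u : Fin M → ℂ} (h : P.IsHom 1 u) :
    P.swap.IsHom (-1) fun i => (u i)⁻¹ := by
  refine ⟨h.1.swap, fun i => ?_⟩
  rw [← h.2 i, bethe, bethe, P.swap_Lam1 (h.1.ne_zero i), P.swap_Lam2 (h.1.ne_zero i), b_inv_sq]
  simp only [P.inv_f, P.inv_h]
  simp only [Params.swap]
  rw [b_inv_q_sq, neg_div_neg_eq]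

theorem IsHom.dual {M : ℕ} {u : Fin M → ℂ} (h : P.IsHom (-1) u) :
    P.dual.IsHom (-1) fun i => (u i)⁻¹ := by
  refine ⟨h.1.dual, fun i => ?_⟩
  have h1 : ∀ v w : ℂ, P.dual.f v⁻¹ w⁻¹ = P.f v w := fun v w => P.inv_f
  have h2 : ∀ v w : ℂ, P.dual.h v⁻¹ w⁻¹ = P.h v w := fun v w => P.inv_h
  rw [← zero_div (u i ^ 2), ← h.2 i, bethe, bethe, P.dual_Lam1 (h.1.ne_zero i),
    P.dual_Lam2 (h.1.ne_zero i), b_inv_sq]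
  simp only [h1, h2]
  simp only [Params.dual]
  rw [b_inv_q_sq, neg_div_neg_eq]
  ring

theorem IsInhom.swap {M : ℕ} {u : Fin P.n → ℂ} (h : P.IsInhom M u) :
    P.swap.IsInhomStar M fun i => (u i)⁻¹ := by
  refine ⟨h.1.swap, fun i => ?_, ?_⟩
  · have hT := P.swap_inhomTerm h.1.ne_zero i
    refine Eq.trans ?_ (h.2.1 i)
    simp only [betheInhomMinus, betheInhomPlus, betheInhomAux]
    rw [P.swap_Lam1 (h.1.ne_zero i), P.swap_Lam2 (h.1.ne_zero i), b_inv_sq, hT]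
    simp only [P.inv_f, P.inv_h]
    simp only [Params.swap]
    have e1 : P.q⁻¹ ^ (1 + 2 * (P.n : ℤ)) = P.q ^ (-1 - 2 * (P.n : ℤ)) := by
      rw [inv_zpow']; congr 1; ring
    have e2 : (P.q⁻¹ ^ 2 * (u i)⁻¹ ^ 3) ^ (-(-1) : ℤ) = (P.q ^ 2 * u i ^ 3) ^ (-1 : ℤ) := by
      rw [inv_pow, inv_pow, ← mul_inv, neg_neg, zpow_one, zpow_neg_one]
    have e3 : (u i)⁻¹ ^ (-1 : ℤ) = u i ^ (1 : ℤ) := by rw [inv_zpow', neg_neg]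
    have e4 : (u i)⁻¹ ^ (-(2 * -1) : ℤ) = u i ^ (-(2 * 1) : ℤ) := by rw [inv_zpow']; congr 1
    rw [b_inv_q_sq, neg_div_neg_eq, e1, e2, e3, e4]
    rfl
  · rw [P.swap_thetaStar, h.2.2, P.swap_qInt, P.swap_edgeStar, P.swap_zz]
    simp only [P.swap_symRoot]
    simp only [Params.swap, inv_zpow', neg_neg, inv_inv]
    rfl

theorem IsDualInhomStar.dual {N : ℕ} {u : Fin P.n → ℂ} (h : P.IsDualInhomStar N u) :
    P.dual.IsInhomStar N fun i => (u i)⁻¹ := by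
  refine ⟨h.1.dual, fun i => ?_, ?_⟩
  · have hT := P.dual_inhomTerm h.1.ne_zero i
    have h1 : ∀ v w : ℂ, P.dual.f v⁻¹ w⁻¹ = P.f v w := fun v w => P.inv_f
    have h2 : ∀ v w : ℂ, P.dual.h v⁻¹ w⁻¹ = P.h v w := fun v w => P.inv_h
    have hu := h.1.ne_zero i
    rw [← zero_div (u i ^ 2), ← h.2.1 i]
    simp only [betheInhomMinus, betheDualMinus, betheDualAux, betheInhomAux]
    rw [P.dual_Lam1 (h.1.ne_zero i), P.dual_Lam2 (h.1.ne_zero i), b_inv_sq, hT]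
    simp only [h1, h2]
    simp only [Params.dual]
    have e1 : P.q⁻¹ ^ (1 + 2 * (P.n : ℤ)) = P.q ^ (-1 - 2 * (P.n : ℤ)) := by
      rw [inv_zpow']; congr 1; ring
    have e2 : (P.q⁻¹ ^ 2 * (u i)⁻¹ ^ 3) ^ (-(-1) : ℤ) = (P.q ^ 2 * u i ^ 3) ^ (-1 : ℤ) := by
      rw [inv_pow, inv_pow, ← mul_inv, neg_neg, zpow_one, zpow_neg_one]
    have e3 : (u i)⁻¹ ^ (-1 : ℤ) = u i ^ (-(-1) : ℤ) := by rw [inv_zpow']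
    have e4 : (u i)⁻¹ ^ (-(2 * -1) : ℤ) = (u i ^ 2)⁻¹ := by
      rw [inv_zpow', ← zpow_natCast, ← zpow_neg]; congr 1
    rw [b_inv_q_sq, neg_div_neg_eq, e1, e2, e3, e4]
    generalize b (u i ^ 2) / b (P.q * u i ^ 2) = d
    generalize u i ^ (-(-1) : ℤ) = w
    generalize (P.q ^ 2 * u i ^ 3) ^ (-1 : ℤ) = w'
    suffices H : ∀ x y : ℂ, d * w * x * (P.Lam1 (-1) (u i) / u i ^ 2) -
        w' * y * (P.Lam2 (-1) (u i) / u i ^ 2) +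
        P.q ^ (-1 - 2 * (P.n : ℤ)) * P.tc * (u i ^ 2)⁻¹ * P.inhomTerm u i =
      (d * w * x * P.Lam1 (-1) (u i) - w' * y * P.Lam2 (-1) (u i) +
        P.q ^ (-1 - 2 * (P.n : ℤ)) * P.tc * P.inhomTerm u i) / u i ^ 2 from H _ _
    intro x y
    ring
  · rw [P.dual_thetaStar, h.2.2, P.dual_qInt, P.dual_edgeStar, P.dual_zz]
    simp only [P.dual_symRoot]
    simp only [Params.dual, inv_zpow', neg_neg, inv_inv]
    rfl

theorem IsDualInhom.swap {M : ℕ} {u : Fin P.n → ℂ} (h : P.IsDualInhom M u) :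
    P.swap.IsDualInhomStar M fun i => (u i)⁻¹ := by
  refine ⟨h.1.swap, fun i => ?_, ?_⟩
  · have hT := P.swap_inhomTerm h.1.ne_zero i
    refine Eq.trans ?_ (h.2.1 i)
    simp only [betheDualMinus, betheDualPlus, betheDualAux]
    rw [P.swap_Lam1 (h.1.ne_zero i), P.swap_Lam2 (h.1.ne_zero i), b_inv_sq, hT]
    simp only [P.inv_f, P.inv_h]
    simp only [Params.swap]
    have e1 : P.q⁻¹ ^ (-1 - 2 * (P.n : ℤ)) = P.q ^ (1 + 2 * (P.n : ℤ)) := by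
      rw [inv_zpow']; congr 1; ring
    have e2 : (P.q⁻¹ ^ 2 * (u i)⁻¹ ^ 3) ^ (-1 : ℤ) = (P.q ^ 2 * u i ^ 3) ^ (1 : ℤ) := by
      rw [inv_pow, inv_pow, ← mul_inv, zpow_one, zpow_neg_one, inv_inv]
    have e3 : (u i)⁻¹ ^ (-(-1) : ℤ) = u i ^ (-1 : ℤ) := by rw [inv_zpow', neg_neg]
    rw [b_inv_q_sq, neg_div_neg_eq, e1, e2, e3]
    rfl
  · rw [P.swap_thetaStar, h.2.2, P.swap_qInt, P.swap_edgeStar, P.swap_zz]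
    simp only [P.swap_symRoot]
    simp only [Params.swap, inv_zpow', neg_neg]
    rfl

end Params

/-! ### Operator strings as polynomials in `S`, and pairings of dual eigenbases. -/

theorem map_qComm {R S : Type*} [Ring R] [Algebra ℂ R] [Ring S] [Algebra ℂ S] (φ : R →ₐ[ℂ] S)
    (q : ℂ) (X Y : R) : φ (qComm q X Y) = qComm q (φ X) (φ Y) := by
  simp [qComm]

theorem map_prod_ofFn {R S : Type*} [Ring R] [Algebra ℂ R] [Ring S] [Algebra ℂ S] (φ : R →ₐ[ℂ] S)
    (T : S) {M : ℕ} (F : Fin M → R) (c t : Fin M → ℂ) (h : ∀ i, φ (F i) = c i • (T - t i • 1)) :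
    φ (List.ofFn F).prod = (∏ i, c i) • aeval T (rootPoly t) := by
  induction M with
  | zero => simp [rootPoly]
  | succ M ih =>
    rw [List.ofFn_succ, List.prod_cons, map_mul, h 0,
      ih (fun i => F i.succ) (fun i => c i.succ) (fun i => t i.succ) fun i => h i.succ,
      Fin.prod_univ_succ, rootPoly_succ, map_mul, map_sub, aeval_X, aeval_C, smul_mul_smul_comm,
      Algebra.algebraMap_eq_smul_one]
    rfl

theorem aeval_dualMap {V : Type*} [AddCommGroup V] [Module ℂ V] (T : End ℂ V) (p : ℂ[X])
    (φ : Dual ℂ V) : aeval (LinearMap.dualMap T : End ℂ (Dual ℂ V)) p φ = φ ∘ₗ aeval T p := by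
  induction p using Polynomial.induction_on' with
  | add p r hp hr => simp only [map_add, LinearMap.add_apply, hp, hr, LinearMap.comp_add]
  | monomial n a =>
    simp only [aeval_monomial, Module.End.mul_apply, Module.algebraMap_end_apply]
    ext x
    have h : ∀ ψ : Dual ℂ V, ((LinearMap.dualMap T : End ℂ (Dual ℂ V)) ^ n) ψ = ψ ∘ₗ (T ^ n) := by
      induction n with
      | zero => intro ψ; rfl
      | succ n ih =>
        intro ψ
        rw [pow_succ, Module.End.mul_apply, ih, pow_succ' T]
        rfl
    simp [h]

namespace LeonardPair

variable {P : Params} {V : Type*} [AddCommGroup V] [Module ℂ V] (L : LeonardPair P V)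

theorem prod_inv_smul_vec {M : ℕ} (hM : M ≤ P.n) (g : Fin M → ℂ) (hg : ∀ i, g i ≠ 0)
    (t : Fin M → ℂ) :
    (∏ k, (g k * L.coef (LeonardRep.hi hM k) (LeonardRep.lo hM k))⁻¹) •
      (∏ i : Fin M, g i * (P.tb * P.q ^ (2 * (i : ℕ) + 1))) • L.vec t = L.nstate hM t := by
  rw [smul_smul, ← Finset.prod_mul_distrib, nstate]
  congr 1
  refine Finset.prod_congr rfl fun k _ => ?_
  have := hg k
  have := L.coef_succ_ne_zero (i := LeonardRep.hi hM k) (j := LeonardRep.lo hM k) rfl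
  field_simp

/-- In the string of `ℬ` operators the dynamical parameter decreases from left to right; only the
product of the powers of `q` matters. -/
theorem prod_inv_smul_vec_rev {M : ℕ} (hM : M ≤ P.n) (g : Fin M → ℂ) (hg : ∀ i, g i ≠ 0)
    (t : Fin M → ℂ) :
    (∏ k, (g k * L.coef (LeonardRep.hi hM k) (LeonardRep.lo hM k))⁻¹) •
      (∏ i : Fin M, g i * (P.tb * P.q ^ (2 * (Fin.rev i : ℕ) + 1))) • L.vec t = L.nstate hM t := by
  rw [← L.prod_inv_smul_vec hM g hg]
  congr 2
  have h := Fintype.prod_equiv Fin.revPerm _ (fun i : Fin M => P.tb * P.q ^ (2 * (i : ℕ) + 1))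
    fun i => rfl
  exact Finset.prod_mul_distrib.trans ((congrArg _ h).trans Finset.prod_mul_distrib.symm)

theorem swap_vec {M : ℕ} (t : Fin M → ℂ) :
    L.swap.vec t = aeval L.S (rootPoly t) (L.ketS 0) := by
  rw [vec, swap_S]; rfl

theorem dual_vec (bra braS : Basis (Fin (P.n + 1)) ℂ (Dual ℂ V))
    (hbra : ∀ M, bra M ∘ₗ L.A = P.theta M • bra M)
    (hbraS : ∀ N, braS N ∘ₗ L.As = P.thetaStar N • braS N) {M : ℕ} (t : Fin M → ℂ) :
    (L.dual bra braS hbra hbraS).vec t = bra 0 ∘ₗ aeval L.S (rootPoly t) := by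
  rw [vec, dual_S, aeval_dualMap]; rfl

theorem bra_ket_of_ne {φ : Dual ℂ V} {i j : Fin (P.n + 1)} (hφ : φ ∘ₗ L.A = P.theta i • φ)
    (h : i ≠ j) : φ (L.ket j) = 0 := by
  have h1 := LinearMap.congr_fun hφ (L.ket j)
  simp only [LinearMap.comp_apply, L.ket_eig, map_smul, LinearMap.smul_apply, smul_eq_mul] at h1
  by_contra h0
  exact h (Fin.ext (L.theta_inj _ (Nat.lt_succ_iff.1 i.2) _ (Nat.lt_succ_iff.1 j.2)
    (mul_right_cancel₀ h0 h1).symm))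

theorem bra_apply {φ : Dual ℂ V} {i : Fin (P.n + 1)} (hφ : φ ∘ₗ L.A = P.theta i • φ) (x : V) :
    φ x = L.ket.repr x i * φ (L.ket i) := by
  conv_lhs => rw [← L.ket.sum_repr x]
  rw [map_sum, Finset.sum_eq_single i (fun j _ hj => ?_) (by simp), map_smul, smul_eq_mul]
  rw [map_smul, L.bra_ket_of_ne hφ hj.symm, smul_zero]

theorem bra_ket_self_ne_zero {φ : Dual ℂ V} {i : Fin (P.n + 1)} (hφ : φ ∘ₗ L.A = P.theta i • φ)
    (h0 : φ ≠ 0) : φ (L.ket i) ≠ 0 := fun h =>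
  h0 (LinearMap.ext fun x => by rw [L.bra_apply hφ, h, mul_zero]; rfl)

/-- The eigenbases of `V` and of the dual are orthogonal but not normalized, hence the division by
`ξ_j`. -/
theorem repr_bra (bra : Basis (Fin (P.n + 1)) ℂ (Dual ℂ V))
    (hbra : ∀ M, bra M ∘ₗ L.A = P.theta M • bra M) (φ : Dual ℂ V) (j : Fin (P.n + 1)) :
    bra.repr φ j = φ (L.ket j) / bra j (L.ket j) := by
  rw [eq_div_iff (L.bra_ket_self_ne_zero (hbra j) (bra.ne_zero j))]
  conv_rhs => rw [← bra.sum_repr φ]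
  rw [LinearMap.sum_apply, Finset.sum_eq_single j (fun k _ hk => ?_) (by simp)]
  · rfl
  · rw [LinearMap.smul_apply, L.bra_ket_of_ne (hbra k) hk, smul_zero]

end LeonardPair

namespace Params

variable (P : Params)

/-- The convention `0 ^ 0 = 1` keeps one of the two terms of `γ` alive when a gauge parameter
vanishes, so `γ` becomes a monomial. -/
theorem gam_minus_zero_right (α : ℂ) (m : ℤ) :
    P.gam (-1) α 0 1 m = α * P.q ^ (-m) := by
  norm_num [gam]

theorem gam_plus_zero_right (α : ℂ) (m : ℤ) :
    P.gam 1 α 0 1 m = -(α * P.q ^ m) := by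
  norm_num [gam]

theorem gam_minus_zero_left (β : ℂ) (m : ℤ) :
    P.gam (-1) 0 β 1 m = -(β * P.q ^ m) := by
  norm_num [gam]

theorem gam_plus_zero_left (β : ℂ) (m : ℤ) :
    P.gam 1 0 β 1 m = β * P.q ^ (-m) := by
  norm_num [gam]

end Params

/-! ### From the representation to the operator pair: dynamical operators as linear factors in `S`.
-/

namespace LeonardRep

variable {P : Params} {V : Type*} [AddCommGroup V] [Module ℂ V] (D : LeonardRep P V)

theorem invariant_of_generators {W : Submodule ℂ V} (h : ∀ x ∈ W, D.π P.genA x ∈ W)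
    (hs : ∀ x ∈ W, D.π P.genAs x ∈ W) (a : P.Algebra) : ∀ x ∈ W, D.π a x ∈ W := by
  obtain ⟨a, rfl⟩ := RingQuot.mkAlgHom_surjective ℂ _ a
  induction a using FreeAlgebra.induction with
  | grade0 r =>
    intro x hx
    rw [AlgHom.commutes, AlgHom.commutes, Module.algebraMap_end_apply]
    exact W.smul_mem r hx
  | grade1 i =>
    fin_cases i
    · exact h
    · exact hs
  | mul a b ha hb =>
    intro x hx
    rw [map_mul, map_mul]
    exact ha _ (hb _ hx)
  | add a b ha hb =>
    intro x hx
    rw [map_add, map_add]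
    exact W.add_mem (ha _ hx) (hb _ hx)

/-- The images of the generators. -/
def toPair : LeonardPair P V where
  A := D.π P.genA
  As := D.π P.genAs
  rel1 := by
    have h := congrArg D.π (RingQuot.mkAlgHom_rel ℂ
      (Rel.aw1 (q := P.q) (ρ := P.rho) (ω := P.omega) (η := P.eta) (ηs := P.etaStar)))
    simp only [map_qComm, map_add, map_smul, map_one] at h
    exact h
  rel2 := by
    have h := congrArg D.π (RingQuot.mkAlgHom_rel ℂ
      (Rel.aw2 (q := P.q) (ρ := P.rho) (ω := P.omega) (η := P.eta) (ηs := P.etaStar)))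
    simp only [map_qComm, map_add, map_smul, map_one] at h
    exact h
  irreducible W h hs := D.irreducible W fun a => D.invariant_of_generators h hs a
  theta_inj := D.theta_inj
  thetaStar_inj := D.thetaStar_inj
  ket := D.ket
  ketS := D.ketS
  ket_eig := D.ket_eig
  ketS_eig := D.ketS_eig

/-- At `x = 0` the gauge vectors select `K₁₂(u)`, so all dynamical operators used here become
commuting functions of one operator. -/
theorem π_gaugeK_zero (ε : ℤ) (u : ℂ) : D.π (P.gaugeK ε u 0) =
    (-(P.χ * b (u ^ 2) / P.qq)) • (D.toPair.S - P.symRoot u • 1) := by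
  have h1 := P.qq_ne
  have h2 := P.tb_ne
  have h3 := P.tc_ne
  simp only [Params.gaugeK, Params.K12, zero_mul, zero_smul, zero_add, sub_zero, ne_eq,
    OfNat.ofNat_ne_zero, not_false_eq_true, zero_pow, map_smul, map_add, map_one, map_qComm,
    LeonardPair.S, Params.symRoot, Params.rho, toPair]
  match_scalars <;> field_simp
  ring

/-- The prescribed `α` is the one for which `χ`, `qq` and `m₀` cancel; what remains is the inverse
of the ratio in `repr_S_ket_succ`. -/
theorem π_dynB_minus (m₀ k : ℤ) (u : ℂ) : D.π (P.dynB (-1) (P.alphaMinus m₀) 0 u (m₀ + 2 * k)) =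
    (P.q * u * b (u ^ 2) * (P.tb * P.q ^ (2 * k + 1))) • (D.toPair.S - P.symRoot u • 1) := by
  have h0 := P.q_ne
  have h1 := P.qq_ne
  have h2 := P.tb_ne
  have h3 := P.χ_ne
  rw [Params.dynB, map_smul, zero_mul, D.π_gaugeK_zero, smul_smul, Params.gam_minus_zero_right, Params.alphaMinus]
  congr 1
  simp only [zpow_add₀ h0, zpow_neg, zpow_one, zpow_mul, neg_add_rev, neg_neg, mul_neg]
  push_cast
  field_simp
  try ring

theorem π_dynB_plus (m₀ k : ℤ) (u : ℂ) : D.π (P.dynB (1) (P.alphaPlus m₀) 0 u (m₀ + 2 * k)) =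
    (-P.q⁻¹ * u⁻¹ * b (u ^ 2) * (P.tcs * P.q⁻¹ ^ (2 * k + 1))) • (D.toPair.S - P.symRoot u • 1) := by
  have h0 := P.q_ne
  have h1 := P.qq_ne
  have h2 := P.tcs_ne
  have h3 := P.χ_ne
  rw [Params.dynB, map_smul, zero_mul, D.π_gaugeK_zero, smul_smul, Params.gam_plus_zero_right, Params.alphaPlus]
  congr 1
  simp only [zpow_add₀ h0, zpow_neg, zpow_one, zpow_mul, inv_zpow, mul_neg]
  push_cast
  field_simp
  try ring

theorem π_dynC_minus (m₀ k : ℤ) (u : ℂ) : D.π (P.dynC (-1) 0 (P.betaMinus m₀) u (m₀ + 2 * (k + 1))) =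
    (P.q⁻¹ * u * b (u ^ 2) * (P.tc * P.q⁻¹ ^ (2 * k + 1))) • (D.toPair.S - P.symRoot u • 1) := by
  have h0 := P.q_ne
  have h1 := P.qq_ne
  have h2 := P.tc_ne
  have h3 := P.χ_ne
  rw [Params.dynC, map_smul, zero_mul, D.π_gaugeK_zero, smul_smul, Params.gam_minus_zero_left, Params.betaMinus]
  congr 1
  simp only [zpow_add₀ h0, zpow_sub₀ h0, zpow_one, mul_add, zpow_mul, inv_zpow, neg_neg, mul_neg, mul_one]
  push_cast
  field_simp
  try ring

theorem π_dynC_plus (m₀ k : ℤ) (u : ℂ) : D.π (P.dynC (1) 0 (P.betaPlus m₀) u (m₀ + 2 * (k + 1))) =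
    (-P.q * u⁻¹ * b (u ^ 2) * (P.tbs * P.q ^ (2 * k + 1))) • (D.toPair.S - P.symRoot u • 1) := by
  have h0 := P.q_ne
  have h1 := P.qq_ne
  have h2 := P.tbs_ne
  have h3 := P.χ_ne
  rw [Params.dynC, map_smul, zero_mul, D.π_gaugeK_zero, smul_smul, Params.gam_plus_zero_left, Params.betaPlus]
  congr 1
  simp only [zpow_add₀ h0, zpow_sub₀ h0, zpow_neg, zpow_one, mul_add, zpow_mul, neg_sub, mul_neg, mul_one]
  push_cast
  field_simp
  try ring

theorem π_stringB_minus (m₀ : ℤ) {M : ℕ} (u : Fin M → ℂ) :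
    D.π (P.stringB (-1) (P.alphaMinus m₀) 0 m₀ u) =
      (∏ i : Fin M, P.q * u i * b (u i ^ 2) * (P.tb * P.q ^ (2 * (Fin.rev i : ℕ) + 1))) •
        aeval D.toPair.S (rootPoly fun i => P.symRoot (u i)) := by
  refine map_prod_ofFn D.π _ _ _ _ fun i => ?_
  have h : (M : ℤ) - 1 - ((i : ℕ) : ℤ) = ((Fin.rev i : ℕ) : ℤ) := by rw [Fin.val_rev]; omega
  rw [h, π_dynB_minus]
  norm_cast

theorem π_stringB_plus (m₀ : ℤ) {M : ℕ} (u : Fin M → ℂ) :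
    D.π (P.stringB 1 (P.alphaPlus m₀) 0 m₀ u) =
      (∏ i : Fin M, -P.q⁻¹ * (u i)⁻¹ * b (u i ^ 2) *
        (P.tcs * P.q⁻¹ ^ (2 * (Fin.rev i : ℕ) + 1))) •
        aeval D.toPair.S (rootPoly fun i => P.symRoot (u i)) := by
  refine map_prod_ofFn D.π _ _ _ _ fun i => ?_
  have h : (M : ℤ) - 1 - ((i : ℕ) : ℤ) = ((Fin.rev i : ℕ) : ℤ) := by rw [Fin.val_rev]; omega
  rw [h, π_dynB_plus]
  norm_cast

theorem π_stringC_minus (m₀ : ℤ) {M : ℕ} (u : Fin M → ℂ) :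
    D.π (P.stringC (-1) 0 (P.betaMinus m₀) m₀ u) =
      (∏ i : Fin M, P.q⁻¹ * u i * b (u i ^ 2) * (P.tc * P.q⁻¹ ^ (2 * (i : ℕ) + 1))) •
        aeval D.toPair.S (rootPoly fun i => P.symRoot (u i)) := by
  refine map_prod_ofFn D.π _ _ _ _ fun i => ?_
  rw [π_dynC_minus]
  norm_cast

theorem π_stringC_plus (m₀ : ℤ) {M : ℕ} (u : Fin M → ℂ) :
    D.π (P.stringC 1 0 (P.betaPlus m₀) m₀ u) =
      (∏ i : Fin M, -P.q * (u i)⁻¹ * b (u i ^ 2) * (P.tbs * P.q ^ (2 * (i : ℕ) + 1))) •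
        aeval D.toPair.S (rootPoly fun i => P.symRoot (u i)) := by
  refine map_prod_ofFn D.π _ _ _ _ fun i => ?_
  rw [π_dynC_plus]
  norm_cast

/-- The transpose of `toPair`. -/
def dualPair : LeonardPair P.dual (Dual ℂ V) :=
  D.toPair.dual D.bra D.braS D.bra_eig D.braS_eig

theorem swap_eig (N : Fin (P.n + 1)) :
    D.braS N ∘ₗ D.toPair.swap.A = P.swap.theta N • D.braS N := by
  rw [P.swap_theta]; exact D.braS_eig N

theorem swap_eigS (M : Fin (P.n + 1)) :
    D.bra M ∘ₗ D.toPair.swap.As = P.swap.thetaStar M • D.bra M := by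
  rw [P.swap_thetaStar]; exact D.bra_eig M

/-- The transpose of `toPair`, with `A` and `A*` exchanged. -/
def dualSwapPair : LeonardPair P.swap.dual (Dual ℂ V) :=
  D.toPair.swap.dual D.braS D.bra D.swap_eig D.swap_eigS

theorem dualPair_vec {M : ℕ} (t : Fin M → ℂ) :
    D.dualPair.vec t = D.bra 0 ∘ₗ aeval D.toPair.S (rootPoly t) :=
  D.toPair.dual_vec D.bra D.braS D.bra_eig D.braS_eig t

theorem dualSwapPair_vec {M : ℕ} (t : Fin M → ℂ) :
    D.dualSwapPair.vec t = D.braS 0 ∘ₗ aeval D.toPair.S (rootPoly t) := by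
  have h := D.toPair.swap.dual_vec D.braS D.bra D.swap_eig D.swap_eigS t
  rw [LeonardPair.swap_S] at h
  exact h

variable {M : ℕ} (hM : M ≤ P.n) {u : Fin M → ℂ}

theorem normKet_smul_PsiMinus (m₀ : ℤ) (hu : P.Admissible u) :
    D.normKet hM u • D.PsiMinus m₀ u = D.toPair.nstate hM fun i => P.symRoot (u i) := by
  rw [PsiMinus, π_stringB_minus, LinearMap.smul_apply]
  exact D.toPair.prod_inv_smul_vec_rev hM _
    (fun i => mul_ne_zero (mul_ne_zero P.q_ne (hu.ne_zero i)) (hu.b_ne i)) _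

theorem normKetS_smul_PsiPlus (m₀ : ℤ) (hu : P.Admissible u) :
    D.normKetS hM u • D.PsiPlus m₀ u =
      D.toPair.swap.nstate (M := M) hM fun i => P.symRoot (u i) := by
  rw [PsiPlus, π_stringB_plus, LinearMap.smul_apply]
  refine Eq.trans ?_ (D.toPair.swap.prod_inv_smul_vec_rev hM
    (fun i => -P.q⁻¹ * (u i)⁻¹ * b (u i ^ 2)) (fun i => mul_ne_zero (mul_ne_zero
      (neg_ne_zero.2 (inv_ne_zero P.q_ne)) (inv_ne_zero (hu.ne_zero i))) (hu.b_ne i)) _)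
  rw [LeonardPair.swap_vec]
  rfl

theorem normBra_smul_dualPsiMinus (m₀ : ℤ) (hu : P.Admissible u) :
    D.normBra hM u • D.dualPsiMinus m₀ u =
      D.dualPair.nstate (M := M) hM fun i => P.symRoot (u i) := by
  rw [dualPsiMinus, π_stringC_minus, LinearMap.comp_smul]
  refine Eq.trans ?_ (D.dualPair.prod_inv_smul_vec hM
    (fun i => P.q⁻¹ * u i * b (u i ^ 2)) (fun i => mul_ne_zero (mul_ne_zero
      (inv_ne_zero P.q_ne) (hu.ne_zero i)) (hu.b_ne i)) _)
  rw [dualPair_vec]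
  rfl

theorem normBraS_smul_dualPsiPlus (m₀ : ℤ) (hu : P.Admissible u) :
    D.normBraS hM u • D.dualPsiPlus m₀ u =
      D.dualSwapPair.nstate (M := M) hM fun i => P.symRoot (u i) := by
  rw [dualPsiPlus, π_stringC_plus, LinearMap.comp_smul]
  refine Eq.trans ?_ (D.dualSwapPair.prod_inv_smul_vec hM
    (fun i => -P.q * (u i)⁻¹ * b (u i ^ 2)) (fun i => mul_ne_zero (mul_ne_zero
      (neg_ne_zero.2 P.q_ne) (inv_ne_zero (hu.ne_zero i))) (hu.b_ne i)) _)
  rw [dualSwapPair_vec]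
  -- The exchange and the transposition each invert `q`, so their composite restores it.
  have e : P.swap.dual.q = P.q := inv_inv P.q
  rw [e]
  rfl

/-! ### The Bethe states are eigenvectors -/

theorem normKet_smul_PsiMinus_eq (m₀ : ℤ) (hu : P.IsHom (-1) u) :
    D.normKet hM u • D.PsiMinus m₀ u = D.ket ⟨M, Nat.lt_succ_iff.2 hM⟩ := by
  rw [D.normKet_smul_PsiMinus hM m₀ hu.1]
  exact D.toPair.nstate_eq_ket hM hu

theorem normKetS_smul_PsiPlus_eq (m₀ : ℤ) (hu : P.IsHom 1 u) :
    D.normKetS hM u • D.PsiPlus m₀ u = D.ketS ⟨M, Nat.lt_succ_iff.2 hM⟩ := by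
  rw [D.normKetS_smul_PsiPlus hM m₀ hu.1]
  have h := D.toPair.swap.nstate_eq_ket hM hu.swap
  simp only [P.swap_symRoot] at h
  exact h

theorem normBra_smul_dualPsiMinus_eq (m₀ : ℤ) (hu : P.IsHom (-1) u) :
    D.normBra hM u • D.dualPsiMinus m₀ u = D.bra ⟨M, Nat.lt_succ_iff.2 hM⟩ := by
  rw [D.normBra_smul_dualPsiMinus hM m₀ hu.1]
  have h := D.dualPair.nstate_eq_ket hM hu.dual
  simp only [P.dual_symRoot] at h
  exact h

theorem normBraS_smul_dualPsiPlus_eq (m₀ : ℤ) (hu : P.IsHom 1 u) :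
    D.normBraS hM u • D.dualPsiPlus m₀ u = D.braS ⟨M, Nat.lt_succ_iff.2 hM⟩ := by
  rw [D.normBraS_smul_dualPsiPlus hM m₀ hu.1]
  have h := D.dualSwapPair.nstate_eq_ket hM hu.swap.dual
  simp only [P.swap.dual_symRoot, P.swap_symRoot] at h
  exact h

variable {w : Fin P.n → ℂ}

theorem normKetInhom_smul_PsiPlus (m₀ : ℤ) (hw : P.IsInhom M w) :
    D.normKetInhom ⟨M, Nat.lt_succ_iff.2 hM⟩ w • D.PsiPlus m₀ w = D.ket ⟨M, Nat.lt_succ_iff.2 hM⟩ := by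
  rw [normKetInhom, mul_comm, mul_smul, D.normKetS_smul_PsiPlus le_rfl m₀ hw.1]
  have h := D.toPair.swap.smul_nstate_eq_ketS hM hw.swap
  simp only [P.swap_symRoot] at h
  exact h

theorem normKetSInhom_smul_PsiMinus (m₀ : ℤ) (hw : P.IsInhomStar M w) :
    D.normKetSInhom ⟨M, Nat.lt_succ_iff.2 hM⟩ w • D.PsiMinus m₀ w = D.ketS ⟨M, Nat.lt_succ_iff.2 hM⟩ := by
  rw [normKetSInhom, mul_comm, mul_smul, D.normKet_smul_PsiMinus le_rfl m₀ hw.1]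
  exact D.toPair.smul_nstate_eq_ketS hM hw

theorem normBraInhom_smul_dualPsiPlus (m₀ : ℤ) (hw : P.IsDualInhom M w) :
    D.normBraInhom ⟨M, Nat.lt_succ_iff.2 hM⟩ w • D.dualPsiPlus m₀ w = D.bra ⟨M, Nat.lt_succ_iff.2 hM⟩ := by
  have h := D.dualSwapPair.smul_nstate_eq_ketS hM hw.swap.dual
  simp only [P.swap.dual_symRoot, P.swap_symRoot] at h
  -- Since `⟨θ_M|θ*_{2s}⟩ = P_{M,2s} ξ_M`, dividing by `ξ*_{2s}` gives the coordinate of `⟨θ_M|` on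
  -- `⟨θ*_{2s}|`, which is the factor demanded by `smul_nstate_eq_ketS`.
  have e : D.trans ⟨M, Nat.lt_succ_iff.2 hM⟩ (Fin.last P.n) * (D.xi ⟨M, Nat.lt_succ_iff.2 hM⟩ / D.xiStar (Fin.last P.n)) =
      D.braS.repr (D.bra ⟨M, Nat.lt_succ_iff.2 hM⟩) (Fin.last P.n) := by
    rw [← mul_div_assoc]
    refine Eq.trans ?_ (D.toPair.swap.repr_bra D.braS D.swap_eig _ _).symm
    exact congrArg (· / _) (D.toPair.bra_apply (D.bra_eig _) _).symm
  rw [normBraInhom, mul_assoc, e, mul_comm, mul_smul, D.normBraS_smul_dualPsiPlus le_rfl m₀ hw.1]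
  exact h

theorem normBraSInhom_smul_dualPsiMinus (m₀ : ℤ) (hw : P.IsDualInhomStar M w) :
    D.normBraSInhom ⟨M, Nat.lt_succ_iff.2 hM⟩ w • D.dualPsiMinus m₀ w = D.braS ⟨M, Nat.lt_succ_iff.2 hM⟩ := by
  have h := D.dualPair.smul_nstate_eq_ketS hM hw.dual
  simp only [P.dual_symRoot] at h
  have e : D.transInv ⟨M, Nat.lt_succ_iff.2 hM⟩ (Fin.last P.n) *
      (D.xiStar ⟨M, Nat.lt_succ_iff.2 hM⟩ / D.xi (Fin.last P.n)) =
      D.bra.repr (D.braS ⟨M, Nat.lt_succ_iff.2 hM⟩) (Fin.last P.n) := by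
    rw [← mul_div_assoc]
    refine Eq.trans ?_ (D.toPair.repr_bra D.bra D.bra_eig _ _).symm
    exact congrArg (· / _) (D.toPair.swap.bra_apply (D.swap_eig _) _).symm
  rw [normBraSInhom, mul_assoc, e, mul_comm, mul_smul, D.normBra_smul_dualPsiMinus le_rfl m₀ hw.1]
  exact h

end LeonardRep

end AW

end

theorem mainTheorem7 (P : AW.Params) {V : Type*} [AddCommGroup V] [Module ℂ V]
    (D : AW.LeonardRep P V) (m₀ : ℤ) :
    -- the four identities, for all homogeneous and inhomogeneous Bethe roots
    (∀ (M : ℕ) (hM : M ≤ P.n) (u : Fin M → ℂ) (u' : Fin P.n → ℂ),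
        P.IsHom (-1) u → P.IsInhom M u' →
        D.normKet hM u • D.PsiMinus m₀ u
          = D.normKetInhom ⟨M, by omega⟩ u' • D.PsiPlus m₀ u') ∧
    (∀ (N : ℕ) (hN : N ≤ P.n) (w : Fin N → ℂ) (w' : Fin P.n → ℂ),
        P.IsHom 1 w → P.IsInhomStar N w' →
        D.normKetS hN w • D.PsiPlus m₀ w
          = D.normKetSInhom ⟨N, by omega⟩ w' • D.PsiMinus m₀ w') ∧
    (∀ (M : ℕ) (hM : M ≤ P.n) (v : Fin M → ℂ) (v' : Fin P.n → ℂ),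
        P.IsHom (-1) v → P.IsDualInhom M v' →
        D.normBra hM v • D.dualPsiMinus m₀ v
          = D.normBraInhom ⟨M, by omega⟩ v' • D.dualPsiPlus m₀ v') ∧
    (∀ (N : ℕ) (hN : N ≤ P.n) (y : Fin N → ℂ) (y' : Fin P.n → ℂ),
        P.IsHom 1 y → P.IsDualInhomStar N y' →
        D.normBraS hN y • D.dualPsiPlus m₀ y
          = D.normBraSInhom ⟨N, by omega⟩ y' • D.dualPsiMinus m₀ y') ∧
    -- the reference states
    (∀ u' : Fin P.n → ℂ, P.IsInhom 0 u' →
        D.OmMinus = D.normKetInhom 0 u' • D.PsiPlus m₀ u') ∧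
    (∀ w' : Fin P.n → ℂ, P.IsInhomStar 0 w' →
        D.OmPlus = D.normKetSInhom 0 w' • D.PsiMinus m₀ w') ∧
    -- under the existence hypotheses, all these identities are realized
    (P.Hypothesis1 → P.Hypothesis2 →
      (∀ (M : ℕ) (hM : M ≤ P.n), ∃ (u : Fin M → ℂ) (u' : Fin P.n → ℂ),
        P.IsHom (-1) u ∧ P.IsInhom M u' ∧
        D.normKet hM u • D.PsiMinus m₀ u
          = D.normKetInhom ⟨M, by omega⟩ u' • D.PsiPlus m₀ u') ∧
      (∀ (N : ℕ) (hN : N ≤ P.n), ∃ (w : Fin N → ℂ) (w' : Fin P.n → ℂ),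
        P.IsHom 1 w ∧ P.IsInhomStar N w' ∧
        D.normKetS hN w • D.PsiPlus m₀ w
          = D.normKetSInhom ⟨N, by omega⟩ w' • D.PsiMinus m₀ w')) ∧
    (P.Hypothesis1 → P.Hypothesis3 →
      (∀ (M : ℕ) (hM : M ≤ P.n), ∃ (v : Fin M → ℂ) (v' : Fin P.n → ℂ),
        P.IsHom (-1) v ∧ P.IsDualInhom M v' ∧
        D.normBra hM v • D.dualPsiMinus m₀ v
          = D.normBraInhom ⟨M, by omega⟩ v' • D.dualPsiPlus m₀ v') ∧
      (∀ (N : ℕ) (hN : N ≤ P.n), ∃ (y : Fin N → ℂ) (y' : Fin P.n → ℂ),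
        P.IsHom 1 y ∧ P.IsDualInhomStar N y' ∧
        D.normBraS hN y • D.dualPsiPlus m₀ y
          = D.normBraSInhom ⟨N, by omega⟩ y' • D.dualPsiMinus m₀ y')) ∧
    (P.Hypothesis2 →
      (∃ u' : Fin P.n → ℂ, P.IsInhom 0 u' ∧
        D.OmMinus = D.normKetInhom 0 u' • D.PsiPlus m₀ u') ∧
      (∃ w' : Fin P.n → ℂ, P.IsInhomStar 0 w' ∧
        D.OmPlus = D.normKetSInhom 0 w' • D.PsiMinus m₀ w')) := by
  -- The homogeneous and the inhomogeneous state are compared through the eigenvector that both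
  -- equal.
  have h1 := fun (M : ℕ) (hM : M ≤ P.n) (u : Fin M → ℂ) (u' : Fin P.n → ℂ)
    (hu : P.IsHom (-1) u) (hu' : P.IsInhom M u') =>
      (D.normKet_smul_PsiMinus_eq hM m₀ hu).trans (D.normKetInhom_smul_PsiPlus hM m₀ hu').symm
  have h2 := fun (N : ℕ) (hN : N ≤ P.n) (w : Fin N → ℂ) (w' : Fin P.n → ℂ)
    (hw : P.IsHom 1 w) (hw' : P.IsInhomStar N w') =>
      (D.normKetS_smul_PsiPlus_eq hN m₀ hw).trans (D.normKetSInhom_smul_PsiMinus hN m₀ hw').symm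
  have h3 := fun (M : ℕ) (hM : M ≤ P.n) (v : Fin M → ℂ) (v' : Fin P.n → ℂ)
    (hv : P.IsHom (-1) v) (hv' : P.IsDualInhom M v') =>
      (D.normBra_smul_dualPsiMinus_eq hM m₀ hv).trans
        (D.normBraInhom_smul_dualPsiPlus hM m₀ hv').symm
  have h4 := fun (N : ℕ) (hN : N ≤ P.n) (y : Fin N → ℂ) (y' : Fin P.n → ℂ)
    (hy : P.IsHom 1 y) (hy' : P.IsDualInhomStar N y') =>
      (D.normBraS_smul_dualPsiPlus_eq hN m₀ hy).trans
        (D.normBraSInhom_smul_dualPsiMinus hN m₀ hy').symm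
  have h5 := fun (u' : Fin P.n → ℂ) (hu' : P.IsInhom 0 u') =>
    (D.normKetInhom_smul_PsiPlus (Nat.zero_le _) m₀ hu').symm
  have h6 := fun (w' : Fin P.n → ℂ) (hw' : P.IsInhomStar 0 w') =>
    (D.normKetSInhom_smul_PsiMinus (Nat.zero_le _) m₀ hw').symm
  refine ⟨h1, h2, h3, h4, h5, h6, fun H H' => ⟨fun M hM => ?_, fun N hN => ?_⟩,
    fun H H' => ⟨fun M hM => ?_, fun N hN => ?_⟩, fun H => ⟨?_, ?_⟩⟩
  · obtain ⟨u, hu⟩ := H.1 M hM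
    obtain ⟨u', hu'⟩ := H'.1 M hM
    exact ⟨u, u', hu, hu', h1 M hM u u' hu hu'⟩
  · obtain ⟨w, hw⟩ := H.2 N hN
    obtain ⟨w', hw'⟩ := H'.2 N hN
    exact ⟨w, w', hw, hw', h2 N hN w w' hw hw'⟩
  · obtain ⟨v, hv⟩ := H.1 M hM
    obtain ⟨v', hv'⟩ := H'.1 M hM
    exact ⟨v, v', hv, hv', h3 M hM v v' hv hv'⟩
  · obtain ⟨y, hy⟩ := H.2 N hN
    obtain ⟨y', hy'⟩ := H'.2 N hN
    exact ⟨y, y', hy, hy', h4 N hN y y' hy hy'⟩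
  · obtain ⟨u', hu'⟩ := H.1 0 (Nat.zero_le _)
    exact ⟨u', hu', h5 u' hu'⟩
  · obtain ⟨w', hw'⟩ := H.2 0 (Nat.zero_le _)
    exact ⟨w', hw', h6 w' hw'⟩
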